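/- Let $\tau>0$, let $\lambda_0,\lambda\in L^\infty(\mathbb R)$ be real-valued, and consider in the real space $L^2(\mathbb R)$ the problem $$u_t+u_{xxx}-u_{xx}+\lambda_0(x)u+\lambda(x)u(x,t-\tau)+u\,u_x=0 \text{ in } \mathbb R\times(0,\infty),\qquad u(x,s)=u_0(x,s)\text{ in }\mathbb R\times[-\tau,0]. \tag{1}$$ The operator $A_{\lambda_0}u=-u_{xxx}+u_{xx}-\lambda_0u$ with domain $H^3(\mathbb R)$ generates a strongly continuous semigroup $(S(t))_{t\ge0}$ on $L^2(\mathbb R)$. For $T>0$ let $$\mathcal B_T=C([0,T];L^2(\mathbb R))\cap L^2(0,T;H^1(\mathbb R)).$$ A mild solution of (1) on $[0,T]$ is a function $u\in\mathcal B_T$ such that, with $u(s)=u_0(s)$ for $s<0$, $$u(t)=S(t)u_0(0)-\int_0^tS(t-s)\lambda u(s-\tau)\,ds-\int_0^tS(t-s)\,u(s)\partial_xu(s)\,ds\qquad\text{for all }t\in[0,T].$$ **Proposition.** For every $u_0\in C([-\tau,0];L^2(\mathbb R))$ there exists $T_0>0$ such that for every $0<T\le T_0$ problem (1) has a unique mild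 solution $u\in\mathcal B_T$ on $[0,T]$. Moreover $u\,\partial_xu\in L^1(0,T;L^2(\mathbb R))$, and for all $t\in[0,T]$ $$\frac12\|u(t)\|_{L^2}^2+\int_0^t\|u_x(s)\|_{L^2}^2\,ds+\int_0^t\!\int_{\mathbb R}\lambda_0(x)u(x,s)^2\,dx\,ds+\int_0^t\!\int_{\mathbb R}\lambda(x)u(x,s-\tau)u(x,s)\,dx\,ds=\frac12\|u(0)\|_{L^2}^2 .$$ -/

import Mathlib

open MeasureTheory Set Filter Topology
open scoped ENNReal ContDiff

noncomputable section

/-- The real Hilbert space `L²(ℝ)`. -/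
abbrev L2R : Type := Lp ℝ 2 (volume : Measure ℝ)

/-- The space `L^∞(ℝ)` of the coefficients. -/
abbrev LinfR : Type := Lp ℝ ∞ (volume : Measure ℝ)

/-- `g` is the weak (distributional) derivative of `f`, both in `L²(ℝ)`:
`∫ f φ' = - ∫ g φ` for all real test functions `φ`. -/
def HasWeakDerivL2 (f g : L2R) : Prop :=
  ∀ φ : ℝ → ℝ, ContDiff ℝ ∞ φ → HasCompactSupport φ →
    ∫ x, f x * deriv φ x = - ∫ x, g x * φ x

/-- `f ∈ H¹(ℝ)`. -/
def MemH1 (f : L2R) : Prop := ∃ g : L2R, HasWeakDerivL2 f g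

/-- A weak derivative is unique. -/
theorem HasWeakDerivL2.unique {f g g' : L2R} (h : HasWeakDerivL2 f g)
    (h' : HasWeakDerivL2 f g') : g = g' := by
  apply Lp.ext
  refine ae_eq_of_integral_contDiff_smul_eq
    ((Lp.memLp g).locallyIntegrable (by norm_num))
    ((Lp.memLp g').locallyIntegrable (by norm_num)) ?_
  intro φ hφ hc
  have e := (h φ hφ hc).symm.trans (h' φ hφ hc)
  simp only [smul_eq_mul, mul_comm (φ _)]
  linarith

open Classical in
/-- The weak derivative `∂ₓ f` of `f ∈ H¹(ℝ)` (and `0` for the other elements of `L²(ℝ)`). -/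
def weakDeriv (f : L2R) : L2R := if h : MemH1 f then h.choose else 0

theorem HasWeakDerivL2.weakDeriv_eq {f g : L2R} (h : HasWeakDerivL2 f g) :
    weakDeriv f = g := by
  have hf : MemH1 f := ⟨g, h⟩
  rw [weakDeriv, dif_pos hf]
  exact hf.choose_spec.unique h

/-- Multiplication of an `L²` function by an `L^∞` coefficient. -/
def coeffMul (c : LinfR) (f : L2R) : L2R := c • f

open Classical in
/-- The pointwise product `f g`, as an element of `L²(ℝ)`, of two `L²` functions whose product
belongs to `L²(ℝ)` (for instance `f ∈ H¹(ℝ)`, which is bounded, and `g ∈ L²(ℝ)`). -/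
def mulL2 (f g : L2R) : L2R :=
  if h : MemLp (fun x => f x * g x) 2 (volume : Measure ℝ) then h.toLp _ else 0

/-- The graph of the operator `A u = - u_xxx + u_xx - c u` with domain `H³(ℝ)`:
`f ∈ H³(ℝ)` and `A f = g`. -/
def KdVBurgersGraph (c : LinfR) (f g : L2R) : Prop :=
  ∃ f₁ f₂ f₃ : L2R, HasWeakDerivL2 f f₁ ∧ HasWeakDerivL2 f₁ f₂ ∧ HasWeakDerivL2 f₂ f₃ ∧
    g = - f₃ + f₂ - coeffMul c f

/-- `S(t)`, `t ≥ 0`, is a strongly continuous semigroup of bounded linear operators on `L²(ℝ)`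
(the values `S(t)` for `t < 0` are irrelevant). -/
structure IsC0Semigroup (S : ℝ → L2R →L[ℝ] L2R) : Prop where
  zero : S 0 = ContinuousLinearMap.id ℝ L2R
  add : ∀ s t : ℝ, 0 ≤ s → 0 ≤ t → S (s + t) = (S s).comp (S t)
  tendsto : ∀ f : L2R, Tendsto (fun t : ℝ => S t f) (𝓝[>] 0) (𝓝 f)

/-- The infinitesimal generator of `S`, with its natural domain, is the operator with graph `G`. -/
def HasGenerator (S : ℝ → L2R →L[ℝ] L2R) (G : L2R → L2R → Prop) : Prop :=
  ∀ f g : L2R, Tendsto (fun t : ℝ => t⁻¹ • (S t f - f)) (𝓝[>] 0) (𝓝 g) ↔ G f g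

/-- `u ∈ C([0,T]; L²(ℝ)) ∩ L²(0,T; H¹(ℝ))`. Only the values on `[0,T]` matter. -/
structure MemBT (T : ℝ) (u : ℝ → L2R) : Prop where
  continuousOn : ContinuousOn u (Icc 0 T)
  memH1 : ∀ᵐ s ∂(volume.restrict (Icc 0 T)), MemH1 (u s)
  memLp : MemLp (fun s => weakDeriv (u s)) 2 (volume.restrict (Icc 0 T))

/-- The delayed function `s ↦ u(s - τ)`, `s ≥ 0`, where `u = u₀` at negative times. -/
def delayed (τ : ℝ) (u₀ u : ℝ → L2R) (s : ℝ) : L2R :=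
  if s < τ then u₀ (s - τ) else u (s - τ)

/-- Given the semigroup `S` generated by `- ∂ₓ³ + ∂ₓ² - λ₀`, `u` is a mild solution on `[0,T]` of
`u_t + u_xxx - u_xx + λ₀ u + lam u(t - τ) + u u_x = 0` with history `u₀` on `[-τ,0]`. -/
structure IsMildSolution (S : ℝ → L2R →L[ℝ] L2R) (lam : LinfR) (τ : ℝ) (u₀ : ℝ → L2R)
    (T : ℝ) (u : ℝ → L2R) : Prop where
  memBT : MemBT T u
  eqn : ∀ t ∈ Icc 0 T, u t = S t (u₀ 0)
      - (∫ s in (0 : ℝ)..t, S (t - s) (coeffMul lam (delayed τ u₀ u s)))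
      - ∫ s in (0 : ℝ)..t, S (t - s) (mulL2 (u s) (weakDeriv (u s)))

/-- The energy identity at time `t`. -/
def EnergyIdentity (lam₀ lam : LinfR) (τ : ℝ) (u₀ u : ℝ → L2R) (t : ℝ) : Prop :=
  1 / 2 * ‖u t‖ ^ 2 + (∫ s in (0 : ℝ)..t, ‖weakDeriv (u s)‖ ^ 2)
    + (∫ s in (0 : ℝ)..t, ∫ x, lam₀ x * u s x ^ 2)
    + (∫ s in (0 : ℝ)..t, ∫ x, lam x * delayed τ u₀ u s x * u s x)
    = 1 / 2 * ‖u 0‖ ^ 2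

end

/-! For T < τ the delayed term on [0,T] only sees the history, so it is a known continuous forcing
h, and the problem becomes u' = Au + h − u uₓ. The tool for this equation is a linear statement with
rough forcing: if F ∈ L¹(0,T;L²), the mild solution of u' = Au + F belongs to B_T and satisfies the
energy identity (`memBT_and_energy_of_mild`). To prove it, the mild formula is projected to
frequencies |ξ| ≤ n, where A is bounded. This gives an integral equation (`cutoff_mild`), to which
the Hilbert space product rule applies (`cutoff_energy`). As n → ∞ the dissipation integrals
increase to a finite limit, which yields uₓ and the identity together.

Agmon's inequality gives ‖f g‖ ≤ (θ⁻¹‖f‖ + θ‖f'‖)‖g‖, so u uₓ has L¹(0,T;L²) norm at most θ⁻¹√T + θ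
times the square of a bound on u in B_T. Taking θ small and then T small, the map from G to the
solution u_G with forcing h − G, and on to u_G ∂ₓu_G, contracts the unit ball of L¹(0,T;L²)
(`exists_mild_convection`). Uniqueness holds in all of B_T, with no smallness: the linear energy
identity for the difference of two solutions, with the derivative absorbed by the dissipation, leads
to Grönwall with an integrable coefficient (`eqOn_of_mild_convection`). The energy identity for u is
the linear one with F = h − u uₓ, because ∫ u² uₓ dx = 0 (`HasWeakDerivL2.integral_sq_mul_eq_zero`).

The semigroup itself is constructed. The operator −∂³ + ∂² is a Fourier multiplier whose symbol has
nonpositive real part, and the bounded term λ₀ is added through a Volterra equation. Real functions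
correspond to Hermitian transforms, so the Fourier analysis stays within the real space. -/

noncomputable section

/-! ### Fourier transform on real L², and weak derivatives as multipliers -/

section RealFourier

open scoped FourierTransform ComplexConjugate

/-- The complex Hilbert space `L²(ℝ; ℂ)`. -/
abbrev L2C : Type := Lp ℂ 2 (volume : Measure ℝ)

/-- The embedding of real into complex square integrable functions. -/
def ofRealL2 : L2R →ₗᵢ[ℝ] L2C where
  toLinearMap := (Complex.ofRealCLM.compLpL 2 volume : L2R →L[ℝ] L2C).toLinearMap
  norm_map' f := by
    have h : (Complex.ofRealCLM.compLpL 2 volume f : L2C) =ᵐ[volume] fun x => (f x : ℂ) :=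
      ContinuousLinearMap.coeFn_compLpL _ _
    change ‖(Complex.ofRealCLM.compLpL 2 volume f : L2C)‖ = ‖f‖
    rw [Lp.norm_def, Lp.norm_def]
    congr 1
    apply eLpNorm_congr_norm_ae
    filter_upwards [h] with x hx
    simp [hx]

theorem coeFn_ofRealL2 (f : L2R) : ofRealL2 f =ᵐ[volume] fun x => (f x : ℂ) :=
  ContinuousLinearMap.coeFn_compLpL _ _

/-- Pointwise complex conjugation on `L²(ℝ; ℂ)`. -/
def conjL2 : L2C →L[ℝ] L2C := (Complex.conjCLE.toContinuousLinearMap).compLpL 2 volume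

theorem coeFn_conjL2 (f : L2C) : conjL2 f =ᵐ[volume] fun x => conj (f x) :=
  ContinuousLinearMap.coeFn_compLpL _ _

/-- The reflection `f ↦ f(-·)` on `L²(ℝ; ℂ)`. -/
def reflL2 : L2C →ₗᵢ[ℝ] L2C :=
  Lp.compMeasurePreservingₗᵢ ℝ Neg.neg (Measure.measurePreserving_neg volume)

theorem coeFn_reflL2 (f : L2C) : reflL2 f =ᵐ[volume] fun x => f (-x) :=
  Lp.coeFn_compMeasurePreserving f (Measure.measurePreserving_neg volume)

theorem ae_neg_real {p : ℝ → Prop} (h : ∀ᵐ x, p x) : ∀ᵐ x, p (-x) :=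
  (Measure.measurePreserving_neg (volume : Measure ℝ)).quasiMeasurePreserving.ae h

/-- Both sides are continuous in f, so Schwartz functions suffice. For these, conjugating the
Fourier integral flips the sign of the frequency. -/
theorem fourier_conjL2 (f : L2C) : 𝓕 (conjL2 f) = conjL2 (reflL2 (𝓕 f)) := by
  apply DenseRange.induction_on
    (p := fun f : L2C => 𝓕 (conjL2 f) = conjL2 (reflL2 (𝓕 f)))
    (SchwartzMap.denseRange_toLpCLM (E := ℝ) (F := ℂ) (p := 2) (μ := volume)
      ENNReal.ofNat_ne_top) f
  · apply isClosed_eq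
    · exact (Lp.fourierTransformₗᵢ ℝ ℂ).continuous.comp conjL2.continuous
    · exact conjL2.continuous.comp (reflL2.continuous.comp
        (Lp.fourierTransformₗᵢ ℝ ℂ).continuous)
  intro ψ
  rw [SchwartzMap.toLpCLM_apply]
  have e : conjL2 (ψ.toLp 2) =
      (ψ.postcompCLM (Complex.conjCLE.toContinuousLinearMap : ℂ →L[ℝ] ℂ)).toLp 2 := by
    apply Lp.ext
    filter_upwards [coeFn_conjL2 (ψ.toLp 2), ψ.coeFn_toLp 2,
      (ψ.postcompCLM (Complex.conjCLE.toContinuousLinearMap : ℂ →L[ℝ] ℂ)).coeFn_toLp 2]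
      with x h1 h2 h3
    rw [h1, h2, h3]
    simp
  rw [e, SchwartzMap.toLp_fourier_eq, SchwartzMap.toLp_fourier_eq]
  apply Lp.ext
  filter_upwards [coeFn_conjL2 (reflL2 ((𝓕 ψ).toLp 2)), coeFn_reflL2 ((𝓕 ψ).toLp 2),
    ae_neg_real (p := fun x => (𝓕 ψ).toLp 2 volume x = (𝓕 ψ) x) ((𝓕 ψ).coeFn_toLp 2 volume),
    (𝓕 (ψ.postcompCLM (Complex.conjCLE.toContinuousLinearMap : ℂ →L[ℝ] ℂ))).coeFn_toLp 2]
    with x h1 h2 h3 h4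
  rw [h1, h2, h3, h4, SchwartzMap.fourier_coe, SchwartzMap.fourier_coe, Real.fourier_eq,
    Real.fourier_eq, ← integral_conj]
  congr 1
  ext v
  simp [Circle.smul_def, ← Circle.coe_inv_eq_conj, AddChar.map_neg_eq_inv]

/-- The Fourier transform of a real square integrable function. -/
def realFourier : L2R →ₗᵢ[ℝ] L2C where
  toFun f := 𝓕 (ofRealL2 f)
  map_add' f g := by
    rw [map_add]; exact (Lp.fourierTransformₗᵢ ℝ ℂ).map_add _ _
  map_smul' c f := by
    rw [map_smul]; exact ((Lp.fourierTransformₗᵢ ℝ ℂ : L2C →ₗ[ℂ] L2C).restrictScalars ℝ).map_smul _ _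
  norm_map' f := by
    change ‖𝓕 (ofRealL2 f)‖ = ‖f‖
    rw [Lp.norm_fourier_eq, LinearIsometry.norm_map]

theorem realFourier_neg (f : L2R) : ∀ᵐ ξ, realFourier f (-ξ) = conj (realFourier f ξ) := by
  have h0 : conjL2 (ofRealL2 f) = ofRealL2 f := by
    apply Lp.ext
    filter_upwards [coeFn_conjL2 (ofRealL2 f), coeFn_ofRealL2 f] with x h1 h2
    rw [h1, h2, Complex.conj_ofReal]
  have h := fourier_conjL2 (ofRealL2 f)
  rw [h0] at h
  change realFourier f = conjL2 (reflL2 (realFourier f)) at h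
  have h3 : realFourier f =ᵐ[volume] conjL2 (reflL2 (realFourier f)) := by rw [← h]
  filter_upwards [h3, coeFn_conjL2 (reflL2 (realFourier f)), coeFn_reflL2 (realFourier f)]
    with ξ h1 h2 h4
  rw [h1, h2, h4, Complex.conj_conj]

/-- By `fourier_conjL2` the inverse transform of a Hermitian k is fixed by conjugation, hence real.
This lets multipliers with Hermitian symbols act on the real space. -/
theorem exists_realFourier_eq (k : L2C) (hk : ∀ᵐ ξ, k (-ξ) = conj (k ξ)) :
    ∃ f : L2R, realFourier f = k := by
  set h : L2C := 𝓕⁻ k with hh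
  have hF : 𝓕 h = k := FourierTransform.fourier_fourierInv_eq k
  have hc : conjL2 (reflL2 k) = k := by
    apply Lp.ext
    filter_upwards [hk, coeFn_conjL2 (reflL2 k), coeFn_reflL2 k] with ξ h1 h2 h3
    rw [h2, h3, h1, Complex.conj_conj]
  have hreal : conjL2 h = h := by
    apply (Lp.fourierTransformₗᵢ ℝ ℂ).injective
    change 𝓕 (conjL2 h) = 𝓕 h
    rw [fourier_conjL2, hF, hc]
  refine ⟨Complex.reCLM.compLpL 2 volume h, ?_⟩
  change 𝓕 (ofRealL2 _) = k
  rw [← hF]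
  congr 1
  apply Lp.ext
  have h4 : h =ᵐ[volume] conjL2 h := by rw [hreal]
  filter_upwards [coeFn_ofRealL2 (Complex.reCLM.compLpL 2 volume h),
    (ContinuousLinearMap.coeFn_compLpL (Complex.reCLM) h : _ =ᵐ[volume] _), h4, coeFn_conjL2 h]
    with x h1 h2 h3 h5
  rw [h1, h2]
  rw [h5] at h3
  exact Complex.conj_eq_iff_re.1 h3.symm

theorem integral_ofReal_mul_schwartz (f : L2R) (ψ : SchwartzMap ℝ ℂ) :
    ∫ x, (f x : ℂ) * ψ x = ∫ ξ, conj (realFourier f ξ) * (𝓕 ψ) ξ := by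
  have h := Lp.inner_fourier_eq (ofRealL2 f) (ψ.toLp 2)
  rw [SchwartzMap.toLp_fourier_eq, L2.inner_def, L2.inner_def] at h
  calc ∫ x, (f x : ℂ) * ψ x = ∫ x, inner ℂ (ofRealL2 f x) (ψ.toLp 2 volume x) := by
        apply integral_congr_ae
        filter_upwards [coeFn_ofRealL2 f, ψ.coeFn_toLp 2] with x h1 h2
        rw [h1, h2]; simp [mul_comm]
    _ = _ := by
        rw [← h]
        apply integral_congr_ae
        filter_upwards [(𝓕 ψ).coeFn_toLp 2] with x h2
        rw [h2]; simp [realFourier, mul_comm]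

/-- Compact support of the test function is removed by the cutoffs χ(cₙ x) with cₙ → 0. The
derivative falling on the cutoff costs a factor cₙ, and dominated convergence does the rest. The
extension is needed for Schwartz functions whose transform, rather than themselves, has compact
support. -/
theorem HasWeakDerivL2.integral_mul_deriv {f g : L2R} (h : HasWeakDerivL2 f g) {φ : ℝ → ℝ}
    (hφ : ContDiff ℝ ∞ φ) (h2 : MemLp φ 2 volume) (h2' : MemLp (deriv φ) 2 volume) :
    ∫ x, f x * deriv φ x = - ∫ x, g x * φ x := by
  let χ : ContDiffBump (0 : ℝ) := ⟨1, 2, by norm_num, by norm_num⟩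
  have hχ : ContDiff ℝ ∞ χ := χ.contDiff
  have hcs : HasCompactSupport (deriv χ) := χ.hasCompactSupport.deriv
  obtain ⟨C, hC⟩ := hcs.exists_bound_of_continuous (hχ.continuous_deriv (by simp))
  let c : ℕ → ℝ := fun n => ((n : ℝ) + 1)⁻¹
  have hc0 : ∀ n, 0 < c n := fun n => by positivity
  have hc1 : ∀ n, c n ≤ 1 := fun n => inv_le_one_of_one_le₀ (by simp)
  have hcl : Tendsto c atTop (𝓝 0) := by
    simpa [c] using tendsto_one_div_add_atTop_nhds_zero_nat (𝕜 := ℝ)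
  have hd : Differentiable ℝ φ := hφ.differentiable (by simp)
  have hχd : Differentiable ℝ χ := hχ.differentiable (by simp)
  have hder : ∀ n x, deriv (fun x => χ (c n * x) * φ x) x =
      deriv χ (c n * x) * c n * φ x + χ (c n * x) * deriv φ x := by
    intro n x
    have h1 : HasDerivAt (fun x => χ (c n * x)) (deriv χ (c n * x) * c n) x := by
      have := (hχd (c n * x)).hasDerivAt.comp x ((hasDerivAt_id x).const_mul (c n))
      simpa [Function.comp_def] using this
    exact (h1.mul (hd x).hasDerivAt).deriv
  have key : ∀ n, ∫ x, f x * (deriv χ (c n * x) * c n * φ x + χ (c n * x) * deriv φ x) =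
      - ∫ x, g x * (χ (c n * x) * φ x) := by
    intro n
    have := h (fun x => χ (c n * x) * φ x) ((hχ.comp (contDiff_const.mul contDiff_id)).mul hφ) ?_
    · simpa only [hder] using this
    · apply HasCompactSupport.mul_right
      exact χ.hasCompactSupport.comp_homeomorph (Homeomorph.mulLeft₀ (c n) (hc0 n).ne')
  have hlim : ∀ x, Tendsto (fun n => χ (c n * x)) atTop (𝓝 1) := by
    intro x
    have h1 : Tendsto (fun n => c n * x) atTop (𝓝 0) := by simpa using hcl.mul_const x
    have := (hχ.continuous.tendsto 0).comp h1
    rwa [χ.one_of_mem_closedBall (by simp [χ])] at this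
  have hb : ∀ y, |χ y| ≤ 1 := fun y => by rw [abs_of_nonneg (χ.nonneg' y)]; exact χ.le_one
  have L1 : Tendsto (fun n => ∫ x, f x * (deriv χ (c n * x) * c n * φ x + χ (c n * x) * deriv φ x))
      atTop (𝓝 (∫ x, f x * deriv φ x)) := by
    apply tendsto_integral_of_dominated_convergence
      (fun x => |C| * |f x * φ x| + |f x * deriv φ x|)
    · intro n
      apply (Lp.aestronglyMeasurable f).mul
      apply Continuous.aestronglyMeasurable
      have := hχ.continuous_deriv (n := ∞) (by simp)
      have := hφ.continuous_deriv (n := ∞) (by simp)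
      have := hχ.continuous
      have := hφ.continuous
      fun_prop
    · exact ((MemLp.integrable_mul (p := 2) (q := 2) (Lp.memLp f) h2).abs.const_mul _).add
        (MemLp.integrable_mul (p := 2) (q := 2) (Lp.memLp f) h2').abs
    · intro n
      refine Eventually.of_forall fun x => ?_
      have h3 : |deriv χ (c n * x) * c n| ≤ |C| := by
        rw [abs_mul, abs_of_pos (hc0 n)]
        calc _ ≤ |deriv χ (c n * x)| * 1 := by gcongr; exact hc1 n
          _ ≤ |C| := by rw [mul_one]; exact (hC _).trans (le_abs_self C)
      have h4 : |χ (c n * x)| ≤ 1 := hb _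
      rw [mul_add, Real.norm_eq_abs]
      refine (abs_add_le _ _).trans ?_
      apply add_le_add
      · calc |f x * (deriv χ (c n * x) * c n * φ x)|
            = |deriv χ (c n * x) * c n| * |f x * φ x| := by rw [← abs_mul]; ring_nf
          _ ≤ _ := by gcongr
      · calc |f x * (χ (c n * x) * deriv φ x)| = |χ (c n * x)| * |f x * deriv φ x| := by
              rw [← abs_mul]; ring_nf
          _ ≤ 1 * |f x * deriv φ x| := by gcongr
          _ = _ := one_mul _
    · refine Eventually.of_forall fun x => ?_
      have h5 : Tendsto (fun n => deriv χ (c n * x) * c n) atTop (𝓝 0) := by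
        apply squeeze_zero_norm (a := fun n => C * c n) _ (by simpa using hcl.const_mul C)
        intro n
        rw [norm_mul, Real.norm_of_nonneg (hc0 n).le]
        exact mul_le_mul_of_nonneg_right (hC _) (hc0 n).le
      have := ((h5.mul_const (φ x)).add ((hlim x).mul_const (deriv φ x))).const_mul (f x)
      simpa using this
  have L2 : Tendsto (fun n => - ∫ x, g x * (χ (c n * x) * φ x)) atTop (𝓝 (- ∫ x, g x * φ x)) := by
    apply Tendsto.neg
    apply tendsto_integral_of_dominated_convergence (fun x => |g x * φ x|)
    · intro n
      apply (Lp.aestronglyMeasurable g).mul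
      apply Continuous.aestronglyMeasurable
      have := hχ.continuous
      have := hφ.continuous
      fun_prop
    · exact (MemLp.integrable_mul (p := 2) (q := 2) (Lp.memLp g) h2).abs
    · intro n
      refine Eventually.of_forall fun x => ?_
      calc |g x * (χ (c n * x) * φ x)| = |χ (c n * x)| * |g x * φ x| := by
              rw [← abs_mul]; ring_nf
          _ ≤ 1 * |g x * φ x| := by gcongr; exact hb _
          _ = _ := one_mul _
    · refine Eventually.of_forall fun x => ?_
      simpa using ((hlim x).mul_const (φ x)).const_mul (g x)
  simp only [key] at L1
  exact tendsto_nhds_unique L1 L2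

theorem integrable_ofReal_mul_schwartz (f : L2R) (ψ : SchwartzMap ℝ ℂ) :
    Integrable (fun x => (f x : ℂ) * ψ x) :=
  MemLp.integrable_mul (p := 2) (q := 2) (Lp.memLp f).ofReal (ψ.memLp 2)

theorem HasWeakDerivL2.integral_schwartz {f g : L2R} (h : HasWeakDerivL2 f g)
    (ψ : SchwartzMap ℝ ℂ) : ∫ x, (f x : ℂ) * deriv ψ x = - ∫ x, (g x : ℂ) * ψ x := by
  have key : ∀ L : ℂ →L[ℝ] ℝ,
      ∫ x, f x * L (deriv ψ x) = - ∫ x, g x * L (ψ x) := by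
    intro L
    have hd : deriv (ψ.postcompCLM L) = fun x => L (deriv ψ x) := by
      ext x
      exact (L.hasFDerivAt.comp_hasDerivAt x (ψ.hasDerivAt x)).deriv
    have hm : MemLp (deriv (ψ.postcompCLM L)) 2 volume := by
      have := (SchwartzMap.derivCLM ℝ ℝ (ψ.postcompCLM L)).memLp 2 volume
      exact this
    have := h.integral_mul_deriv (φ := ψ.postcompCLM L) (ψ.postcompCLM L).smooth'
      ((ψ.postcompCLM L).memLp 2) hm
    rw [hd] at this
    simpa using this
  have hi1 := integrable_ofReal_mul_schwartz f (SchwartzMap.derivCLM ℝ ℂ ψ)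
  have hi2 := integrable_ofReal_mul_schwartz g ψ
  have hre := key Complex.reCLM
  have him := key Complex.imCLM
  have e1 : ∀ (L : ℂ →L[ℝ] ℝ) (hL : ∀ (r : ℝ) (z : ℂ), L (r * z) = r * L z),
      L (∫ x, (f x : ℂ) * deriv ψ x) = ∫ x, f x * L (deriv ψ x) := by
    intro L hL
    simp only [← hL]
    exact (L.integral_comp_comm hi1).symm
  have e2 : ∀ (L : ℂ →L[ℝ] ℝ) (hL : ∀ (r : ℝ) (z : ℂ), L (r * z) = r * L z),
      L (∫ x, (g x : ℂ) * ψ x) = ∫ x, g x * L (ψ x) := by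
    intro L hL
    simp only [← hL]
    exact (L.integral_comp_comm hi2).symm
  apply Complex.ext
  · rw [Complex.neg_re]
    exact (e1 Complex.reCLM (by simp)).trans (hre.trans (congrArg Neg.neg (e2 Complex.reCLM (by simp)).symm))
  · rw [Complex.neg_im]
    exact (e1 Complex.imCLM (by simp)).trans (him.trans (congrArg Neg.neg (e2 Complex.imCLM (by simp)).symm))

theorem fourier_derivCLM_apply (ψ : SchwartzMap ℝ ℂ) (ξ : ℝ) :
    𝓕 (SchwartzMap.derivCLM ℝ ℂ ψ) ξ = (2 * Real.pi * Complex.I * ξ) * 𝓕 ψ ξ := by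
  rw [SchwartzMap.fourier_coe, SchwartzMap.fourier_coe]
  have := Real.fourier_deriv ψ.integrable ψ.differentiable
    (SchwartzMap.derivCLM ℝ ℂ ψ).integrable
  have := congrFun this ξ
  rw [smul_eq_mul] at this
  exact this

/-- The symbol of the derivative. -/
def derivSymbol (ξ : ℝ) : ℂ := 2 * Real.pi * Complex.I * ξ

theorem continuous_derivSymbol : Continuous derivSymbol := by
  unfold derivSymbol; fun_prop

theorem conj_derivSymbol (ξ : ℝ) : conj (derivSymbol ξ) = - derivSymbol ξ := by
  simp [derivSymbol, Complex.conj_ofNat]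

theorem derivSymbol_neg (ξ : ℝ) : derivSymbol (-ξ) = - derivSymbol ξ := by
  simp [derivSymbol]

/-- Plancherel moves the defining identity to the frequency side. In one direction the test
functions are the inverse transforms of all smooth compactly supported η, which identify the
transform of g almost everywhere. In the other a compactly supported φ is itself Schwartz. -/
theorem hasWeakDerivL2_iff {f g : L2R} :
    HasWeakDerivL2 f g ↔ ∀ᵐ ξ, realFourier g ξ = derivSymbol ξ * realFourier f ξ := by
  constructor
  · intro h
    have hloc : ∀ k : L2C, LocallyIntegrable k := fun k =>
      (Lp.memLp k).locallyIntegrable (by norm_num)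
    have hconj : ∀ k : L2C, LocallyIntegrable (fun ξ => conj (k ξ)) := fun k =>
      (Lp.memLp k).star.locallyIntegrable (by norm_num)
    have hmain : ∀ᵐ ξ, conj (realFourier g ξ) = - derivSymbol ξ * conj (realFourier f ξ) := by
      apply ae_eq_of_integral_contDiff_smul_eq (hconj _)
      · exact LocallyIntegrable.continuous_mul continuous_derivSymbol.neg (hconj _)
      intro η hη hcη
      have hcη' : HasCompactSupport (fun x => (η x : ℂ)) :=
        hcη.comp_left (g := ((↑) : ℝ → ℂ)) Complex.ofReal_zero
      let η' : SchwartzMap ℝ ℂ := hcη'.toSchwartzMap (Complex.ofRealCLM.contDiff.comp hη)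
      have hη' : ∀ x, η' x = η x := fun x => rfl
      have h1 := h.integral_schwartz (𝓕⁻ η')
      have h2 := integral_ofReal_mul_schwartz f (SchwartzMap.derivCLM ℝ ℂ (𝓕⁻ η'))
      have h3 := integral_ofReal_mul_schwartz g (𝓕⁻ η')
      simp only [fourier_derivCLM_apply, FourierTransform.fourier_fourierInv_eq] at h2 h3
      rw [h3] at h1
      have h4 : ∫ ξ, conj (realFourier g ξ) * η' ξ =
          - ∫ ξ, conj (realFourier f ξ) * (2 * Real.pi * Complex.I * ξ * η' ξ) := by
        rw [← h2, eq_neg_iff_add_eq_zero, add_comm, ← eq_neg_iff_add_eq_zero]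
        exact h1
      rw [← integral_neg] at h4
      calc _ = ∫ ξ, conj (realFourier g ξ) * η' ξ := by
            congr 1; ext ξ; rw [hη', Complex.real_smul]; ring
        _ = _ := by
            rw [h4]; congr 1; ext ξ; rw [hη', Complex.real_smul, derivSymbol]; ring
    filter_upwards [hmain] with ξ hξ
    rw [← Complex.conj_conj (realFourier g ξ), hξ, map_mul, map_neg, conj_derivSymbol]
    simp
  · intro h φ hφ hcφ
    have hcφ' : HasCompactSupport (fun x => (φ x : ℂ)) :=
      hcφ.comp_left (g := ((↑) : ℝ → ℂ)) Complex.ofReal_zero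
    let φ' : SchwartzMap ℝ ℂ := hcφ'.toSchwartzMap (Complex.ofRealCLM.contDiff.comp hφ)
    have hφ' : ∀ x, φ' x = φ x := fun x => rfl
    have hdφ' : ∀ x, SchwartzMap.derivCLM ℝ ℂ φ' x = (deriv φ x : ℝ) := fun x =>
      ((hφ.differentiable (by simp) x).hasDerivAt.ofReal_comp).deriv
    have h2 := integral_ofReal_mul_schwartz f (SchwartzMap.derivCLM ℝ ℂ φ')
    have h3 := integral_ofReal_mul_schwartz g φ'
    have h4 : ∫ ξ, conj (realFourier f ξ) * 𝓕 (SchwartzMap.derivCLM ℝ ℂ φ') ξ =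
        - ∫ ξ, conj (realFourier g ξ) * 𝓕 φ' ξ := by
      rw [← integral_neg]
      apply integral_congr_ae
      filter_upwards [h] with ξ hξ
      rw [hξ, fourier_derivCLM_apply, map_mul, conj_derivSymbol, derivSymbol]
      ring
    rw [← h2, ← h3] at h4
    simp only [hdφ', hφ', ← Complex.ofReal_mul, integral_complex_ofReal, ← Complex.ofReal_neg] at h4
    exact Complex.ofReal_injective h4

end RealFourier

/-! ### Fubini on a triangle -/

section Triangle

/-- Exchange of the order of integration over a triangle. -/
theorem intervalIntegral_triangle_swap {E : Type*} [NormedAddCommGroup E] [NormedSpace ℝ E]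
    {a b : ℝ} (hab : a ≤ b) (K : ℝ → ℝ → E)
    (hK : Integrable (Function.uncurry K)
      ((volume.restrict (Ioc a b)).prod (volume.restrict (Ioc a b)))) :
    ∫ r in a..b, ∫ s in a..r, K r s = ∫ s in a..b, ∫ r in s..b, K r s := by
  set μ : Measure ℝ := volume.restrict (Ioc a b)
  let K' : ℝ → ℝ → E := fun r s => {p : ℝ × ℝ | p.2 ≤ p.1}.indicator (Function.uncurry K) (r, s)
  have hm : MeasurableSet {p : ℝ × ℝ | p.2 ≤ p.1} := measurableSet_le measurable_snd measurable_fst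
  have hK' : Integrable (Function.uncurry K') (μ.prod μ) := hK.indicator hm
  have h := integral_integral_swap hK'
  rw [intervalIntegral.integral_of_le hab, intervalIntegral.integral_of_le hab]
  calc _ = ∫ r, ∫ s, K' r s ∂μ ∂μ := by
        apply setIntegral_congr_fun measurableSet_Ioc
        intro r hr
        change ∫ s in a..r, K r s = ∫ s, K' r s ∂μ
        have e : K' r = (Iic r).indicator (K r) := by
          ext s; simp only [K', indicator]; simp
        rw [e, integral_indicator measurableSet_Iic, Measure.restrict_restrict measurableSet_Iic,
          intervalIntegral.integral_of_le hr.1.le]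
        congr 2
        ext s
        simp only [mem_Ioc, mem_inter_iff, mem_Iic]
        have := hr.2
        grind
    _ = ∫ s, ∫ r, K' r s ∂μ ∂μ := h
    _ = _ := by
        apply setIntegral_congr_fun measurableSet_Ioc
        intro s hs
        change ∫ r, K' r s ∂μ = ∫ r in s..b, K r s
        have e : (fun r => K' r s) = (Ici s).indicator (fun r => K r s) := by
          ext r; simp only [K', indicator]; simp
        rw [e, integral_indicator measurableSet_Ici, Measure.restrict_restrict measurableSet_Ici,
          intervalIntegral.integral_of_le hs.2, ← integral_Icc_eq_integral_Ioc]
        congr 2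
        ext r
        simp only [mem_Ioc, mem_inter_iff, mem_Ici, mem_Icc]
        have := hs.1
        grind

end Triangle

/-! ### Product rule for Hilbert space valued primitives -/

section ProductRule

variable {H : Type*} [NormedAddCommGroup H] [InnerProductSpace ℝ H]

theorem integrable_inner_prod {g h : ℝ → H} {μ ν : Measure ℝ} [SFinite μ] [SFinite ν]
    (hg : Integrable g μ) (hh : Integrable h ν) :
    Integrable (fun p : ℝ × ℝ => inner ℝ (g p.1) (h p.2)) (μ.prod ν) := by
  refine (hg.norm.mul_prod hh.norm).mono' ?_ (Eventually.of_forall fun p => norm_inner_le_norm _ _)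
  exact hg.aestronglyMeasurable.comp_fst.inner hh.aestronglyMeasurable.comp_snd

theorem intervalIntegral_inner [CompleteSpace H] {f : ℝ → H} {a b : ℝ}
    (hf : IntervalIntegrable f volume a b) (c : H) :
    ∫ s in a..b, inner ℝ c (f s) = inner ℝ c (∫ s in a..b, f s) :=
  (innerSL ℝ c).intervalIntegral_comp_comm hf

/-- Product rule for indefinite integrals with values in a Hilbert space. -/
theorem inner_add_integral_eq [CompleteSpace H] {a b : ℝ} (hab : a ≤ b) {g h y z : ℝ → H}
    (hg : IntegrableOn g (Ioc a b)) (hh : IntegrableOn h (Ioc a b))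
    (hy : ∀ t ∈ Icc a b, y t = y a + ∫ s in a..t, g s)
    (hz : ∀ t ∈ Icc a b, z t = z a + ∫ s in a..t, h s) :
    inner ℝ (y b) (z b) = inner ℝ (y a) (z a) +
      ∫ s in a..b, (inner ℝ (y s) (h s) + inner ℝ (g s) (z s)) := by
  have hgi : IntervalIntegrable g volume a b :=
    (intervalIntegrable_iff_integrableOn_Ioc_of_le hab).2 hg
  have hhi : IntervalIntegrable h volume a b :=
    (intervalIntegrable_iff_integrableOn_Ioc_of_le hab).2 hh
  have hu : uIcc a b = Icc a b := uIcc_of_le hab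
  have cG : ContinuousOn (fun t => ∫ s in a..t, g s) (uIcc a b) :=
    intervalIntegral.continuousOn_primitive_interval'
      hgi left_mem_uIcc
  have cH : ContinuousOn (fun t => ∫ s in a..t, h s) (uIcc a b) :=
    intervalIntegral.continuousOn_primitive_interval'
      hhi left_mem_uIcc
  have cont_inner : ∀ {p q : ℝ → H}, ContinuousOn p (uIcc a b) → IntervalIntegrable q volume a b →
      IntervalIntegrable (fun s => inner ℝ (p s) (q s)) volume a b := by
    intro p q hp hq
    rw [intervalIntegrable_iff] at hq ⊢
    obtain ⟨C, hC⟩ := isCompact_uIcc.exists_bound_of_continuousOn hp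
    refine (hq.norm.const_mul C).mono' ?_ ?_
    · exact ((hp.mono uIoc_subset_uIcc).aestronglyMeasurable measurableSet_uIoc).inner
        hq.aestronglyMeasurable
    · filter_upwards [ae_restrict_mem measurableSet_uIoc] with s hs
      refine (norm_inner_le_norm _ _).trans ?_
      gcongr
      exact hC s (uIoc_subset_uIcc hs)
  have cont_inner' : ∀ {p q : ℝ → H}, ContinuousOn p (uIcc a b) → IntervalIntegrable q volume a b →
      IntervalIntegrable (fun s => inner ℝ (q s) (p s)) volume a b := by
    intro p q hp hq
    simpa only [real_inner_comm] using cont_inner hp hq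
  -- Integration by parts without derivatives: the double integral over the triangle r ≤ s is taken
  -- in the other order. Writing the inner integral from r to b as the whole minus the part up to r
  -- then gives the product of the total increments minus the symmetric term.
  have T : ∫ s in a..b, inner ℝ (∫ r in a..s, g r) (h s) =
      ∫ r in a..b, inner ℝ (g r) (∫ s in r..b, h s) := by
    have := intervalIntegral_triangle_swap hab (fun s r => inner ℝ (g r) (h s))
      ((integrable_inner_prod hg hh).swap)
    calc _ = ∫ s in a..b, ∫ r in a..s, inner ℝ (g r) (h s) := by
          apply intervalIntegral.integral_congr
          intro s hs
          rw [hu] at hs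
          have hi : IntervalIntegrable g volume a s :=
            hgi.mono_set (by rw [hu, uIcc_of_le hs.1]; exact Icc_subset_Icc_right hs.2)
          simp only [real_inner_comm (h s)]
          exact (intervalIntegral_inner hi (h s)).symm
      _ = _ := this
      _ = _ := by
          apply intervalIntegral.integral_congr
          intro r hr
          rw [hu] at hr
          have hi : IntervalIntegrable h volume r b :=
            hhi.mono_set (by rw [hu, uIcc_of_le hr.2]; exact Icc_subset_Icc_left hr.1)
          exact intervalIntegral_inner hi (g r)
  have T' : ∫ r in a..b, inner ℝ (g r) (∫ s in r..b, h s) =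
      inner ℝ (∫ r in a..b, g r) (∫ s in a..b, h s) -
        ∫ r in a..b, inner ℝ (g r) (∫ s in a..r, h s) := by
    have e1 : ∫ r in a..b, inner ℝ (g r) (∫ s in a..b, h s) =
        inner ℝ (∫ r in a..b, g r) (∫ s in a..b, h s) := by
      simp only [real_inner_comm (∫ s in a..b, h s)]
      exact intervalIntegral_inner hgi _
    rw [← e1, ← intervalIntegral.integral_sub]
    · apply intervalIntegral.integral_congr
      intro r hr
      rw [hu] at hr
      change inner ℝ (g r) (∫ s in r..b, h s) =
        inner ℝ (g r) (∫ s in a..b, h s) - inner ℝ (g r) (∫ s in a..r, h s)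
      rw [← inner_sub_right]
      congr 1
      rw [intervalIntegral.integral_interval_sub_left hhi]
      exact hhi.mono_set (by rw [hu, uIcc_of_le hr.1]; exact Icc_subset_Icc_right hr.2)
    · exact cont_inner' continuousOn_const hgi
    · exact cont_inner' cH hgi
  have e2 : ∫ s in a..b, inner ℝ (y s) (h s) =
      inner ℝ (y a) (∫ s in a..b, h s) + ∫ s in a..b, inner ℝ (∫ r in a..s, g r) (h s) := by
    rw [← intervalIntegral_inner hhi (y a), ← intervalIntegral.integral_add]
    · apply intervalIntegral.integral_congr
      intro s hs
      rw [hu] at hs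
      change inner ℝ (y s) (h s) = _
      rw [hy s hs, inner_add_left]
    · exact cont_inner continuousOn_const hhi
    · exact cont_inner cG hhi
  have e3 : ∫ s in a..b, inner ℝ (g s) (z s) =
      inner ℝ (∫ s in a..b, g s) (z a) + ∫ s in a..b, inner ℝ (g s) (∫ r in a..s, h r) := by
    rw [real_inner_comm, ← intervalIntegral_inner hgi (z a), ← intervalIntegral.integral_add]
    · apply intervalIntegral.integral_congr
      intro s hs
      rw [hu] at hs
      change inner ℝ (g s) (z s) = _
      rw [hz s hs, inner_add_right, real_inner_comm (z a)]
    · exact cont_inner continuousOn_const hgi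
    · exact cont_inner' cH hgi
  have cy : ContinuousOn y (uIcc a b) :=
    (continuousOn_const.add cG).congr fun t ht => hy t (hu ▸ ht)
  have cz : ContinuousOn z (uIcc a b) :=
    (continuousOn_const.add cH).congr fun t ht => hz t (hu ▸ ht)
  rw [intervalIntegral.integral_add (cont_inner cy hhi)
    (cont_inner' cz hgi), e2, e3, T, T',
    hy b (right_mem_Icc.2 hab), hz b (right_mem_Icc.2 hab), inner_add_left, inner_add_right,
    inner_add_right]
  ring

end ProductRule

/-! ### Absolutely continuous representatives, Agmon's inequality, and ∫ f² f' = 0 -/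

section Representative

/-- Du Bois-Reymond's argument. Subtracting (∫ψ) r from ψ, where r is a bump of integral one, leaves
a function of mean zero, whose primitive is an admissible test function. Hence ∫ψk = (∫ψ)(∫rk), and
the constant is ∫rk. -/
theorem ae_eq_const_of_integral_mul_deriv_eq_zero {k : ℝ → ℝ} (hk : LocallyIntegrable k)
    (h : ∀ φ : ℝ → ℝ, ContDiff ℝ ∞ φ → HasCompactSupport φ → ∫ x, k x * deriv φ x = 0) :
    ∃ c, ∀ᵐ x, k x = c := by
  let ρ : ContDiffBump (0 : ℝ) := ⟨1, 2, by norm_num, by norm_num⟩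
  let r : ℝ → ℝ := ρ.normed volume
  have hr : ContDiff ℝ ∞ r := ρ.contDiff_normed
  have hrc : HasCompactSupport r := ρ.hasCompactSupport_normed
  have hr1 : ∫ x, r x = 1 := ρ.integral_normed
  have hmul : ∀ φ : ℝ → ℝ, Continuous φ → HasCompactSupport φ →
      Integrable (fun x => φ x * k x) := fun φ hφ hc => by
    simpa only [smul_eq_mul] using hk.integrable_smul_left_of_hasCompactSupport hφ hc
  refine ⟨∫ x, r x * k x, ?_⟩
  apply ae_eq_of_integral_contDiff_smul_eq hk (locallyIntegrable_const _)
  intro ψ hψ hψc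
  simp only [smul_eq_mul]
  set I := ∫ x, ψ x
  let η : ℝ → ℝ := fun x => ψ x - I * r x
  have hη : ContDiff ℝ ∞ η := hψ.sub (contDiff_const.mul hr)
  have hηc : HasCompactSupport η := hψc.sub (hrc.mul_left)
  have hηi : Integrable η := hη.continuous.integrable_of_hasCompactSupport hηc
  have hη0 : ∫ x, η x = 0 := by
    rw [integral_sub (hψ.continuous.integrable_of_hasCompactSupport hψc)
      ((hr.continuous.integrable_of_hasCompactSupport hrc).const_mul _), integral_const_mul, hr1]
    simp [I]
  obtain ⟨R, hR⟩ := hηc.isCompact.isBounded.subset_closedBall 0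
  have hout : ∀ x, |R| + 1 ≤ |x| → η x = 0 := by
    intro x hx
    by_contra hne
    have := hR (subset_tsupport _ hne)
    rw [mem_closedBall_zero_iff, Real.norm_eq_abs] at this
    linarith [le_abs_self R]
  let φ : ℝ → ℝ := fun x => ∫ s in (-(|R| + 1))..x, η s
  have hd : ∀ x, HasDerivAt φ (η x) x := fun x =>
    intervalIntegral.integral_hasDerivAt_right (hη.continuous.intervalIntegrable _ _)
      (hη.continuous.stronglyMeasurableAtFilter _ _) hη.continuous.continuousAt
  have hdφ : deriv φ = η := funext fun x => (hd x).deriv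
  have hφ : ContDiff ℝ ∞ φ := by
    rw [contDiff_infty_iff_deriv]
    exact ⟨fun x => (hd x).differentiableAt, by rw [hdφ]; exact hη⟩
  have hφc : HasCompactSupport φ := by
    apply HasCompactSupport.intro (K := Icc (-(|R| + 1)) (|R| + 1)) isCompact_Icc
    intro x hx
    rw [mem_Icc, ← abs_le, not_le] at hx
    rcases lt_or_ge x 0 with hx0 | hx0
    · rw [abs_of_neg hx0] at hx
      apply intervalIntegral.integral_zero_ae
      refine Eventually.of_forall fun s hs => hout s ?_
      rw [uIoc_of_ge (by linarith)] at hs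
      linarith [hs.2, neg_abs_le s]
    · rw [abs_of_nonneg hx0] at hx
      change ∫ s in (-(|R| + 1))..x, η s = 0
      rw [intervalIntegral.integral_eq_integral_of_support_subset, hη0]
      intro s hs
      by_contra hn
      refine hs (hout s ?_)
      rw [mem_Ioc, not_and_or, not_lt, not_le] at hn
      rcases hn with hn | hn
      · linarith [neg_abs_le s]
      · linarith [le_abs_self s]
  have := h φ hφ hφc
  rw [hdφ] at this
  have e1 : ∫ x, k x * η x = (∫ x, ψ x * k x) - I * ∫ x, r x * k x := by
    rw [← integral_const_mul, ← integral_sub (hmul ψ hψ.continuous hψc)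
      ((hmul r hr.continuous hrc).const_mul _)]
    congr 1; ext x; simp only [η]; ring
  rw [integral_mul_const]
  linarith

/-- The absolutely continuous representative of a function in `H¹(ℝ)`. -/
theorem HasWeakDerivL2.exists_ae_eq_integral {f g : L2R} (h : HasWeakDerivL2 f g) :
    ∃ F : ℝ → ℝ, Continuous F ∧ f =ᵐ[volume] F ∧ ∀ a b, F b = F a + ∫ x in a..b, g x := by
  have hgl : LocallyIntegrable g := (Lp.memLp g).locallyIntegrable (by norm_num)
  have hgi : ∀ a b, IntervalIntegrable g volume a b := fun a b =>
    (hgl.integrableOn_isCompact isCompact_uIcc).intervalIntegrable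
  let G : ℝ → ℝ := fun x => ∫ s in (0 : ℝ)..x, g s
  have hG : Continuous G := intervalIntegral.continuous_primitive hgi 0
  have hGab : ∀ a b, G b = G a + ∫ x in a..b, g x := fun a b =>
    (intervalIntegral.integral_add_adjacent_intervals (hgi 0 a) (hgi a b)).symm
  have hfl : LocallyIntegrable f := (Lp.memLp f).locallyIntegrable (by norm_num)
  obtain ⟨c, hc⟩ := ae_eq_const_of_integral_mul_deriv_eq_zero (k := fun x => f x - G x)
    (hfl.sub hG.locallyIntegrable) (by
      intro φ hφ hφc
      have hdc : Continuous (deriv φ) := hφ.continuous_deriv (by simp)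
      have hdcs : HasCompactSupport (deriv φ) := hφc.deriv
      have i1 : Integrable (fun x => f x * deriv φ x) := by
        simpa only [smul_eq_mul] using
          hfl.integrable_smul_right_of_hasCompactSupport hdc hdcs
      have i2 : Integrable (fun x => G x * deriv φ x) :=
        (hG.mul hdc).integrable_of_hasCompactSupport hdcs.mul_left
      have i3 : Integrable (fun x => g x * φ x) := by
        simpa only [smul_eq_mul] using
          hgl.integrable_smul_right_of_hasCompactSupport hφ.continuous hφc
      obtain ⟨R, hR⟩ := hφc.isCompact.isBounded.subset_closedBall 0
      have hout : ∀ x, |R| + 1 ≤ |x| → φ x = 0 := by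
        intro x hx
        by_contra hne
        have := hR (subset_tsupport _ hne)
        rw [mem_closedBall_zero_iff, Real.norm_eq_abs] at this
        linarith [le_abs_self R]
      have hd0 : ∀ x, |R| + 1 ≤ |x| → deriv φ x = 0 := by
        intro x hx
        by_contra hne
        have := hR (support_deriv_subset hne)
        rw [mem_closedBall_zero_iff, Real.norm_eq_abs] at this
        linarith [le_abs_self R]
      set A := |R| + 1 with hA
      have hA0 : 0 ≤ A := by positivity
      have hsub : ∀ k : ℝ → ℝ, (∀ x, A ≤ |x| → k x = 0) → Function.support k ⊆ Ioc (-A) A := by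
        intro k hk s hs
        by_contra hn
        refine hs (hk s ?_)
        rw [mem_Ioc, not_and_or, not_lt, not_le] at hn
        rcases hn with hn | hn
        · linarith [neg_abs_le s]
        · linarith [le_abs_self s]
      -- Integration by parts of the primitive G against φ. The boundary terms vanish because φ is
      -- zero at ±A, so f − G annihilates every φ'.
      have hprod := inner_add_integral_eq (H := ℝ) (a := -A) (b := A) (by linarith) (g := g)
        (h := deriv φ) (y := G) (z := φ) ((hgi _ _).1) ((hdc.intervalIntegrable _ _).1)
        (fun t _ => hGab _ _) (fun t _ => by
          rw [intervalIntegral.integral_deriv_eq_sub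
            (fun x _ => hφ.differentiable (by simp) x) (hdc.intervalIntegrable _ _)]
          ring)
      have hφA : φ A = 0 := hout A (le_abs_self A)
      have hφA' : φ (-A) = 0 := hout (-A) (by rw [abs_neg]; exact le_abs_self A)
      rw [hφA, hφA', inner_zero_right, inner_zero_right, zero_add,
        intervalIntegral.integral_eq_integral_of_support_subset (hsub _ (fun x hx => by
          rw [hout x hx, hd0 x hx]; simp))] at hprod
      have e := h φ hφ hφc
      calc ∫ x, (f x - G x) * deriv φ x
          = (∫ x, f x * deriv φ x) - ∫ x, G x * deriv φ x := by
            rw [← integral_sub i1 i2]; congr 1; ext x; ring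
        _ = - ((∫ x, G x * deriv φ x) + ∫ x, g x * φ x) := by rw [e]; ring
        _ = - ∫ x, (inner ℝ (G x) (deriv φ x) + inner ℝ (g x) (φ x)) := by
            rw [← integral_add i2 i3]; congr 2; ext x; simp [mul_comm]
        _ = 0 := by rw [← hprod, neg_zero])
  refine ⟨fun x => c + G x, continuous_const.add hG, ?_, fun a b => ?_⟩
  · filter_upwards [hc] with x hx
    linarith
  · simp only [hGab a b]; ring

theorem integral_abs_mul_abs_le (f g : L2R) : ∫ x, |f x| * |g x| ≤ ‖f‖ * ‖g‖ := by
  have h := real_inner_le_norm |f| |g|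
  rw [norm_abs_eq_norm, norm_abs_eq_norm, L2.inner_def] at h
  refine le_trans (le_of_eq ?_) h
  apply integral_congr_ae
  filter_upwards [Lp.coeFn_abs f, Lp.coeFn_abs g] with x h1 h2
  rw [h1, h2]; simp [mul_comm]

theorem integrable_abs_mul_abs (f g : L2R) : Integrable (fun x => |f x| * |g x|) :=
  MemLp.integrable_mul (p := 2) (q := 2) (Lp.memLp f).abs (Lp.memLp g).abs

/-- Otherwise F² ≥ ε² on a set of infinite measure. Applied to half-lines, it provides endpoints at
which F is small, which replaces the statement that F tends to zero at infinity. -/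
theorem exists_abs_lt_of_integrable_sq {F : ℝ → ℝ} (hF : Integrable (fun x => F x ^ 2))
    {ε : ℝ} (hε : 0 < ε) {s : Set ℝ} (hs : volume s = ⊤) (hms : MeasurableSet s) :
    ∃ x ∈ s, |F x| < ε := by
  by_contra! hcon
  have : IntegrableOn (fun _ => ε ^ 2) s := by
    refine (hF.integrableOn (s := s)).mono' aestronglyMeasurable_const ?_
    filter_upwards [ae_restrict_mem hms] with x hx
    rw [Real.norm_of_nonneg (by positivity), ← sq_abs (F x)]
    gcongr
    exact hcon x hx
  rw [integrableOn_const_iff] at this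
  rcases this with h | h
  · exact (pow_pos hε 2).ne' (by simpa using h)
  · simp [hs] at h

theorem sq_add_integral_eq {F g : ℝ → ℝ} {a b : ℝ} (hab : a ≤ b)
    (hg : IntegrableOn g (Ioc a b)) (hF : ∀ t ∈ Icc a b, F t = F a + ∫ x in a..t, g x) :
    F b ^ 2 = F a ^ 2 + ∫ x in a..b, 2 * (F x * g x) := by
  have h := inner_add_integral_eq hab hg hg hF hF
  simp only [RCLike.inner_apply, conj_trivial] at h
  rw [sq, sq, h]
  congr 2
  ext x; ring

theorem cube_add_integral_eq {F g : ℝ → ℝ} {a b : ℝ} (hab : a ≤ b)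
    (hg : IntegrableOn g (Ioc a b)) (hFc : Continuous F)
    (hF : ∀ t ∈ Icc a b, F t = F a + ∫ x in a..t, g x) :
    F b ^ 3 = F a ^ 3 + ∫ x in a..b, 3 * (F x ^ 2 * g x) := by
  have hg2 : IntegrableOn (fun x => 2 * (F x * g x)) (Ioc a b) :=
    ((((intervalIntegrable_iff_integrableOn_Ioc_of_le hab).2 hg).continuousOn_mul
      hFc.continuousOn).const_mul 2).1
  have h := inner_add_integral_eq hab hg hg2 hF (z := fun t => F t ^ 2) (fun t ht =>
    sq_add_integral_eq ht.1 (hg.mono_set (Ioc_subset_Ioc_right ht.2))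
      (fun s hs => hF s ⟨hs.1, hs.2.trans ht.2⟩))
  simp only [RCLike.inner_apply, conj_trivial] at h
  rw [pow_succ, pow_succ (F a), h]
  congr 2
  ext x; ring

/-- Agmon's inequality. -/
theorem HasWeakDerivL2.ae_sq_le {f g : L2R} (h : HasWeakDerivL2 f g) :
    ∀ᵐ x, f x ^ 2 ≤ 2 * (‖f‖ * ‖g‖) := by
  obtain ⟨F, hFc, hfF, hF⟩ := h.exists_ae_eq_integral
  have hgl : LocallyIntegrable g := (Lp.memLp g).locallyIntegrable (by norm_num)
  have hF2 : Integrable (fun x => F x ^ 2) := by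
    refine ((Lp.memLp f).integrable_sq).congr ?_
    filter_upwards [hfF] with x hx
    rw [hx]
  have hFg : Integrable (fun x => |F x| * |g x|) := by
    refine (integrable_abs_mul_abs f g).congr ?_
    filter_upwards [hfF] with x hx
    rw [hx]
  have hFgle : ∫ x, |F x| * |g x| ≤ ‖f‖ * ‖g‖ := by
    refine le_trans (le_of_eq ?_) (integral_abs_mul_abs_le f g)
    apply integral_congr_ae
    filter_upwards [hfF] with x hx
    rw [hx]
  filter_upwards [hfF] with b hb
  rw [hb]
  -- If F(b)² exceeded the bound by δ, a point a ≤ b with F(a)² < δ would contradict F(b)² − F(a)² =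
  -- 2∫ F g over [a,b].
  by_contra! hcon
  set δ := F b ^ 2 - 2 * (‖f‖ * ‖g‖) with hδ
  have hδ0 : 0 < δ := by linarith
  obtain ⟨a, hab, ha⟩ := exists_abs_lt_of_integrable_sq hF2 (Real.sqrt_pos.2 hδ0)
    (s := Iic b) Real.volume_Iic measurableSet_Iic
  have hab : a ≤ b := hab
  have h1 := sq_add_integral_eq hab ((hgl.integrableOn_isCompact isCompact_Icc).mono_set
    Ioc_subset_Icc_self) (fun t _ => hF a t)
  have h2 : F a ^ 2 < δ := by
    rw [← sq_abs, ← Real.sq_sqrt hδ0.le]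
    exact pow_lt_pow_left₀ ha (abs_nonneg _) (by norm_num)
  have h3 : ∫ x in a..b, 2 * (F x * g x) ≤ 2 * (‖f‖ * ‖g‖) := by
    rw [intervalIntegral.integral_const_mul]
    refine mul_le_mul_of_nonneg_left ?_ (by norm_num)
    rw [intervalIntegral.integral_of_le hab]
    refine le_trans (le_trans ?_ (setIntegral_le_integral (s := Ioc a b) hFg
      (Eventually.of_forall fun x => by positivity))) hFgle
    refine (le_abs_self _).trans ((abs_integral_le_integral_abs).trans (le_of_eq ?_))
    congr 1; ext x; rw [abs_mul]
  linarith

/-- The integrand is the derivative of F³/3 for the continuous representative F, and it is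
integrable because f is bounded by Agmon. The integrals over intervals whose endpoints run to ∓∞
along points where F tends to zero therefore vanish in the limit. -/
theorem HasWeakDerivL2.integral_sq_mul_eq_zero {f g : L2R} (h : HasWeakDerivL2 f g) :
    ∫ x, f x ^ 2 * g x = 0 := by
  have hag := h.ae_sq_le
  obtain ⟨F, hFc, hfF, hF⟩ := h.exists_ae_eq_integral
  have hgl : LocallyIntegrable g := (Lp.memLp g).locallyIntegrable (by norm_num)
  have hF2 : Integrable (fun x => F x ^ 2) := by
    refine ((Lp.memLp f).integrable_sq).congr ?_
    filter_upwards [hfF] with x hx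
    rw [hx]
  have hf2g : Integrable (fun x => f x ^ 2 * g x) := by
    have hfL : MemLp (fun x => f x * f x) 2 volume := by
      refine (Lp.memLp f).of_le_mul (c := √(2 * (‖f‖ * ‖g‖)))
        ((Lp.aestronglyMeasurable f).mul (Lp.aestronglyMeasurable f)) ?_
      filter_upwards [hag] with x hx
      rw [norm_mul]
      gcongr
      exact Real.abs_le_sqrt hx
    simp only [sq]
    exact MemLp.integrable_mul (p := 2) (q := 2) hfL (Lp.memLp g)
  have hF2g : Integrable (fun x => F x ^ 2 * g x) := by
    refine hf2g.congr ?_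
    filter_upwards [hfF] with x hx
    rw [hx]
  have e0 : ∫ x, f x ^ 2 * g x = ∫ x, F x ^ 2 * g x := by
    apply integral_congr_ae
    filter_upwards [hfF] with x hx
    rw [hx]
  rw [e0]
  have hpos : ∀ n : ℕ, (0 : ℝ) < 1 / ((n : ℝ) + 1) := fun n => by positivity
  choose a ha ha' using fun n : ℕ => exists_abs_lt_of_integrable_sq hF2 (hpos n)
    (s := Iic (-(n : ℝ))) Real.volume_Iic measurableSet_Iic
  choose b hb hb' using fun n : ℕ => exists_abs_lt_of_integrable_sq hF2 (hpos n)
    (s := Ici (n : ℝ)) Real.volume_Ici measurableSet_Ici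
  have hla : Tendsto a atTop atBot :=
    tendsto_atBot_mono ha (tendsto_neg_atTop_atBot.comp tendsto_natCast_atTop_atTop)
  have hlb : Tendsto b atTop atTop := tendsto_atTop_mono hb tendsto_natCast_atTop_atTop
  have hFa : Tendsto (fun n => F (a n)) atTop (𝓝 0) :=
    squeeze_zero_norm (fun n => (ha' n).le) tendsto_one_div_add_atTop_nhds_zero_nat
  have hFb : Tendsto (fun n => F (b n)) atTop (𝓝 0) :=
    squeeze_zero_norm (fun n => (hb' n).le) tendsto_one_div_add_atTop_nhds_zero_nat
  have hlim := intervalIntegral_tendsto_integral hF2g hla hlb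
  have hlim' : Tendsto (fun n => ∫ x in a n..b n, F x ^ 2 * g x) atTop (𝓝 0) := by
    have h0 : Tendsto (fun n => (F (b n) ^ 3 - F (a n) ^ 3) / 3) atTop (𝓝 0) := by
      simpa using ((hFb.pow 3).sub (hFa.pow 3)).div_const 3
    refine h0.congr fun n => ?_
    have hab : a n ≤ b n := by
      have h1 : a n ≤ -(n : ℝ) := ha n
      have h2 : (n : ℝ) ≤ b n := hb n
      have h3 : (0 : ℝ) ≤ n := n.cast_nonneg
      linarith
    have := cube_add_integral_eq hab ((hgl.integrableOn_isCompact isCompact_Icc).mono_set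
      Ioc_subset_Icc_self) hFc (fun t _ => hF (a n) t)
    rw [intervalIntegral.integral_const_mul] at this
    linarith
  exact tendsto_nhds_unique hlim hlim'

end Representative

/-! ### Products with an H¹ factor -/

section PointwiseProduct

theorem HasWeakDerivL2.memLp_mul {f g : L2R} (h : HasWeakDerivL2 f g) (k : L2R) :
    MemLp (fun x => f x * k x) 2 (volume : Measure ℝ) := by
  refine (Lp.memLp k).of_le_mul (c := √(2 * (‖f‖ * ‖g‖)))
    ((Lp.aestronglyMeasurable f).mul (Lp.aestronglyMeasurable k)) ?_
  filter_upwards [h.ae_sq_le] with x hx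
  rw [norm_mul]
  gcongr
  exact Real.abs_le_sqrt hx

theorem HasWeakDerivL2.coeFn_mulL2 {f g : L2R} (h : HasWeakDerivL2 f g) (k : L2R) :
    mulL2 f k =ᵐ[volume] fun x => f x * k x := by
  rw [mulL2, dif_pos (h.memLp_mul k)]
  exact MemLp.coeFn_toLp _

theorem HasWeakDerivL2.norm_mulL2_le {f g : L2R} (h : HasWeakDerivL2 f g) (k : L2R) :
    ‖mulL2 f k‖ ≤ √(2 * (‖f‖ * ‖g‖)) * ‖k‖ := by
  apply Lp.norm_le_mul_norm_of_ae_le_mul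
  filter_upwards [h.ae_sq_le, h.coeFn_mulL2 k] with x hx hx'
  rw [hx', norm_mul]
  gcongr
  exact Real.abs_le_sqrt hx

/-- Agmon followed by √(2ab) ≤ a + b. The free parameter θ is the source of smallness: the
derivative carries θ, while the weight θ⁻¹ on ‖f‖ is later compensated by a factor √T. -/
theorem HasWeakDerivL2.norm_mulL2_le_add {f g : L2R} (h : HasWeakDerivL2 f g) (k : L2R)
    {θ : ℝ} (hθ : 0 < θ) : ‖mulL2 f k‖ ≤ (θ⁻¹ * ‖f‖ + θ * ‖g‖) * ‖k‖ := by
  refine (h.norm_mulL2_le k).trans ?_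
  gcongr
  apply Real.sqrt_le_iff.2 ⟨by positivity, ?_⟩
  have e : θ⁻¹ * ‖f‖ * (θ * ‖g‖) = ‖f‖ * ‖g‖ := by field_simp
  nlinarith [sq_nonneg (θ⁻¹ * ‖f‖), sq_nonneg (θ * ‖g‖)]

/-- Linearity is not automatic, since `mulL2` takes the value zero when the product leaves L². An H¹
first factor excludes that case. -/
theorem HasWeakDerivL2.mulL2_sub_right {f g : L2R} (h : HasWeakDerivL2 f g) (k l : L2R) :
    mulL2 f (k - l) = mulL2 f k - mulL2 f l := by
  apply Lp.ext
  filter_upwards [h.coeFn_mulL2 (k - l), h.coeFn_mulL2 k, h.coeFn_mulL2 l, Lp.coeFn_sub k l,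
    Lp.coeFn_sub (mulL2 f k) (mulL2 f l)] with x h1 h2 h3 h4 h5
  simp only [h1, h5, Pi.sub_apply, h2, h3, h4]
  ring

theorem HasWeakDerivL2.sub {f g f' g' : L2R} (h : HasWeakDerivL2 f g)
    (h' : HasWeakDerivL2 f' g') : HasWeakDerivL2 (f - f') (g - g') := by
  rw [hasWeakDerivL2_iff] at *
  rw [map_sub, map_sub]
  filter_upwards [h, h', Lp.coeFn_sub (realFourier f) (realFourier f'),
    Lp.coeFn_sub (realFourier g) (realFourier g')] with ξ h1 h2 h3 h4
  rw [h3, h4, Pi.sub_apply, Pi.sub_apply, h1, h2]; ring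

theorem HasWeakDerivL2.mulL2_sub_left {f g f' g' : L2R} (h : HasWeakDerivL2 f g)
    (h' : HasWeakDerivL2 f' g') (k : L2R) :
    mulL2 (f - f') k = mulL2 f k - mulL2 f' k := by
  apply Lp.ext
  filter_upwards [(h.sub h').coeFn_mulL2 k, h.coeFn_mulL2 k, h'.coeFn_mulL2 k, Lp.coeFn_sub f f',
    Lp.coeFn_sub (mulL2 f k) (mulL2 f' k)] with x h1 h2 h3 h4 h5
  simp only [h1, h5, Pi.sub_apply, h2, h3, h4]
  ring

theorem mulL2_zero (f : L2R) : mulL2 f 0 = 0 := by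
  have h : (fun x => f x * (0 : L2R) x) =ᵐ[volume] 0 := by
    filter_upwards [Lp.coeFn_zero ℝ 2 (volume : Measure ℝ)] with x hx
    rw [hx]; simp
  rw [mulL2, dif_pos ((memLp_congr_ae h).2 MemLp.zero)]
  apply Lp.ext
  exact (MemLp.coeFn_toLp _).trans (h.trans (Lp.coeFn_zero ℝ 2 _).symm)

theorem MemH1.hasWeakDerivL2 {f : L2R} (h : MemH1 f) : HasWeakDerivL2 f (weakDeriv f) := by
  obtain ⟨g, hg⟩ := h
  rwa [hg.weakDeriv_eq]

theorem weakDeriv_of_not_memH1 {f : L2R} (h : ¬ MemH1 f) : weakDeriv f = 0 := dif_neg h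

/-- Outside H¹ the default value `weakDeriv f = 0` makes the identity trivial. It can thus be used
at every time, not only at almost every one. -/
theorem inner_mulL2_weakDeriv_self (f : L2R) : inner ℝ (mulL2 f (weakDeriv f)) f = 0 := by
  by_cases h : MemH1 f
  · have hw := h.hasWeakDerivL2
    rw [L2.inner_def, ← hw.integral_sq_mul_eq_zero]
    apply integral_congr_ae
    filter_upwards [hw.coeFn_mulL2 (weakDeriv f)] with x hx
    rw [hx]
    simp; ring
  · rw [weakDeriv_of_not_memH1 h, mulL2_zero, inner_zero_left]

end PointwiseProduct

/-! ### Fourier multipliers on real L² -/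

section Multiplier

open scoped ComplexConjugate

/-- A bounded measurable Hermitian symbol. -/
structure IsRealSymbol (m : ℝ → ℂ) (C : ℝ) : Prop where
  measurable : Measurable m
  bound : ∀ ξ, ‖m ξ‖ ≤ C
  neg : ∀ ξ, m (-ξ) = conj (m ξ)

/-- No bound on m is required, so this also produces derivatives of f once the product is known to
be square integrable. -/
theorem exists_realFourier_eq_mul {m : ℝ → ℂ} (hneg : ∀ ξ, m (-ξ) = conj (m ξ)) (f : L2R)
    (h : MemLp (fun ξ => m ξ * realFourier f ξ) 2 volume) :
    ∃ g : L2R, ∀ᵐ ξ, realFourier g ξ = m ξ * realFourier f ξ := by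
  have hk := h.coeFn_toLp
  obtain ⟨g, hg⟩ := exists_realFourier_eq (h.toLp _) (by
    filter_upwards [hk, ae_neg_real (p := fun ξ => (h.toLp _ : L2C) ξ = m ξ * realFourier f ξ) hk,
      realFourier_neg f] with ξ h1 h2 h3
    rw [h1, h2, h3, hneg, map_mul])
  exact ⟨g, by rw [hg]; exact hk⟩

theorem IsRealSymbol.memLp {m : ℝ → ℂ} {C : ℝ} (h : IsRealSymbol m C) (f : L2R) :
    MemLp (fun ξ => m ξ * realFourier f ξ) 2 volume :=
  (Lp.memLp (realFourier f)).of_le_mul (c := C)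
    (h.measurable.aestronglyMeasurable.mul (Lp.aestronglyMeasurable _))
    (Eventually.of_forall fun ξ => by rw [norm_mul]; gcongr; exact h.bound ξ)

theorem realFourier_ext {f g : L2R} (h : ∀ᵐ ξ, realFourier f ξ = realFourier g ξ) : f = g :=
  realFourier.injective (Lp.ext h)

theorem IsRealSymbol.exists_operator {m : ℝ → ℂ} {C : ℝ} (h : IsRealSymbol m C) :
    ∃ T : L2R →L[ℝ] L2R, ∀ f, ∀ᵐ ξ, realFourier (T f) ξ = m ξ * realFourier f ξ := by
  choose T hT using fun f => exists_realFourier_eq_mul h.neg f (h.memLp f)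
  have hadd : ∀ f g, T (f + g) = T f + T g := by
    intro f g
    apply realFourier_ext
    rw [map_add]
    filter_upwards [hT (f + g), hT f, hT g, Lp.coeFn_add (realFourier (T f)) (realFourier (T g)),
      Lp.coeFn_add (realFourier f) (realFourier g)] with ξ h1 h2 h3 h4 h5
    rw [h1, h4, Pi.add_apply, h2, h3, map_add, h5, Pi.add_apply, mul_add]
  have hsmul : ∀ (c : ℝ) f, T (c • f) = c • T f := by
    intro c f
    apply realFourier_ext
    rw [map_smul]
    filter_upwards [hT (c • f), hT f, Lp.coeFn_smul c (realFourier (T f)),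
      Lp.coeFn_smul c (realFourier f)] with ξ h1 h2 h3 h4
    rw [h1, h3, Pi.smul_apply, h2, map_smul, h4, Pi.smul_apply, Complex.real_smul,
      Complex.real_smul]
    ring
  refine ⟨LinearMap.mkContinuous ⟨⟨T, hadd⟩, hsmul⟩ C fun f => ?_, hT⟩
  change ‖T f‖ ≤ C * ‖f‖
  rw [← realFourier.norm_map, ← realFourier.norm_map f]
  apply Lp.norm_le_mul_norm_of_ae_le_mul
  filter_upwards [hT f] with ξ hξ
  rw [hξ, norm_mul]
  gcongr
  exact h.bound ξ

open Classical in
/-- The Fourier multiplier with a bounded Hermitian symbol, acting on real functions. -/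
def multiplier (m : ℝ → ℂ) : L2R →L[ℝ] L2R :=
  if h : ∃ C, IsRealSymbol m C then h.choose_spec.exists_operator.choose else 0

theorem IsRealSymbol.realFourier_multiplier {m : ℝ → ℂ} {C : ℝ} (h : IsRealSymbol m C) (f : L2R) :
    ∀ᵐ ξ, realFourier (multiplier m f) ξ = m ξ * realFourier f ξ := by
  have h' : ∃ C, IsRealSymbol m C := ⟨C, h⟩
  rw [multiplier, dif_pos h']
  exact h'.choose_spec.exists_operator.choose_spec f

theorem IsRealSymbol.norm_multiplier_le {m : ℝ → ℂ} {C : ℝ} (h : IsRealSymbol m C) (f : L2R) :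
    ‖multiplier m f‖ ≤ C * ‖f‖ := by
  rw [← realFourier.norm_map, ← realFourier.norm_map f]
  apply Lp.norm_le_mul_norm_of_ae_le_mul
  filter_upwards [h.realFourier_multiplier f] with ξ hξ
  rw [hξ, norm_mul]
  gcongr
  exact h.bound ξ

theorem inner_eq_integral_realFourier (f g : L2R) :
    inner ℝ f g = ∫ ξ, inner ℝ (realFourier f ξ) (realFourier g ξ) := by
  rw [← realFourier.inner_map_map, L2.inner_def]

theorem norm_sq_eq_integral_realFourier (f : L2R) : ‖f‖ ^ 2 = ∫ ξ, ‖realFourier f ξ‖ ^ 2 := by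
  rw [← real_inner_self_eq_norm_sq, inner_eq_integral_realFourier]
  simp only [real_inner_self_eq_norm_sq]

/-- Dominated convergence in `L²(ℝ)`, on the Fourier side. -/
theorem tendsto_of_realFourier {ι : Type*} {l : Filter ι} [l.IsCountablyGenerated]
    {k : ι → L2R} {k₀ : L2R} {a : ι → ℝ → ℂ} {a₀ : ℝ → ℂ} {G : ℝ → ℝ} (hG : MemLp G 2 volume)
    (h : ∀ᶠ i in l, realFourier (k i) =ᵐ[volume] a i) (h₀ : realFourier k₀ =ᵐ[volume] a₀)
    (hb : ∀ᶠ i in l, ∀ᵐ ξ, ‖a i ξ‖ ≤ G ξ)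
    (hlim : ∀ᵐ ξ, Tendsto (fun i => a i ξ) l (𝓝 (a₀ ξ))) : Tendsto k l (𝓝 k₀) := by
  have key : Tendsto (fun i => ‖k i - k₀‖ ^ 2) l (𝓝 0) := by
    have e : ∀ᶠ i in l, ∫ ξ, ‖a i ξ - a₀ ξ‖ ^ 2 = ‖k i - k₀‖ ^ 2 := by
      filter_upwards [h] with i hi
      rw [norm_sq_eq_integral_realFourier, map_sub]
      apply integral_congr_ae
      filter_upwards [hi, h₀, Lp.coeFn_sub (realFourier (k i)) (realFourier k₀)] with ξ h1 h2 h3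
      rw [h3, Pi.sub_apply, h1, h2]
    refine Tendsto.congr' e ?_
    have e0 : (0 : ℝ) = ∫ ξ : ℝ, (0 : ℝ) := by simp
    rw [e0]
    apply tendsto_integral_filter_of_dominated_convergence
      (fun ξ => (G ξ + ‖realFourier k₀ ξ‖) ^ 2)
    · filter_upwards [h] with i hi
      exact (((Lp.aestronglyMeasurable _).congr hi).sub
        ((Lp.aestronglyMeasurable _).congr h₀)).norm.pow 2
    · filter_upwards [hb] with i hi
      filter_upwards [hi, h₀] with ξ h1 h2
      rw [Real.norm_of_nonneg (by positivity), h2]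
      have := norm_sub_le (a i ξ) (a₀ ξ)
      gcongr
      linarith
    · exact (hG.add (Lp.memLp (realFourier k₀)).norm).integrable_sq
    · filter_upwards [hlim] with ξ hξ
      have := ((hξ.sub_const (a₀ ξ)).norm).pow 2
      simpa using this
  rw [tendsto_iff_norm_sub_tendsto_zero]
  have := key.sqrt
  simpa [Real.sqrt_sq] using this

theorem tendsto_multiplier {ι : Type*} {l : Filter ι} [l.IsCountablyGenerated]
    {m : ι → ℝ → ℂ} {m₀ : ℝ → ℂ} {C C₀ : ℝ} (hm : ∀ᶠ i in l, IsRealSymbol (m i) C)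
    (hm₀ : IsRealSymbol m₀ C₀) (hlim : ∀ ξ, Tendsto (fun i => m i ξ) l (𝓝 (m₀ ξ))) (f : L2R) :
    Tendsto (fun i => multiplier (m i) f) l (𝓝 (multiplier m₀ f)) := by
  apply tendsto_of_realFourier (G := fun ξ => C * ‖realFourier f ξ‖)
    (a := fun i ξ => m i ξ * realFourier f ξ) (a₀ := fun ξ => m₀ ξ * realFourier f ξ)
  · exact (Lp.memLp (realFourier f)).norm.const_mul C
  · filter_upwards [hm] with i hi using hi.realFourier_multiplier f
  · exact hm₀.realFourier_multiplier f
  · filter_upwards [hm] with i hi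
    refine Eventually.of_forall fun ξ => ?_
    rw [norm_mul]
    gcongr
    exact hi.bound ξ
  · exact Eventually.of_forall fun ξ => (hlim ξ).mul_const _

theorem IsRealSymbol.mul {m n : ℝ → ℂ} {C D : ℝ} (hm : IsRealSymbol m C) (hn : IsRealSymbol n D) :
    IsRealSymbol (fun ξ => m ξ * n ξ) (C * D) where
  measurable := hm.measurable.mul hn.measurable
  bound ξ := by
    rw [norm_mul]
    exact mul_le_mul (hm.bound ξ) (hn.bound ξ) (norm_nonneg _) ((norm_nonneg _).trans (hm.bound ξ))
  neg ξ := by rw [hm.neg, hn.neg, map_mul]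

theorem IsRealSymbol.multiplier_mul {m n : ℝ → ℂ} {C D : ℝ} (hm : IsRealSymbol m C)
    (hn : IsRealSymbol n D) (f : L2R) :
    multiplier (fun ξ => m ξ * n ξ) f = multiplier m (multiplier n f) := by
  apply realFourier_ext
  filter_upwards [(hm.mul hn).realFourier_multiplier f, hm.realFourier_multiplier (multiplier n f),
    hn.realFourier_multiplier f] with ξ h1 h2 h3
  rw [h1, h2, h3, mul_assoc]

theorem IsRealSymbol.multiplier_eq {m : ℝ → ℂ} {C : ℝ} (hm : IsRealSymbol m C) {f g : L2R}
    (h : ∀ᵐ ξ, realFourier g ξ = m ξ * realFourier f ξ) : multiplier m f = g := by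
  apply realFourier_ext
  filter_upwards [hm.realFourier_multiplier f, h] with ξ h1 h2
  rw [h1, h2]

end Multiplier

/-! ### The semigroup of −∂³ + ∂² and frequency cutoffs -/

section FreeGroup

open scoped ComplexConjugate

/-- The symbol of `- ∂³ + ∂²`. -/
def kdvSymbol (ξ : ℝ) : ℂ := - derivSymbol ξ ^ 3 + derivSymbol ξ ^ 2

theorem derivSymbol_eq (ξ : ℝ) : derivSymbol ξ = ((2 * Real.pi * ξ : ℝ) : ℂ) * Complex.I := by
  rw [derivSymbol]; push_cast; ring

theorem norm_derivSymbol (ξ : ℝ) : ‖derivSymbol ξ‖ = |2 * Real.pi * ξ| := by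
  rw [derivSymbol_eq, norm_mul, Complex.norm_I, mul_one, Complex.norm_real, Real.norm_eq_abs]

theorem kdvSymbol_eq (ξ : ℝ) : kdvSymbol ξ =
    ((-(2 * Real.pi * ξ) ^ 2 : ℝ) : ℂ) + (((2 * Real.pi * ξ) ^ 3 : ℝ) : ℂ) * Complex.I := by
  rw [kdvSymbol, derivSymbol_eq]
  set a := 2 * Real.pi * ξ
  have h3 : Complex.I ^ 3 = - Complex.I := Complex.I_pow_three
  rw [mul_pow, mul_pow, h3, Complex.I_sq]
  push_cast
  ring

theorem continuous_kdvSymbol : Continuous kdvSymbol := by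
  have := continuous_derivSymbol
  unfold kdvSymbol; fun_prop

theorem kdvSymbol_re (ξ : ℝ) : (kdvSymbol ξ).re = - (2 * Real.pi * ξ) ^ 2 := by
  rw [kdvSymbol_eq, Complex.add_re, Complex.re_ofReal_mul, Complex.I_re, Complex.ofReal_re]
  ring

theorem kdvSymbol_im (ξ : ℝ) : (kdvSymbol ξ).im = (2 * Real.pi * ξ) ^ 3 := by
  rw [kdvSymbol_eq, Complex.add_im, Complex.im_ofReal_mul, Complex.I_im, Complex.ofReal_im]
  ring

theorem kdvSymbol_re_nonpos (ξ : ℝ) : (kdvSymbol ξ).re ≤ 0 := by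
  rw [kdvSymbol_re]; nlinarith [sq_nonneg (2 * Real.pi * ξ)]

theorem conj_derivSymbol' (ξ : ℝ) : derivSymbol (-ξ) = conj (derivSymbol ξ) := by
  rw [derivSymbol_neg, conj_derivSymbol]

theorem conj_kdvSymbol (ξ : ℝ) : kdvSymbol (-ξ) = conj (kdvSymbol ξ) := by
  simp only [kdvSymbol, conj_derivSymbol', map_add, map_neg, map_pow]

theorem norm_derivSymbol_sq_le (ξ : ℝ) : ‖derivSymbol ξ‖ ^ 2 ≤ ‖kdvSymbol ξ‖ := by
  rw [norm_derivSymbol, sq_abs]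
  have := Complex.abs_re_le_norm (kdvSymbol ξ)
  rw [kdvSymbol_re, abs_neg, abs_of_nonneg (sq_nonneg _)] at this
  exact this

theorem norm_derivSymbol_cube_le (ξ : ℝ) : ‖derivSymbol ξ‖ ^ 3 ≤ ‖kdvSymbol ξ‖ := by
  rw [norm_derivSymbol, ← abs_pow, ← kdvSymbol_im]
  exact Complex.abs_im_le_norm (kdvSymbol ξ)

/-- The real part of `kdvSymbol` controls the square and the imaginary part controls the cube; the
first power follows from a ≤ 1 + a². This is why the natural domain of the multiplier is exactly H³.
-/
theorem norm_derivSymbol_pow_le (ξ : ℝ) {j : ℕ} (hj : j ≤ 3) :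
    ‖derivSymbol ξ ^ j‖ ≤ 1 + ‖kdvSymbol ξ‖ := by
  rw [norm_pow]
  have h2 := norm_derivSymbol_sq_le ξ
  have h3 := norm_derivSymbol_cube_le ξ
  interval_cases j
  · simp
  · nlinarith [sq_nonneg (‖derivSymbol ξ‖ - 1)]
  · linarith
  · linarith

/-- The operator `- ∂³ + ∂²` with domain `H³(ℝ)` is the Fourier multiplier `kdvSymbol`. -/
theorem kdvBurgersGraph_iff {c : LinfR} {f g : L2R} : KdVBurgersGraph c f g ↔
    ∀ᵐ ξ, realFourier (g + coeffMul c f) ξ = kdvSymbol ξ * realFourier f ξ := by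
  constructor
  · rintro ⟨f₁, f₂, f₃, h1, h2, h3, rfl⟩
    rw [hasWeakDerivL2_iff] at h1 h2 h3
    rw [sub_add_cancel, map_add, map_neg]
    filter_upwards [h1, h2, h3, Lp.coeFn_add (-realFourier f₃) (realFourier f₂),
      Lp.coeFn_neg (realFourier f₃)] with ξ e1 e2 e3 e4 e5
    rw [e4, Pi.add_apply, e5, Pi.neg_apply, e3, e2, e1, kdvSymbol]
    ring
  · intro h
    set k := g + coeffMul c f with hk
    have hmem : ∀ j : ℕ, j ≤ 3 → MemLp (fun ξ => derivSymbol ξ ^ j * realFourier f ξ) 2 volume := by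
      intro j hj
      refine MemLp.mono' (g := fun ξ => ‖realFourier f ξ‖ + ‖realFourier k ξ‖)
        ((Lp.memLp _).norm.add (Lp.memLp _).norm)
        ((continuous_derivSymbol.pow j).aestronglyMeasurable.mul (Lp.aestronglyMeasurable _)) ?_
      filter_upwards [h] with ξ hξ
      rw [norm_mul, hξ, norm_mul]
      have := norm_derivSymbol_pow_le ξ hj
      nlinarith [norm_nonneg (realFourier f ξ)]
    have hex : ∀ j : ℕ, j ≤ 3 → ∃ g : L2R, ∀ᵐ ξ,
        realFourier g ξ = derivSymbol ξ ^ j * realFourier f ξ := fun j hj =>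
      exists_realFourier_eq_mul (m := fun ξ => derivSymbol ξ ^ j)
        (fun ξ => by rw [conj_derivSymbol', map_pow]) f (hmem j hj)
    obtain ⟨f₁, h1⟩ := hex 1 (by norm_num)
    obtain ⟨f₂, h2⟩ := hex 2 (by norm_num)
    obtain ⟨f₃, h3⟩ := hex 3 (by norm_num)
    refine ⟨f₁, f₂, f₃, ?_, ?_, ?_, ?_⟩
    · rw [hasWeakDerivL2_iff]
      filter_upwards [h1] with ξ e1
      rw [e1, pow_one]
    · rw [hasWeakDerivL2_iff]
      filter_upwards [h1, h2] with ξ e1 e2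
      rw [e1, e2]; ring
    · rw [hasWeakDerivL2_iff]
      filter_upwards [h2, h3] with ξ e1 e2
      rw [e1, e2]; ring
    · rw [eq_sub_iff_add_eq, ← hk]
      clear_value k
      apply realFourier_ext
      rw [map_add, map_neg]
      filter_upwards [h, h2, h3, Lp.coeFn_add (-realFourier f₃) (realFourier f₂),
        Lp.coeFn_neg (realFourier f₃)] with ξ e1 e2 e3 e4 e5
      rw [e4, Pi.add_apply, e5, Pi.neg_apply, e3, e2, e1, kdvSymbol]
      ring

/-- The mean value inequality on the left half-plane, which is convex and on which |exp| ≤ 1. It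
dominates the difference quotients of the semigroup symbol uniformly in t. -/
theorem norm_exp_sub_one_le_of_re_nonpos {z : ℂ} (hz : z.re ≤ 0) : ‖Complex.exp z - 1‖ ≤ ‖z‖ := by
  have h := (convex_halfSpace_re_le 0).norm_image_sub_le_of_norm_deriv_le (𝕜 := ℂ)
    (f := Complex.exp) (C := 1) (x := 0) (y := z)
    (fun x _ => Complex.differentiableAt_exp) (fun x hx => by
      rw [Complex.deriv_exp, Complex.norm_exp]
      exact Real.exp_le_one_iff.2 hx) (by simp) hz
  simpa using h

/-- The symbol of the semigroup generated by `- ∂³ + ∂²`. -/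
def freeSymbol (t : ℝ) (ξ : ℝ) : ℂ := Complex.exp ((max t 0 : ℝ) * kdvSymbol ξ)

/-- The semigroup generated by `- ∂³ + ∂²`. -/
def freeSemigroup (t : ℝ) : L2R →L[ℝ] L2R := multiplier (freeSymbol t)

theorem re_mul_kdvSymbol_nonpos {t : ℝ} (ht : 0 ≤ t) (ξ : ℝ) : ((t : ℂ) * kdvSymbol ξ).re ≤ 0 := by
  rw [Complex.re_ofReal_mul]
  exact mul_nonpos_of_nonneg_of_nonpos ht (kdvSymbol_re_nonpos ξ)

theorem isRealSymbol_freeSymbol (t : ℝ) : IsRealSymbol (freeSymbol t) 1 where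
  measurable := by
    have := continuous_kdvSymbol
    apply Continuous.measurable
    unfold freeSymbol
    fun_prop
  bound ξ := by
    rw [freeSymbol, Complex.norm_exp, Real.exp_le_one_iff]
    exact re_mul_kdvSymbol_nonpos (le_max_right _ _) ξ
  neg ξ := by
    rw [freeSymbol, freeSymbol, conj_kdvSymbol, ← Complex.exp_conj, map_mul, Complex.conj_ofReal]

theorem norm_freeSemigroup_apply_le (t : ℝ) (f : L2R) : ‖freeSemigroup t f‖ ≤ ‖f‖ := by
  simpa [freeSemigroup] using (isRealSymbol_freeSymbol t).norm_multiplier_le f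

/-- The truncation `max t 0` in the symbol freezes the family at the identity for negative times, so
that continuity in t holds on the whole line without side conditions. -/
theorem freeSemigroup_of_nonpos {t : ℝ} (ht : t ≤ 0) (f : L2R) : freeSemigroup t f = f := by
  apply (isRealSymbol_freeSymbol t).multiplier_eq
  refine Eventually.of_forall fun ξ => ?_
  simp [freeSymbol, max_eq_right ht]

theorem freeSemigroup_add {s t : ℝ} (hs : 0 ≤ s) (ht : 0 ≤ t) (f : L2R) :
    freeSemigroup (s + t) f = freeSemigroup s (freeSemigroup t f) := by
  rw [freeSemigroup, freeSemigroup, freeSemigroup,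
    ← (isRealSymbol_freeSymbol s).multiplier_mul (isRealSymbol_freeSymbol t)]
  congr 2
  ext ξ
  rw [freeSymbol, freeSymbol, freeSymbol, ← Complex.exp_add, max_eq_left hs, max_eq_left ht,
    max_eq_left (add_nonneg hs ht)]
  push_cast
  ring_nf

theorem continuous_freeSemigroup_apply (f : L2R) : Continuous fun t => freeSemigroup t f := by
  rw [continuous_iff_continuousAt]
  intro t
  refine tendsto_multiplier (Eventually.of_forall fun s => isRealSymbol_freeSymbol s)
    (isRealSymbol_freeSymbol t) (fun ξ => ?_) f
  have : Continuous fun s => freeSymbol s ξ := by unfold freeSymbol; fun_prop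
  exact this.tendsto t

/-- Joint continuity of a strongly continuous, locally bounded family of operators. -/
theorem continuous_uncurry_of_bound {S : ℝ → L2R →L[ℝ] L2R} (hc : ∀ f, Continuous fun t => S t f)
    (hb : ∀ T, ∃ K, ∀ t ≤ T, ∀ f, ‖S t f‖ ≤ K * ‖f‖) :
    Continuous fun p : ℝ × L2R => S p.1 p.2 := by
  rw [continuous_iff_continuousAt]
  rintro ⟨t, f⟩
  obtain ⟨K, hK⟩ := hb (t + 1)
  rw [ContinuousAt, tendsto_iff_norm_sub_tendsto_zero]
  have h1 : Tendsto (fun p : ℝ × L2R => K * ‖p.2 - f‖ + ‖S p.1 f - S t f‖)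
      (𝓝 (t, f)) (𝓝 0) := by
    have hcont : Continuous (fun p : ℝ × L2R => K * ‖p.2 - f‖ + ‖S p.1 f - S t f‖) := by
      have := (hc f).comp (continuous_fst (X := ℝ) (Y := L2R))
      simp only [Function.comp_def] at this
      fun_prop
    simpa using hcont.tendsto (t, f)
  refine squeeze_zero' (Eventually.of_forall fun _ => norm_nonneg _) ?_ h1
  have hn : ∀ᶠ p : ℝ × L2R in 𝓝 (t, f), p.1 < t + 1 :=
    continuous_fst.continuousAt.eventually_lt continuousAt_const (by simp)
  filter_upwards [hn] with p hp
  calc ‖S p.1 p.2 - S t f‖ = ‖S p.1 (p.2 - f) + (S p.1 f - S t f)‖ := by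
        rw [map_sub]; congr 1; abel
    _ ≤ _ := (norm_add_le _ _).trans (add_le_add_left (hK _ hp.le _) _)

theorem continuous_freeSemigroup : Continuous fun p : ℝ × L2R => freeSemigroup p.1 p.2 :=
  continuous_uncurry_of_bound continuous_freeSemigroup_apply fun _ =>
    ⟨1, fun t _ f => by rw [one_mul]; exact norm_freeSemigroup_apply_le t f⟩

/-- The symbol of the frequency cutoff to `|ξ| ≤ n`. -/
def cutoffSymbol (n : ℕ) (ξ : ℝ) : ℂ := if |ξ| ≤ n then 1 else 0

/-- A continuous symbol is bounded on [−n, n]. After the cutoff, differential operators are bounded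
on L² and pass through Bochner integrals. -/
theorem isRealSymbol_cutoff_mul (n : ℕ) {m : ℝ → ℂ} (hm : Continuous m)
    (hneg : ∀ ξ, m (-ξ) = conj (m ξ)) :
    ∃ C, IsRealSymbol (fun ξ => cutoffSymbol n ξ * m ξ) C := by
  obtain ⟨C, hC⟩ := (isCompact_Icc (a := -(n : ℝ)) (b := n)).exists_bound_of_continuousOn
    hm.continuousOn
  refine ⟨max C 0, ⟨?_, fun ξ => ?_, fun ξ => ?_⟩⟩
  · refine Measurable.mul ?_ hm.measurable
    exact Measurable.ite (measurableSet_le measurable_id.abs measurable_const) measurable_const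
      measurable_const
  · rw [cutoffSymbol]
    split_ifs with h
    · rw [one_mul]
      exact (hC ξ (abs_le.1 h)).trans (le_max_left _ _)
    · simp
  · rw [hneg, map_mul]
    simp only [cutoffSymbol, abs_neg]
    split_ifs <;> simp

theorem isRealSymbol_cutoff (n : ℕ) : IsRealSymbol (cutoffSymbol n) 1 where
  measurable := Measurable.ite (measurableSet_le measurable_id.abs measurable_const)
    measurable_const measurable_const
  bound ξ := by rw [cutoffSymbol]; split_ifs <;> simp
  neg ξ := by simp only [cutoffSymbol, abs_neg]; split_ifs <;> simp

/-- The frequency cutoff to `|ξ| ≤ n`. -/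
def cutoff (n : ℕ) : L2R →L[ℝ] L2R := multiplier (cutoffSymbol n)

/-- The derivative composed with the frequency cutoff. -/
def cutoffDeriv (n : ℕ) : L2R →L[ℝ] L2R := multiplier fun ξ => cutoffSymbol n ξ * derivSymbol ξ

/-- The operator `- ∂³ + ∂²` composed with the frequency cutoff. -/
def cutoffKdv (n : ℕ) : L2R →L[ℝ] L2R := multiplier fun ξ => cutoffSymbol n ξ * kdvSymbol ξ

theorem realFourier_cutoff (n : ℕ) (f : L2R) :
    ∀ᵐ ξ, realFourier (cutoff n f) ξ = cutoffSymbol n ξ * realFourier f ξ :=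
  (isRealSymbol_cutoff n).realFourier_multiplier f

theorem realFourier_cutoffDeriv (n : ℕ) (f : L2R) :
    ∀ᵐ ξ, realFourier (cutoffDeriv n f) ξ = cutoffSymbol n ξ * derivSymbol ξ * realFourier f ξ :=
  (isRealSymbol_cutoff_mul n continuous_derivSymbol conj_derivSymbol').choose_spec
    |>.realFourier_multiplier f

theorem realFourier_cutoffKdv (n : ℕ) (f : L2R) :
    ∀ᵐ ξ, realFourier (cutoffKdv n f) ξ = cutoffSymbol n ξ * kdvSymbol ξ * realFourier f ξ :=
  (isRealSymbol_cutoff_mul n continuous_kdvSymbol conj_kdvSymbol).choose_spec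
    |>.realFourier_multiplier f

theorem eventually_cutoffSymbol_eq_one (ξ : ℝ) : ∀ᶠ n in atTop, cutoffSymbol n ξ = 1 := by
  filter_upwards [eventually_ge_atTop ⌈|ξ|⌉₊] with n hn
  rw [cutoffSymbol, if_pos ((Nat.le_ceil _).trans (by exact_mod_cast hn))]

theorem tendsto_cutoff (f : L2R) : Tendsto (fun n => cutoff n f) atTop (𝓝 f) := by
  have h1 : IsRealSymbol (fun _ => 1) 1 := ⟨measurable_const, by simp, by simp⟩
  have e : multiplier (fun _ => 1) f = f := h1.multiplier_eq (by simp)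
  have := tendsto_multiplier (l := atTop) (m := cutoffSymbol) (m₀ := fun _ => 1)
    (Eventually.of_forall isRealSymbol_cutoff) h1 (fun ξ => tendsto_const_nhds.congr' (by
      filter_upwards [eventually_cutoffSymbol_eq_one ξ] with n hn using hn.symm)) f
  rwa [e] at this

theorem norm_cutoff_le (n : ℕ) (f : L2R) : ‖cutoff n f‖ ≤ ‖f‖ := by
  simpa [cutoff] using (isRealSymbol_cutoff n).norm_multiplier_le f

theorem hasWeakDerivL2_cutoff (n : ℕ) (f : L2R) :
    HasWeakDerivL2 (cutoff n f) (cutoffDeriv n f) := by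
  rw [hasWeakDerivL2_iff]
  filter_upwards [realFourier_cutoff n f, realFourier_cutoffDeriv n f] with ξ h1 h2
  rw [h1, h2]; ring

theorem HasWeakDerivL2.cutoff_eq {f g : L2R} (h : HasWeakDerivL2 f g) (n : ℕ) :
    cutoff n g = cutoffDeriv n f := by
  rw [hasWeakDerivL2_iff] at h
  apply (isRealSymbol_cutoff n).multiplier_eq
  filter_upwards [h, realFourier_cutoffDeriv n f] with ξ h1 h2
  rw [h1, h2]; ring

theorem HasWeakDerivL2.tendsto_cutoffDeriv {f g : L2R} (h : HasWeakDerivL2 f g) :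
    Tendsto (fun n => cutoffDeriv n f) atTop (𝓝 g) := by
  simpa only [h.cutoff_eq] using tendsto_cutoff g

theorem inner_cutoff_cutoff (n : ℕ) (f g : L2R) :
    inner ℝ (cutoff n f) (cutoff n g) = inner ℝ (cutoff n f) g := by
  rw [inner_eq_integral_realFourier, inner_eq_integral_realFourier]
  apply integral_congr_ae
  filter_upwards [realFourier_cutoff n f, realFourier_cutoff n g] with ξ h1 h2
  rw [h1, h2, cutoffSymbol]
  split_ifs <;> simp

/-- The dispersive part of the symbol is purely imaginary and drops out of the real inner product.
The real part is −|`derivSymbol`|², which is the dissipation. -/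
theorem inner_cutoff_cutoffKdv (n : ℕ) (f : L2R) :
    inner ℝ (cutoff n f) (cutoffKdv n f) = - ‖cutoffDeriv n f‖ ^ 2 := by
  rw [inner_eq_integral_realFourier, norm_sq_eq_integral_realFourier, ← integral_neg]
  apply integral_congr_ae
  filter_upwards [realFourier_cutoff n f, realFourier_cutoffDeriv n f, realFourier_cutoffKdv n f]
    with ξ h1 h2 h3
  rw [h1, h2, h3, cutoffSymbol]
  split_ifs
  · rw [one_mul, one_mul, one_mul, norm_mul, mul_pow, norm_derivSymbol, sq_abs,
      ← neg_mul, ← kdvSymbol_re, ← Complex.normSq_eq_norm_sq]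
    simp [Complex.inner, Complex.normSq_apply]
    ring
  · simp

theorem norm_cutoffDeriv_mono {n m : ℕ} (h : n ≤ m) (f : L2R) :
    ‖cutoffDeriv n f‖ ≤ ‖cutoffDeriv m f‖ := by
  rw [← realFourier.norm_map, ← realFourier.norm_map (cutoffDeriv m f)]
  apply Lp.norm_le_norm_of_ae_le
  filter_upwards [realFourier_cutoffDeriv n f, realFourier_cutoffDeriv m f] with ξ h1 h2
  rw [h1, h2, cutoffSymbol, cutoffSymbol]
  by_cases h3 : |ξ| ≤ n
  · rw [if_pos h3, if_pos (h3.trans (by exact_mod_cast h))]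
  · rw [if_neg h3]; simp

/-- Fatou's lemma on the frequency side: the cut off transforms converge pointwise, so the full
product with `derivSymbol` is in L². -/
theorem memH1_of_norm_cutoffDeriv_le {f : L2R} {B : ℝ} (hB : ∀ n, ‖cutoffDeriv n f‖ ≤ B) :
    MemH1 f := by
  have hle : eLpNorm (fun ξ => derivSymbol ξ * realFourier f ξ) 2 volume ≤ ENNReal.ofReal B := by
    refine (Lp.eLpNorm_lim_le_liminf_eLpNorm
      (f := fun n => (realFourier (cutoffDeriv n f) : ℝ → ℂ))
      (fun n => Lp.aestronglyMeasurable _) _ ?_).trans ?_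
    · have hall := ae_all_iff.2 fun n => realFourier_cutoffDeriv n f
      filter_upwards [hall] with ξ hξ
      refine tendsto_const_nhds.congr' ?_
      filter_upwards [eventually_cutoffSymbol_eq_one ξ] with n hn
      rw [hξ, hn, one_mul]
    · refine liminf_le_of_le (by isBoundedDefault) fun b hb => ?_
      obtain ⟨n, hn⟩ := hb.exists
      refine hn.trans ?_
      rw [← ENNReal.ofReal_toReal (Lp.eLpNorm_ne_top _), ← Lp.norm_def, realFourier.norm_map]
      exact ENNReal.ofReal_le_ofReal (hB n)
  obtain ⟨g, hg⟩ := exists_realFourier_eq_mul conj_derivSymbol' f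
    ⟨continuous_derivSymbol.aestronglyMeasurable.mul (Lp.aestronglyMeasurable _),
      hle.trans_lt ENNReal.ofReal_lt_top⟩
  exact ⟨g, hasWeakDerivL2_iff.2 hg⟩

theorem realFourier_freeSemigroup_quotient (t : ℝ) (f : L2R) :
    ∀ᵐ ξ, realFourier (t⁻¹ • (freeSemigroup t f - f)) ξ =
      ((t⁻¹ : ℝ) * (freeSymbol t ξ - 1)) * realFourier f ξ := by
  rw [map_smul, map_sub]
  filter_upwards [(isRealSymbol_freeSymbol t).realFourier_multiplier f,
    Lp.coeFn_smul t⁻¹ (realFourier (freeSemigroup t f) - realFourier f),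
    Lp.coeFn_sub (realFourier (freeSemigroup t f)) (realFourier f)] with ξ e2 e3 e4
  rw [e3, Pi.smul_apply, e4, Pi.sub_apply, freeSemigroup, e2, Complex.real_smul]
  ring

theorem norm_freeSymbol_quotient_le {t : ℝ} (ht : 0 < t) (ξ : ℝ) :
    ‖(t⁻¹ : ℝ) * (freeSymbol t ξ - 1)‖ ≤ ‖kdvSymbol ξ‖ := by
  have h2 := norm_exp_sub_one_le_of_re_nonpos (re_mul_kdvSymbol_nonpos ht.le ξ)
  rw [norm_mul, Complex.norm_real, Real.norm_of_nonneg ht.le] at h2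
  rw [norm_mul, Complex.norm_real, Real.norm_of_nonneg (by positivity), inv_mul_le_iff₀ ht,
    freeSymbol, max_eq_left ht.le]
  exact h2

theorem tendsto_freeSymbol_quotient (ξ : ℝ) :
    Tendsto (fun t : ℝ => (t⁻¹ : ℝ) * (freeSymbol t ξ - 1)) (𝓝[>] 0) (𝓝 (kdvSymbol ξ)) := by
  have h : HasDerivAt (fun t : ℝ => Complex.exp (t * kdvSymbol ξ)) (kdvSymbol ξ) 0 := by
    have := (((hasDerivAt_id (0 : ℝ)).ofReal_comp).mul_const (kdvSymbol ξ)).cexp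
    simpa using this
  refine h.tendsto_slope_zero_right.congr' ?_
  filter_upwards [self_mem_nhdsWithin] with t ht
  have ht : 0 < t := ht
  simp [freeSymbol, max_eq_left ht.le]

/-- Difference quotients of the free semigroup, under the frequency cutoff. -/
theorem tendsto_cutoff_freeSemigroup (n : ℕ) (f : L2R) :
    Tendsto (fun t : ℝ => cutoff n (t⁻¹ • (freeSemigroup t f - f))) (𝓝[>] 0)
      (𝓝 (cutoffKdv n f)) := by
  obtain ⟨C, hC⟩ := isRealSymbol_cutoff_mul n continuous_kdvSymbol conj_kdvSymbol
  apply tendsto_of_realFourier (G := fun ξ => C * ‖realFourier f ξ‖)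
    (a := fun t ξ => cutoffSymbol n ξ * (((t⁻¹ : ℝ) * (freeSymbol t ξ - 1)) * realFourier f ξ))
    (a₀ := fun ξ => cutoffSymbol n ξ * kdvSymbol ξ * realFourier f ξ)
  · exact (Lp.memLp (realFourier f)).norm.const_mul C
  · refine Eventually.of_forall fun t => ?_
    filter_upwards [realFourier_cutoff n (t⁻¹ • (freeSemigroup t f - f)),
      realFourier_freeSemigroup_quotient t f] with ξ e1 e2
    rw [e1, e2]
  · exact realFourier_cutoffKdv n f
  · filter_upwards [self_mem_nhdsWithin] with t ht
    refine Eventually.of_forall fun ξ => ?_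
    have h1 := hC.bound ξ
    have h2 := norm_freeSymbol_quotient_le ht ξ
    rw [norm_mul] at h1
    rw [norm_mul, norm_mul _ (realFourier f ξ), ← mul_assoc]
    exact mul_le_mul_of_nonneg_right
      ((mul_le_mul_of_nonneg_left h2 (norm_nonneg _)).trans h1) (norm_nonneg _)
  · refine Eventually.of_forall fun ξ => ?_
    rw [mul_assoc]
    exact ((tendsto_freeSymbol_quotient ξ).mul_const _).const_mul _

/-- The generator of the free semigroup. -/
theorem tendsto_freeSemigroup_quotient_iff {f g : L2R} :
    Tendsto (fun t : ℝ => t⁻¹ • (freeSemigroup t f - f)) (𝓝[>] 0) (𝓝 g) ↔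
      ∀ᵐ ξ, realFourier g ξ = kdvSymbol ξ * realFourier f ξ := by
  constructor
  · intro h
    -- Under a cutoff the quotients converge for every f, so the two limits can be compared. Each
    -- frequency lies below some n, which recovers the full identity.
    have hn : ∀ n, cutoff n g = cutoffKdv n f := fun n =>
      tendsto_nhds_unique (((cutoff n).continuous.tendsto g).comp h)
        (tendsto_cutoff_freeSemigroup n f)
    have hall : ∀ᵐ ξ, ∀ n, realFourier (cutoff n g) ξ =
        cutoffSymbol n ξ * kdvSymbol ξ * realFourier f ξ :=
      ae_all_iff.2 fun n => by rw [hn]; exact realFourier_cutoffKdv n f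
    filter_upwards [hall, ae_all_iff.2 fun n => realFourier_cutoff n g] with ξ h1 h2
    obtain ⟨n, hn⟩ := (eventually_cutoffSymbol_eq_one ξ).exists
    have := (h2 n).symm.trans (h1 n)
    rwa [hn, one_mul, one_mul] at this
  · intro h
    -- The quotients of the symbol are bounded by |`kdvSymbol`|, so the transform of g itself is the
    -- dominating function.
    apply tendsto_of_realFourier (G := fun ξ => ‖realFourier g ξ‖)
      (a := fun t ξ => ((t⁻¹ : ℝ) * (freeSymbol t ξ - 1)) * realFourier f ξ)
      (a₀ := fun ξ => kdvSymbol ξ * realFourier f ξ)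
    · exact (Lp.memLp (realFourier g)).norm
    · exact Eventually.of_forall fun t => realFourier_freeSemigroup_quotient t f
    · exact h
    · filter_upwards [self_mem_nhdsWithin] with t ht
      filter_upwards [h] with ξ hξ
      rw [hξ, norm_mul _ (realFourier f ξ), norm_mul (kdvSymbol ξ)]
      exact mul_le_mul_of_nonneg_right (norm_freeSymbol_quotient_le ht ξ)
        (norm_nonneg (realFourier f ξ))
    · exact Eventually.of_forall fun ξ => (tendsto_freeSymbol_quotient ξ).mul_const _

end FreeGroup

/-! ### Grönwall's lemma -/

section Gronwall

/-- Grönwall's lemma with an integrable coefficient. -/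
theorem eq_zero_of_le_integral_mul {T : ℝ} {φ a : ℝ → ℝ} (hφc : ContinuousOn φ (Icc 0 T))
    (hφ : ∀ t ∈ Icc 0 T, 0 ≤ φ t) (ha : IntegrableOn a (Icc 0 T)) (ha0 : ∀ t, 0 ≤ a t)
    (h : ∀ t ∈ Icc 0 T, φ t ≤ ∫ s in (0 : ℝ)..t, a s * φ s) : ∀ t ∈ Icc 0 T, φ t = 0 := by
  intro t₀ ht₀
  have hT : 0 ≤ T := ht₀.1.trans ht₀.2
  have hi : ∀ {x y}, x ∈ Icc 0 T → y ∈ Icc 0 T → IntervalIntegrable a volume x y := fun hx hy =>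
    (ha.mono_set (ordConnected_Icc.uIcc_subset hx hy)).intervalIntegrable
  have hai : ∀ {x y}, x ∈ Icc 0 T → y ∈ Icc 0 T →
      IntervalIntegrable (fun s => a s * φ s) volume x y := fun hx hy =>
    (hi hx hy).mul_continuousOn (hφc.mono (ordConnected_Icc.uIcc_subset hx hy))
  have h0 : (0 : ℝ) ∈ Icc 0 T := ⟨le_rfl, hT⟩
  have hTm : T ∈ Icc 0 T := ⟨hT, le_rfl⟩
  let Φ : ℝ → ℝ := fun t => ∫ s in (0 : ℝ)..t, a s * φ s
  have hΦc : ContinuousOn Φ (Icc 0 T) := by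
    have := intervalIntegral.continuousOn_primitive_interval' (hai h0 hTm) left_mem_uIcc
    rwa [uIcc_of_le hT] at this
  have hadd : ∀ {x y}, x ∈ Icc 0 T → y ∈ Icc 0 T → Φ y = Φ x + ∫ s in x..y, a s * φ s :=
    fun hx hy => (intervalIntegral.integral_add_adjacent_intervals (hai h0 hx) (hai hx hy)).symm
  have hmono : ∀ {x y}, x ∈ Icc 0 T → y ∈ Icc 0 T → x ≤ y → Φ x ≤ Φ y := by
    intro x y hx hy hxy
    rw [hadd hx hy, le_add_iff_nonneg_right]
    exact intervalIntegral.integral_nonneg hxy fun s hs =>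
      mul_nonneg (ha0 s) (hφ s ⟨hx.1.trans hs.1, hs.2.trans hy.2⟩)
  -- Continuous induction on the zero set of Φ. From a zero x one moves to a t with ∫ a < 1/2 over
  -- [x,t]; there monotonicity of Φ gives Φ(t) ≤ Φ(t)/2.
  have hsub : Icc 0 T ⊆ {t | Φ t = 0} := by
    apply IsClosed.Icc_subset_of_forall_exists_gt
    · rw [inter_comm]
      exact hΦc.preimage_isClosed_of_isClosed isClosed_Icc isClosed_singleton
    · exact intervalIntegral.integral_same
    · rintro x ⟨hx, hxI⟩ y hy
      have hx : Φ x = 0 := hx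
      have hy : x < y := hy
      have hxm : x ∈ Icc 0 T := ⟨hxI.1, hxI.2.le⟩
      have hcA : ContinuousOn (fun t => ∫ s in x..t, a s) (Icc x T) := by
        have := intervalIntegral.continuousOn_primitive_interval' (hi hxm hTm) left_mem_uIcc
        rwa [uIcc_of_le hxI.2.le] at this
      have hev : ∀ᶠ t in 𝓝[Icc x T] x, ∫ s in x..t, a s < 1 / 2 := by
        apply (hcA x ⟨le_rfl, hxI.2.le⟩).eventually_lt tendsto_const_nhds
        simp
      have hev' : ∀ᶠ t in 𝓝[>] x, t ∈ Ioc x (min y T) ∧ ∫ s in x..t, a s < 1 / 2 := by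
        have hmem : Ioc x (min y T) ∈ 𝓝[>] x := Ioc_mem_nhdsGT (lt_min hy hxI.2)
        have : 𝓝[>] x ≤ 𝓝[Icc x T] x := by
          rw [← nhdsWithin_Ioc_eq_nhdsGT hxI.2]
          exact nhdsWithin_mono _ Ioc_subset_Icc_self
        filter_upwards [hmem, this hev] with t h1 h2 using ⟨h1, h2⟩
      obtain ⟨t, ⟨htx, hty⟩, hta⟩ := hev'.exists
      have htm : t ∈ Icc 0 T := ⟨hxI.1.trans htx.le, hty.trans (min_le_right _ _)⟩
      refine ⟨t, ?_, htx, hty.trans (min_le_left _ _)⟩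
      have hnn : 0 ≤ Φ t := hx ▸ hmono hxm htm htx.le
      have hle : Φ t ≤ Φ t * ∫ s in x..t, a s := by
        have e := hadd hxm htm
        rw [hx, zero_add] at e
        conv_lhs => rw [e]
        rw [← intervalIntegral.integral_const_mul]
        apply intervalIntegral.integral_mono_on htx.le (hai hxm htm) ((hi hxm htm).const_mul _)
        intro s hs
        have hsm : s ∈ Icc 0 T := ⟨hxI.1.trans hs.1, hs.2.trans htm.2⟩
        rw [mul_comm]
        exact mul_le_mul_of_nonneg_right ((h s hsm).trans (hmono hsm htm hs.2)) (ha0 s)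
      change Φ t = 0
      nlinarith
  exact le_antisymm ((h t₀ ht₀).trans (hsub ht₀).le) (hφ t₀ ht₀)

end Gronwall

/-! ### Bounded perturbation of the free semigroup -/

section Perturbation

open scoped BoundedContinuousFunction

theorem integrableOn_exp_neg_mul {k : ℝ} (hk : 0 < k) :
    IntegrableOn (fun r : ℝ => Real.exp (-(k * r))) (Ioi 0) := by
  simpa only [neg_mul] using exp_neg_integrableOn_Ioi 0 hk

theorem integral_exp_neg_mul {k : ℝ} (hk : 0 < k) :
    ∫ r in Ioi (0 : ℝ), Real.exp (-(k * r)) = k⁻¹ := by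
  have := integral_exp_mul_Ioi (a := -k) (by linarith) 0
  simpa only [neg_mul, mul_zero, neg_zero, Real.exp_zero, div_neg, neg_div, neg_neg, one_div] using this

variable (L : L2R →L[ℝ] L2R)

/-- The exponential weight. -/
def volterraRate : ℝ := ‖L‖ + 1

theorem volterraRate_pos : 0 < volterraRate L := by unfold volterraRate; positivity

/-- The integrand of the weighted Volterra operator. -/
def volterraIntegrand (w : ℝ →ᵇ L2R) (t r : ℝ) : L2R :=
  (Iic t).indicator
    (fun r => Real.exp (-(volterraRate L * r)) • freeSemigroup r (L (w (t - r)))) r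

theorem continuous_volterra_kernel (w : ℝ →ᵇ L2R) :
    Continuous fun p : ℝ × ℝ =>
      Real.exp (-(volterraRate L * p.2)) • freeSemigroup p.2 (L (w (p.1 - p.2))) := by
  have h1 : Continuous fun p : ℝ × ℝ => freeSemigroup p.2 (L (w (p.1 - p.2))) :=
    continuous_freeSemigroup.comp (continuous_snd.prodMk
      (L.continuous.comp (w.continuous.comp (continuous_fst.sub continuous_snd))))
  fun_prop

theorem norm_volterraIntegrand_le (w : ℝ →ᵇ L2R) (t r : ℝ) :
    ‖volterraIntegrand L w t r‖ ≤ Real.exp (-(volterraRate L * r)) * (‖L‖ * ‖w‖) := by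
  refine (norm_indicator_le_norm_self _ _).trans ?_
  rw [norm_smul, Real.norm_of_nonneg (Real.exp_pos _).le]
  gcongr
  exact (norm_freeSemigroup_apply_le _ _).trans
    ((L.le_opNorm _).trans (by gcongr; exact w.norm_coe_le_norm _))

theorem aestronglyMeasurable_volterraIntegrand (w : ℝ →ᵇ L2R) (t : ℝ) (μ : Measure ℝ) :
    AEStronglyMeasurable (volterraIntegrand L w t) μ := by
  apply AEStronglyMeasurable.indicator _ measurableSet_Iic
  exact ((continuous_volterra_kernel L w).comp
    (continuous_const.prodMk continuous_id)).aestronglyMeasurable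

theorem integrable_volterraBound (w : ℝ →ᵇ L2R) :
    IntegrableOn (fun r => Real.exp (-(volterraRate L * r)) * (‖L‖ * ‖w‖)) (Ioi 0) :=
  (integrableOn_exp_neg_mul (volterraRate_pos L)).mul_const _

theorem integrable_volterraIntegrand (w : ℝ →ᵇ L2R) (t : ℝ) :
    IntegrableOn (volterraIntegrand L w t) (Ioi 0) :=
  (integrable_volterraBound L w).mono' (aestronglyMeasurable_volterraIntegrand L w t _)
    (Eventually.of_forall (norm_volterraIntegrand_le L w t))

theorem continuous_integral_volterraIntegrand (w : ℝ →ᵇ L2R) :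
    Continuous fun t => ∫ r in Ioi (0 : ℝ), volterraIntegrand L w t r := by
  rw [continuous_iff_continuousAt]
  intro t
  apply continuousAt_of_dominated
    (Eventually.of_forall fun s => aestronglyMeasurable_volterraIntegrand L w s _)
    (Eventually.of_forall fun s => Eventually.of_forall (norm_volterraIntegrand_le L w s))
    (integrable_volterraBound L w)
  -- Moving t also moves the jump of the indicator. For fixed r, continuity at t fails only if r =
  -- t, a null set.
  have hne : ∀ᵐ r : ℝ, r ≠ t := by simp [ae_iff]
  filter_upwards [ae_restrict_of_ae hne] with r hr
  have hc : Continuous fun s =>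
      Real.exp (-(volterraRate L * r)) • freeSemigroup r (L (w (s - r))) :=
    (continuous_volterra_kernel L w).comp (continuous_id.prodMk continuous_const)
  rcases lt_or_gt_of_ne hr with h | h
  · refine hc.continuousAt.congr ?_
    filter_upwards [lt_mem_nhds h] with s hs
    rw [volterraIntegrand, indicator_of_mem (mem_Iic.2 (le_of_lt hs))]
  · refine (continuousAt_const : ContinuousAt (fun _ : ℝ => (0 : L2R)) t).congr ?_
    filter_upwards [gt_mem_nhds h] with s hs
    rw [volterraIntegrand, indicator_of_notMem (by simpa using hs)]

theorem norm_integral_volterraIntegrand_le (w : ℝ →ᵇ L2R) (t : ℝ) :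
    ‖∫ r in Ioi (0 : ℝ), volterraIntegrand L w t r‖ ≤ (volterraRate L)⁻¹ * (‖L‖ * ‖w‖) := by
  refine (norm_integral_le_of_norm_le (integrable_volterraBound L w)
    (Eventually.of_forall (norm_volterraIntegrand_le L w t))).trans (le_of_eq ?_)
  rw [integral_mul_const, integral_exp_neg_mul (volterraRate_pos L)]

/-- The weighted Volterra operator. -/
def volterraOperator : (ℝ →ᵇ L2R) →L[ℝ] (ℝ →ᵇ L2R) :=
  LinearMap.mkContinuous
    { toFun := fun w => BoundedContinuousFunction.ofNormedAddCommGroup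
        (fun t => ∫ r in Ioi (0 : ℝ), volterraIntegrand L w t r)
        (continuous_integral_volterraIntegrand L w) ((volterraRate L)⁻¹ * (‖L‖ * ‖w‖)) 
        (norm_integral_volterraIntegrand_le L w)
      map_add' := fun v w => by
        ext1 t
        change ∫ r in Ioi (0 : ℝ), volterraIntegrand L (v + w) t r = 
          (∫ r in Ioi (0 : ℝ), volterraIntegrand L v t r) +
            ∫ r in Ioi (0 : ℝ), volterraIntegrand L w t r
        rw [← integral_add (integrable_volterraIntegrand L v t) (integrable_volterraIntegrand L w t)]
        congr 1
        ext1 r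
        simp only [volterraIntegrand, indicator]
        split_ifs <;> simp
      map_smul' := fun c w => by
        ext1 t
        change ∫ r in Ioi (0 : ℝ), volterraIntegrand L (c • w) t r =
          c • ∫ r in Ioi (0 : ℝ), volterraIntegrand L w t r
        rw [← integral_smul]
        congr 1
        ext1 r
        simp only [volterraIntegrand, indicator]
        split_ifs
        · simp [smul_comm c]
        · simp }
    ((volterraRate L)⁻¹ * ‖L‖) (fun w => by
      rw [mul_assoc]
      exact BoundedContinuousFunction.norm_ofNormedAddCommGroup_le _ (by
        have := volterraRate_pos L
        positivity)
        (norm_integral_volterraIntegrand_le L w))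

theorem volterraOperator_apply (w : ℝ →ᵇ L2R) (t : ℝ) :
    volterraOperator L w t = ∫ r in Ioi (0 : ℝ), volterraIntegrand L w t r := rfl

/-- The exponential weight integrates to the reciprocal of its rate, so the norm is at most ‖L‖/(‖L‖
+ 1). The Neumann series then solves the Volterra equation for all times at once, with a bounded
linear dependence on the datum. -/
theorem norm_neg_volterraOperator_lt : ‖-volterraOperator L‖ < 1 := by
  rw [norm_neg]
  have hk := volterraRate_pos L
  refine (LinearMap.mkContinuous_norm_le _ (by positivity) _).trans_lt ?_
  rw [inv_mul_lt_iff₀ hk, mul_one, volterraRate]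
  linarith

theorem norm_exp_smul_freeSemigroup_le (f : L2R) (t : ℝ) :
    ‖Real.exp (-(volterraRate L * max t 0)) • freeSemigroup t f‖ ≤ ‖f‖ := by
  rw [norm_smul, Real.norm_of_nonneg (Real.exp_pos _).le]
  have h1 : Real.exp (-(volterraRate L * max t 0)) ≤ 1 := by
    rw [Real.exp_le_one_iff, neg_nonpos]
    exact mul_nonneg (volterraRate_pos L).le (le_max_right _ _)
  calc _ ≤ 1 * ‖f‖ := by gcongr; exact norm_freeSemigroup_apply_le _ _
    _ = _ := one_mul _

/-- The weighted free evolution. -/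
def weightedFree : L2R →L[ℝ] (ℝ →ᵇ L2R) :=
  LinearMap.mkContinuous
    { toFun := fun f => BoundedContinuousFunction.ofNormedAddCommGroup
        (fun t => Real.exp (-(volterraRate L * max t 0)) • freeSemigroup t f)
        (by have := continuous_freeSemigroup_apply f; fun_prop) ‖f‖
        (norm_exp_smul_freeSemigroup_le L f)
      map_add' := fun f g => by ext1 t; simp
      map_smul' := fun c f => by ext1 t; simp [smul_comm c] }
    1 (fun f => by
      rw [one_mul]
      exact BoundedContinuousFunction.norm_ofNormedAddCommGroup_le _ (norm_nonneg _)
        (norm_exp_smul_freeSemigroup_le L f))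

theorem weightedFree_apply (f : L2R) (t : ℝ) :
    weightedFree L f t = Real.exp (-(volterraRate L * max t 0)) • freeSemigroup t f := rfl

/-- The weighted solution of the Volterra equation. -/
def weightedSolution : L2R →L[ℝ] (ℝ →ᵇ L2R) :=
  (((Units.oneSub (-volterraOperator L) (norm_neg_volterraOperator_lt L))⁻¹ :
    ((ℝ →ᵇ L2R) →L[ℝ] (ℝ →ᵇ L2R))ˣ) : (ℝ →ᵇ L2R) →L[ℝ] (ℝ →ᵇ L2R)).comp (weightedFree L)

theorem weightedSolution_eq (f : L2R) :
    weightedSolution L f = weightedFree L f - volterraOperator L (weightedSolution L f) := by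
  set N := Units.oneSub (-volterraOperator L) (norm_neg_volterraOperator_lt L)
  have h : (N : (ℝ →ᵇ L2R) →L[ℝ] (ℝ →ᵇ L2R)) (weightedSolution L f) = weightedFree L f := by
    have := congrArg (fun T : (ℝ →ᵇ L2R) →L[ℝ] (ℝ →ᵇ L2R) => T (weightedFree L f)) N.mul_inv
    exact this
  have hN : (N : (ℝ →ᵇ L2R) →L[ℝ] (ℝ →ᵇ L2R)) = 1 - -volterraOperator L := rfl
  rw [hN, sub_neg_eq_add, add_apply, one_apply_eq_self] at h
  rw [← h]; abel

/-- The semigroup generated by `- ∂³ + ∂² - L`. -/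
def perturbedSemigroup (t : ℝ) : L2R →L[ℝ] L2R :=
  Real.exp (volterraRate L * max t 0) •
    (BoundedContinuousFunction.evalCLM ℝ (max t 0)).comp (weightedSolution L)

theorem perturbedSemigroup_apply (t : ℝ) (f : L2R) : perturbedSemigroup L t f =
    Real.exp (volterraRate L * max t 0) • weightedSolution L f (max t 0) := rfl

theorem continuous_perturbedSemigroup_apply (f : L2R) :
    Continuous fun t => perturbedSemigroup L t f := by
  simp only [perturbedSemigroup_apply]
  have := (weightedSolution L f).continuous
  fun_prop

theorem exists_norm_perturbedSemigroup_le (T : ℝ) :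
    ∃ K, ∀ t ≤ T, ∀ f, ‖perturbedSemigroup L t f‖ ≤ K * ‖f‖ := by
  refine ⟨Real.exp (volterraRate L * max T 0) * ‖weightedSolution L‖, fun t ht f => ?_⟩
  rw [perturbedSemigroup_apply, norm_smul, Real.norm_of_nonneg (Real.exp_pos _).le, mul_assoc]
  have hk := volterraRate_pos L
  gcongr
  exact (BoundedContinuousFunction.norm_coe_le_norm _ _).trans ((weightedSolution L).le_opNorm f)

theorem continuous_perturbedSemigroup :
    Continuous fun p : ℝ × L2R => perturbedSemigroup L p.1 p.2 :=
  continuous_uncurry_of_bound (continuous_perturbedSemigroup_apply L)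
    (exists_norm_perturbedSemigroup_le L)

/-- The factor in front removes the exponential weight and the substitution s = t − r restores the
usual Duhamel form. The semigroup law and the generator are both derived from this equation. -/
theorem perturbedSemigroup_volterra {t : ℝ} (ht : 0 ≤ t) (f : L2R) :
    perturbedSemigroup L t f = freeSemigroup t f -
      ∫ s in (0 : ℝ)..t, freeSemigroup (t - s) (L (perturbedSemigroup L s f)) := by
  rw [perturbedSemigroup_apply, max_eq_left ht, weightedSolution_eq,
    BoundedContinuousFunction.sub_apply, smul_sub, weightedFree_apply, max_eq_left ht, smul_smul,
    ← Real.exp_add, add_neg_cancel, Real.exp_zero, one_smul, volterraOperator_apply]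
  congr 1
  have e1 : ∫ r in Ioi (0 : ℝ), volterraIntegrand L (weightedSolution L f) t r =
      ∫ r in (0 : ℝ)..t, Real.exp (-(volterraRate L * r)) •
        freeSemigroup r (L (weightedSolution L f (t - r))) := by
    rw [intervalIntegral.integral_of_le ht]
    simp only [volterraIntegrand]
    rw [integral_indicator measurableSet_Iic, Measure.restrict_restrict measurableSet_Iic,
      inter_comm, Ioi_inter_Iic]
  rw [e1, ← intervalIntegral.integral_smul]
  have e2 := intervalIntegral.integral_comp_sub_left (a := 0) (b := t)
    (fun s => freeSemigroup (t - s) (L (perturbedSemigroup L s f))) t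
  rw [sub_self, sub_zero] at e2
  rw [← e2]
  apply intervalIntegral.integral_congr
  intro r hr
  rw [uIcc_of_le ht] at hr
  have hr' : 0 ≤ t - r := sub_nonneg.2 hr.2
  change _ • (_ • _) = freeSemigroup (t - (t - r)) (L (perturbedSemigroup L (t - r) f))
  rw [sub_sub_cancel, perturbedSemigroup_apply, max_eq_left hr', smul_smul, ← Real.exp_add,
    map_smul, map_smul]
  congr 2
  ring

theorem continuous_duhamel_kernel {x : ℝ → L2R} (hx : Continuous x) :
    Continuous fun p : ℝ × ℝ => freeSemigroup (p.1 - p.2) (L (x p.2)) :=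
  continuous_freeSemigroup.comp ((continuous_fst.sub continuous_snd).prodMk
    (L.continuous.comp (hx.comp continuous_snd)))

/-- Uniqueness for the Volterra equation. -/
theorem eq_of_volterra {x y : ℝ → L2R} (hx : Continuous x) (hy : Continuous y) {f : L2R}
    (h : ∀ t, 0 ≤ t → x t = freeSemigroup t f - ∫ s in (0 : ℝ)..t, freeSemigroup (t - s) (L (x s)))
    (h' : ∀ t, 0 ≤ t →
      y t = freeSemigroup t f - ∫ s in (0 : ℝ)..t, freeSemigroup (t - s) (L (y s)))
    {t : ℝ} (ht : 0 ≤ t) : x t = y t := by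
  have key := eq_zero_of_le_integral_mul (T := t) (φ := fun s => ‖x s - y s‖)
    (a := fun _ => ‖L‖) (hx.sub hy).norm.continuousOn (fun _ _ => norm_nonneg _)
    (integrableOn_const (by simp)) (fun _ => norm_nonneg _) (fun s hs => by
      have e : x s - y s = ∫ r in (0 : ℝ)..s, freeSemigroup (s - r) (L (y r - x r)) := by
        rw [h s hs.1, h' s hs.1, sub_sub_sub_cancel_left, ← intervalIntegral.integral_sub]
        · simp only [map_sub]
        · exact ((continuous_duhamel_kernel L hy).comp
            (continuous_const.prodMk continuous_id)).intervalIntegrable _ _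
        · exact ((continuous_duhamel_kernel L hx).comp
            (continuous_const.prodMk continuous_id)).intervalIntegrable _ _
      rw [e]
      apply intervalIntegral.norm_integral_le_of_norm_le hs.1
      · refine Eventually.of_forall fun r _ => ?_
        rw [norm_sub_rev (x r)]
        exact (norm_freeSemigroup_apply_le _ _).trans (L.le_opNorm _)
      · exact (continuous_const.mul (hx.sub hy).norm).intervalIntegrable _ _) t ⟨ht, le_rfl⟩
  exact sub_eq_zero.1 (norm_eq_zero.1 key)

theorem perturbedSemigroup_zero (f : L2R) : perturbedSemigroup L 0 f = f := by
  rw [perturbedSemigroup_volterra L le_rfl, intervalIntegral.integral_same, sub_zero,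
    freeSemigroup_of_nonpos le_rfl]

/-- Splitting the Duhamel integral at t shows that the shifted orbit solves the Volterra equation
with datum S(t)f, and `eq_of_volterra` identifies it. -/
theorem perturbedSemigroup_add {s t : ℝ} (hs : 0 ≤ s) (ht : 0 ≤ t) (f : L2R) :
    perturbedSemigroup L (s + t) f = perturbedSemigroup L s (perturbedSemigroup L t f) := by
  refine eq_of_volterra L (x := fun s => perturbedSemigroup L (s + t) f)
    (y := fun s => perturbedSemigroup L s (perturbedSemigroup L t f))
    ((continuous_perturbedSemigroup_apply L f).comp (continuous_id.add continuous_const))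
    (continuous_perturbedSemigroup_apply L _) (f := perturbedSemigroup L t f) ?_
    (fun s hs => perturbedSemigroup_volterra L hs _) hs
  intro s hs
  have hc := continuous_duhamel_kernel L (continuous_perturbedSemigroup_apply L f)
  have hi : ∀ c a b, IntervalIntegrable
      (fun r => freeSemigroup (c - r) (L (perturbedSemigroup L r f))) volume a b := fun c a b =>
    (hc.comp (continuous_const.prodMk continuous_id)).intervalIntegrable _ _
  have e1 : ∫ r in (0 : ℝ)..t, freeSemigroup (s + t - r) (L (perturbedSemigroup L r f)) =
      freeSemigroup s (∫ r in (0 : ℝ)..t, freeSemigroup (t - r) (L (perturbedSemigroup L r f))) := by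
    rw [← (freeSemigroup s).intervalIntegral_comp_comm (hi _ _ _)]
    apply intervalIntegral.integral_congr
    intro r hr
    rw [uIcc_of_le ht] at hr
    change freeSemigroup (s + t - r) _ = freeSemigroup s (freeSemigroup (t - r) _)
    rw [← freeSemigroup_add hs (sub_nonneg.2 hr.2), add_sub_assoc]
  have e2 : ∫ r in t..(s + t), freeSemigroup (s + t - r) (L (perturbedSemigroup L r f)) =
      ∫ r in (0 : ℝ)..s, freeSemigroup (s - r) (L (perturbedSemigroup L (r + t) f)) := by
    have := intervalIntegral.integral_comp_add_right (a := 0) (b := s)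
      (fun r => freeSemigroup (s + t - r) (L (perturbedSemigroup L r f))) t
    rw [zero_add] at this
    rw [← this]
    simp only [add_sub_add_right_eq_sub]
  change perturbedSemigroup L (s + t) f = _
  rw [perturbedSemigroup_volterra L (add_nonneg hs ht), perturbedSemigroup_volterra L ht,
    ← intervalIntegral.integral_add_adjacent_intervals (hi (s + t) 0 t) (hi (s + t) t (s + t)),
    e1, e2, freeSemigroup_add hs ht, map_sub]
  abel

/-- The difference of the quotients is minus the mean over [0,t] of the Duhamel integrand, which is
jointly continuous with value Lf at the origin. Since f is arbitrary, the free and the perturbed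
generator have the same domain. -/
theorem tendsto_perturbedSemigroup_quotient_sub (f : L2R) :
    Tendsto (fun t : ℝ => t⁻¹ • (perturbedSemigroup L t f - f) -
      t⁻¹ • (freeSemigroup t f - f)) (𝓝[>] 0) (𝓝 (- L f)) := by
  have hc := continuous_duhamel_kernel L (continuous_perturbedSemigroup_apply L f)
  rw [Metric.tendsto_nhds]
  intro ε hε
  have h0 := Metric.continuousAt_iff.1 (hc.continuousAt (x := (0, 0))) (ε / 2) (by positivity)
  obtain ⟨δ, hδ, hδ'⟩ := h0
  filter_upwards [Ioo_mem_nhdsGT hδ] with t ht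
  have ht0 : 0 < t := ht.1
  rw [← smul_sub, sub_sub_sub_cancel_right, perturbedSemigroup_volterra L ht.1.le,
    sub_sub_cancel_left, smul_neg, dist_neg_neg, dist_eq_norm]
  have e : t⁻¹ • (∫ s in (0 : ℝ)..t, freeSemigroup (t - s) (L (perturbedSemigroup L s f))) - L f =
      t⁻¹ • ∫ s in (0 : ℝ)..t, (freeSemigroup (t - s) (L (perturbedSemigroup L s f)) - L f) := by
    have hi : IntervalIntegrable
        (fun s => freeSemigroup (t - s) (L (perturbedSemigroup L s f))) volume 0 t :=
      (hc.comp (continuous_const.prodMk continuous_id)).intervalIntegrable _ _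
    rw [intervalIntegral.integral_sub hi
      (continuous_const.intervalIntegrable _ _), intervalIntegral.integral_const, sub_zero, smul_sub,
      smul_smul, inv_mul_cancel₀ ht0.ne', one_smul]
  rw [e, norm_smul, Real.norm_of_nonneg (by positivity), inv_mul_lt_iff₀ ht0]
  have hb : ‖∫ s in (0 : ℝ)..t, (freeSemigroup (t - s) (L (perturbedSemigroup L s f)) - L f)‖ ≤
      ε / 2 * |t - 0| := by
    apply intervalIntegral.norm_integral_le_of_norm_le_const
    intro s hs
    rw [uIoc_of_le ht0.le] at hs
    have := hδ' (x := (t, s)) (by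
      rw [Prod.dist_eq, Real.dist_eq, Real.dist_eq, sub_zero, sub_zero, abs_of_pos ht0,
        abs_of_pos hs.1]
      exact max_lt ht.2 (hs.2.trans_lt ht.2))
    simp only [sub_zero, perturbedSemigroup_zero, freeSemigroup_of_nonpos le_rfl] at this
    rw [dist_eq_norm] at this
    exact this.le
  rw [sub_zero, abs_of_pos ht0] at hb
  nlinarith

theorem tendsto_perturbedSemigroup_quotient_iff {f g : L2R} :
    Tendsto (fun t : ℝ => t⁻¹ • (perturbedSemigroup L t f - f)) (𝓝[>] 0) (𝓝 g) ↔
      ∀ᵐ ξ, realFourier (g + L f) ξ = kdvSymbol ξ * realFourier f ξ := by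
  rw [← tendsto_freeSemigroup_quotient_iff]
  have h := tendsto_perturbedSemigroup_quotient_sub L f
  constructor
  · intro h1
    simpa using h1.sub h
  · intro h1
    simpa using h1.add h

/-- After the cutoff orbits are right differentiable for every f, without assuming that f is in the
domain of the generator. This is what makes energy estimates possible for L² data. -/
theorem tendsto_cutoff_perturbedSemigroup (n : ℕ) (f : L2R) :
    Tendsto (fun t : ℝ => cutoff n (t⁻¹ • (perturbedSemigroup L t f - f))) (𝓝[>] 0)
      (𝓝 (cutoffKdv n f - cutoff n (L f))) := by
  have h := ((cutoff n).continuous.tendsto _).comp (tendsto_perturbedSemigroup_quotient_sub L f)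
  have := (tendsto_cutoff_freeSemigroup n f).add h
  rw [map_neg, ← sub_eq_add_neg] at this
  refine this.congr fun t => ?_
  rw [Function.comp_apply, ← map_add, add_sub_cancel]

theorem isC0Semigroup_perturbedSemigroup : IsC0Semigroup (perturbedSemigroup L) where
  zero := by ext1 f; exact perturbedSemigroup_zero L f
  add s t hs ht := by ext1 f; exact perturbedSemigroup_add L hs ht f
  tendsto f := by
    have := (continuous_perturbedSemigroup_apply L f).tendsto 0
    rw [perturbedSemigroup_zero] at this
    exact this.mono_left nhdsWithin_le_nhds

end Perturbation

/-! ### Multiplication by bounded coefficients -/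

section Coefficient

/-- Multiplication by an `L^∞` coefficient as a bounded operator. -/
def coeffMulL (c : LinfR) : L2R →L[ℝ] L2R :=
  LinearMap.mkContinuous
    { toFun := coeffMul c
      map_add' := fun f g => Lp.add_smul c f g
      map_smul' := fun r f => (Lp.smul_comm r c f).symm }
    ‖c‖ (fun f => Lp.norm_smul_le c f)

theorem coeffMulL_apply (c : LinfR) (f : L2R) : coeffMulL c f = coeffMul c f := rfl

theorem inner_coeffMul (c : LinfR) (f g : L2R) :
    inner ℝ (coeffMul c f) g = ∫ x, c x * f x * g x := by
  rw [L2.inner_def]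
  apply integral_congr_ae
  filter_upwards [(Lp.coeFn_lpSMul c f : coeffMul c f =ᵐ[volume] _)] with x hx
  have hx' : coeffMul c f x = c x * f x := hx
  rw [hx']
  simp [mul_comm]

theorem hasGenerator_perturbedSemigroup (c : LinfR) :
    HasGenerator (perturbedSemigroup (coeffMulL c)) (KdVBurgersGraph c) := fun f g => by
  rw [tendsto_perturbedSemigroup_quotient_iff, kdvBurgersGraph_iff, coeffMulL_apply]

end Coefficient

/-! ### The inhomogeneous linear problem: regularity and energy -/

section Duhamel

variable (L : L2R →L[ℝ] L2R)

/-- The Duhamel integral of a forcing term. -/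
def duhamel (F : ℝ → L2R) (t : ℝ) : L2R := ∫ s in (0 : ℝ)..t, perturbedSemigroup L (t - s) (F s)

theorem aestronglyMeasurable_perturbedSemigroup {F : ℝ → L2R} {μ : Measure ℝ}
    (hF : AEStronglyMeasurable F μ) (t : ℝ) :
    AEStronglyMeasurable (fun s => perturbedSemigroup L (t - s) (F s)) μ :=
  (continuous_perturbedSemigroup L).comp_aestronglyMeasurable
    (f := fun s => (t - s, F s))
    ((continuous_const.sub continuous_id).aestronglyMeasurable.prodMk hF)

theorem norm_perturbedSemigroup_le_of_bound {T K : ℝ}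
    (hK : ∀ t ≤ T, ∀ f, ‖perturbedSemigroup L t f‖ ≤ K * ‖f‖) {t s : ℝ} (ht : t ≤ T) (hs : 0 ≤ s)
    (f : L2R) : ‖perturbedSemigroup L (t - s) f‖ ≤ K * ‖f‖ :=
  hK _ (by linarith) f

theorem integrableOn_perturbedSemigroup {T : ℝ} {F : ℝ → L2R} (hF : IntegrableOn F (Icc 0 T))
    {t : ℝ} (ht : t ≤ T) :
    IntegrableOn (fun s => perturbedSemigroup L (t - s) (F s)) (Icc 0 T) := by
  obtain ⟨K, hK⟩ := exists_norm_perturbedSemigroup_le L T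
  refine (hF.norm.const_mul K).mono'
    (aestronglyMeasurable_perturbedSemigroup L hF.aestronglyMeasurable t) ?_
  filter_upwards [ae_restrict_mem measurableSet_Icc] with s hs
  exact norm_perturbedSemigroup_le_of_bound L hK ht hs.1 _

theorem intervalIntegrable_of_integrableOn_Icc {E : Type*} [NormedAddCommGroup E] {T : ℝ}
    {F : ℝ → E} (hF : IntegrableOn F (Icc 0 T)) {a b : ℝ} (ha : a ∈ Icc 0 T) (hb : b ∈ Icc 0 T) :
    IntervalIntegrable F volume a b :=
  (hF.mono_set (ordConnected_Icc.uIcc_subset ha hb)).intervalIntegrable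

/-- An indicator turns the variable upper limit into a fixed domain, and dominated convergence with
K‖F‖ applies. Only integrability of F is available, since the nonlinear term is no better than L¹ in
time. -/
theorem continuousOn_duhamel {T : ℝ} {F : ℝ → L2R} (hF : IntegrableOn F (Icc 0 T)) :
    ContinuousOn (duhamel L F) (Icc 0 T) := by
  obtain ⟨K, hK⟩ := exists_norm_perturbedSemigroup_le L T
  let Φ : ℝ → ℝ → L2R := fun t => (Iic t).indicator fun s => perturbedSemigroup L (t - s) (F s)
  have e : EqOn (duhamel L F) (fun t => ∫ s in Ioc 0 T, Φ t s) (Icc 0 T) := by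
    intro t ht
    simp only [Φ]
    rw [integral_indicator measurableSet_Iic, Measure.restrict_restrict measurableSet_Iic, inter_comm,
      Ioc_inter_Iic, min_eq_right ht.2, duhamel, intervalIntegral.integral_of_le ht.1]
  have hF' : IntegrableOn F (Ioc 0 T) := hF.mono_set Ioc_subset_Icc_self
  refine ContinuousOn.congr ?_ e
  intro t ht
  apply continuousWithinAt_of_dominated (bound := fun s => K * ‖F s‖)
  · exact Eventually.of_forall fun r => (aestronglyMeasurable_perturbedSemigroup L
      hF'.aestronglyMeasurable r).indicator measurableSet_Iic
  · filter_upwards [self_mem_nhdsWithin] with r hr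
    filter_upwards [ae_restrict_mem measurableSet_Ioc] with s hs
    exact (norm_indicator_le_norm_self _ _).trans
      (norm_perturbedSemigroup_le_of_bound L hK hr.2 hs.1.le _)
  · exact hF'.norm.const_mul K
  · have hne : ∀ᵐ s : ℝ, s ≠ t := by simp [ae_iff]
    filter_upwards [ae_restrict_of_ae hne] with s hs
    apply ContinuousAt.continuousWithinAt
    have hc : Continuous fun r => perturbedSemigroup L (r - s) (F s) :=
      (continuous_perturbedSemigroup_apply L (F s)).comp (continuous_id.sub continuous_const)
    rcases lt_or_gt_of_ne hs with h | h
    · refine hc.continuousAt.congr ?_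
      filter_upwards [lt_mem_nhds h] with r hr
      simp only [Φ]
      rw [indicator_of_mem (mem_Iic.2 (le_of_lt hr))]
    · refine (continuousAt_const : ContinuousAt (fun _ : ℝ => (0 : L2R)) t).congr ?_
      filter_upwards [gt_mem_nhds h] with r hr
      simp only [Φ]
      rw [indicator_of_notMem (by simpa using hr)]

theorem norm_duhamel_le {T K : ℝ} (hK : ∀ t ≤ T, ∀ f, ‖perturbedSemigroup L t f‖ ≤ K * ‖f‖)
    (hK0 : 0 ≤ K) {F : ℝ → L2R} (hF : IntegrableOn F (Icc 0 T)) {t : ℝ} (ht : t ∈ Icc 0 T) :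
    ‖duhamel L F t‖ ≤ K * ∫ s in Icc 0 T, ‖F s‖ := by
  have hT : 0 ≤ T := ht.1.trans ht.2
  have hi := intervalIntegrable_of_integrableOn_Icc hF.norm ⟨le_rfl, hT⟩ ht
  calc ‖duhamel L F t‖ ≤ ∫ s in (0 : ℝ)..t, K * ‖F s‖ := by
        apply intervalIntegral.norm_integral_le_of_norm_le ht.1 _ (hi.const_mul K)
        exact Eventually.of_forall fun s hs =>
          norm_perturbedSemigroup_le_of_bound L hK ht.2 hs.1.le _
    _ = K * ∫ s in (0 : ℝ)..t, ‖F s‖ := intervalIntegral.integral_const_mul _ _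
    _ ≤ _ := by
        gcongr
        rw [intervalIntegral.integral_of_le ht.1]
        exact setIntegral_mono_set hF.norm (Eventually.of_forall fun s => norm_nonneg _)
          (Eventually.of_forall (Ioc_subset_Icc_self.trans (Icc_subset_Icc_right ht.2)))

/-- The generator under the frequency cutoff. -/
def cutoffGenerator (n : ℕ) : L2R →L[ℝ] L2R := cutoffKdv n - (cutoff n).comp L

/-- The cut off orbit has a continuous right derivative by the semigroup law, and a right derivative
is enough for the fundamental theorem of calculus. -/
theorem cutoff_perturbedSemigroup (n : ℕ) {t : ℝ} (ht : 0 ≤ t) (f : L2R) :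
    ∫ r in (0 : ℝ)..t, cutoffGenerator L n (perturbedSemigroup L r f) =
      cutoff n (perturbedSemigroup L t f) - cutoff n f := by
  have hc := continuous_perturbedSemigroup_apply L f
  have := intervalIntegral.integral_eq_sub_of_hasDeriv_right
    (f := fun t => cutoff n (perturbedSemigroup L t f))
    (f' := fun r => cutoffGenerator L n (perturbedSemigroup L r f)) (a := 0) (b := t)
    ((cutoff n).continuous.comp hc).continuousOn (fun x hx => ?_)
    (((cutoffGenerator L n).continuous.comp hc).intervalIntegrable _ _)
  · rw [this, perturbedSemigroup_zero]
  rw [min_eq_left ht, max_eq_right ht] at hx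
  rw [hasDerivWithinAt_iff_tendsto_slope' (by simp)]
  have h := tendsto_cutoff_perturbedSemigroup L n (perturbedSemigroup L x f)
  have hm : Tendsto (fun y => y - x) (𝓝[>] x) (𝓝[>] 0) := by
    apply tendsto_nhdsWithin_of_tendsto_nhds_of_eventually_within
    · have : Tendsto (fun y => y - x) (𝓝 x) (𝓝 (x - x)) := (continuous_sub_right x).tendsto x
      rw [sub_self] at this
      exact this.mono_left nhdsWithin_le_nhds
    · filter_upwards [self_mem_nhdsWithin] with y hy
      exact sub_pos.2 (mem_Ioi.1 hy)
  refine (h.comp hm).congr' ?_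
  filter_upwards [self_mem_nhdsWithin] with y hy
  have hy : x < y := hy
  rw [Function.comp_apply, ← perturbedSemigroup_add L (sub_pos.2 hy).le hx.1.le, sub_add_cancel,
    slope_def_module, map_smul, map_sub]

/-- The evolution equation satisfied by the frequency cutoff of a mild solution. -/
theorem cutoff_mild {T : ℝ} {F u : ℝ → L2R} {f : L2R} (hF : IntegrableOn F (Icc 0 T))
    (hu : ∀ t ∈ Icc 0 T, u t = perturbedSemigroup L t f + duhamel L F t) (n : ℕ) {t : ℝ}
    (ht : t ∈ Icc 0 T) :
    cutoff n (u t) = cutoff n f +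
      ∫ r in (0 : ℝ)..t, (cutoffGenerator L n (u r) + cutoff n (F r)) := by
  obtain ⟨K, hK⟩ := exists_norm_perturbedSemigroup_le L T
  have hT : 0 ≤ T := ht.1.trans ht.2
  have h0 : (0 : ℝ) ∈ Icc 0 T := ⟨le_rfl, hT⟩
  set C := cutoffGenerator L n with hC
  have hc := continuous_perturbedSemigroup_apply L f
  have hsub : Icc 0 t ⊆ Icc 0 T := Icc_subset_Icc_right ht.2
  have hFt : IntegrableOn F (Ioc 0 t) := hF.mono_set (Ioc_subset_Icc_self.trans hsub)
  have hFi := intervalIntegrable_of_integrableOn_Icc hF h0 ht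
  have hdc : ContinuousOn (fun r => C (duhamel L F r)) (uIcc 0 t) := by
    rw [uIcc_of_le ht.1]
    exact C.continuous.comp_continuousOn ((continuousOn_duhamel L hF).mono hsub)
  have hPF : IntervalIntegrable (fun r => cutoff n (F r)) volume 0 t := by
    rw [intervalIntegrable_iff, uIoc_of_le ht.1]
    exact (cutoff n).integrable_comp hFt
  have hK' : IntegrableOn (fun s => perturbedSemigroup L (t - s) (F s)) (Ioc 0 t) :=
    (integrableOn_perturbedSemigroup L hF ht.2).mono_set (Ioc_subset_Icc_self.trans hsub)
  have hPS : IntervalIntegrable (fun s => cutoff n (perturbedSemigroup L (t - s) (F s)))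
      volume 0 t := by
    rw [intervalIntegrable_iff, uIoc_of_le ht.1]
    exact (cutoff n).integrable_comp hK'
  -- The Duhamel term is not differentiated. Fubini on the triangle leaves, for each s, the
  -- integrated equation of the orbit that starts from F(s) at time s.
  have key : ∫ r in (0 : ℝ)..t, C (duhamel L F r) =
      cutoff n (duhamel L F t) - ∫ s in (0 : ℝ)..t, cutoff n (F s) := by
    calc ∫ r in (0 : ℝ)..t, C (duhamel L F r)
        = ∫ r in (0 : ℝ)..t, ∫ s in (0 : ℝ)..r, C (perturbedSemigroup L (r - s) (F s)) := by
          apply intervalIntegral.integral_congr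
          intro r hr
          rw [uIcc_of_le ht.1] at hr
          have hrT := hsub hr
          exact (C.intervalIntegral_comp_comm (intervalIntegrable_of_integrableOn_Icc
            (integrableOn_perturbedSemigroup L hF hrT.2) h0 hrT)).symm
      _ = ∫ s in (0 : ℝ)..t, ∫ r in s..t, C (perturbedSemigroup L (r - s) (F s)) := by
          apply intervalIntegral_triangle_swap ht.1
          have hi : Integrable (fun p : ℝ × ℝ => ‖C‖ * (K * ‖F p.2‖))
              ((volume.restrict (Ioc 0 t)).prod (volume.restrict (Ioc 0 t))) :=
            ((hFt.norm.comp_snd (volume.restrict (Ioc 0 t))).const_mul K).const_mul ‖C‖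
          refine hi.mono' ?_ ?_
          · apply C.continuous.comp_aestronglyMeasurable
            exact (continuous_perturbedSemigroup L).comp_aestronglyMeasurable
              (f := fun p : ℝ × ℝ => (p.1 - p.2, F p.2))
              ((continuous_fst.sub continuous_snd).aestronglyMeasurable.prodMk
                hFt.aestronglyMeasurable.comp_snd)
          · have hmem : ∀ᵐ p : ℝ × ℝ ∂((volume.restrict (Ioc 0 t)).prod
                (volume.restrict (Ioc 0 t))), p ∈ Ioc 0 t ×ˢ Ioc 0 t := by
              rw [Measure.prod_restrict]
              exact ae_restrict_mem (measurableSet_Ioc.prod measurableSet_Ioc)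
            filter_upwards [hmem] with p hp
            refine (C.le_opNorm _).trans ?_
            gcongr
            exact norm_perturbedSemigroup_le_of_bound L hK (hp.1.2.trans ht.2) hp.2.1.le _
      _ = ∫ s in (0 : ℝ)..t, (cutoff n (perturbedSemigroup L (t - s) (F s)) - cutoff n (F s)) := by
          apply intervalIntegral.integral_congr
          intro s hs
          rw [uIcc_of_le ht.1] at hs
          change ∫ r in s..t, C (perturbedSemigroup L (r - s) (F s)) =
            cutoff n (perturbedSemigroup L (t - s) (F s)) - cutoff n (F s)
          rw [← cutoff_perturbedSemigroup L n (sub_nonneg.2 hs.2),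
            intervalIntegral.integral_comp_sub_right
              (fun q => C (perturbedSemigroup L q (F s))) s, sub_self]
      _ = _ := by
          rw [intervalIntegral.integral_sub hPS hPF]
          congr 1
          exact (cutoff n).intervalIntegral_comp_comm
            (intervalIntegrable_of_integrableOn_Icc (integrableOn_perturbedSemigroup L hF ht.2) h0 ht)
  have e1 : ∫ r in (0 : ℝ)..t, (C (u r) + cutoff n (F r)) =
      ∫ r in (0 : ℝ)..t, ((C (perturbedSemigroup L r f) + C (duhamel L F r)) + cutoff n (F r)) := by
    apply intervalIntegral.integral_congr
    intro r hr
    rw [uIcc_of_le ht.1] at hr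
    change C (u r) + cutoff n (F r) = _
    rw [hu r (hsub hr), map_add]
  have hi1 : IntervalIntegrable (fun r => C (perturbedSemigroup L r f)) volume 0 t :=
    (C.continuous.comp hc).intervalIntegrable _ _
  rw [e1, intervalIntegral.integral_add (hi1.add hdc.intervalIntegrable) hPF,
    intervalIntegral.integral_add hi1 hdc.intervalIntegrable, key,
    cutoff_perturbedSemigroup L n ht.1, hu t ht, map_add]
  abel

theorem continuousOn_mild {T : ℝ} {F u : ℝ → L2R} {f : L2R} (hF : IntegrableOn F (Icc 0 T))
    (hu : ∀ t ∈ Icc 0 T, u t = perturbedSemigroup L t f + duhamel L F t) :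
    ContinuousOn u (Icc 0 T) :=
  ((continuous_perturbedSemigroup_apply L f).continuousOn.add (continuousOn_duhamel L hF)).congr hu

theorem mild_zero {T : ℝ} {F u : ℝ → L2R} {f : L2R} (hT : 0 ≤ T)
    (hu : ∀ t ∈ Icc 0 T, u t = perturbedSemigroup L t f + duhamel L F t) : u 0 = f := by
  rw [hu 0 ⟨le_rfl, hT⟩, perturbedSemigroup_zero, duhamel, intervalIntegral.integral_same, add_zero]

theorem intervalIntegrable_inner {a b : ℝ} {p q : ℝ → L2R} (hp : ContinuousOn p (uIcc a b))
    (hq : IntervalIntegrable q volume a b) :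
    IntervalIntegrable (fun s => inner ℝ (p s) (q s)) volume a b := by
  rw [intervalIntegrable_iff] at hq ⊢
  obtain ⟨C, hC⟩ := isCompact_uIcc.exists_bound_of_continuousOn hp
  refine (hq.norm.const_mul C).mono' ?_ ?_
  · exact ((hp.mono uIoc_subset_uIcc).aestronglyMeasurable measurableSet_uIoc).inner
      hq.aestronglyMeasurable
  · filter_upwards [ae_restrict_mem measurableSet_uIoc] with s hs
    refine (norm_inner_le_norm _ _).trans ?_
    gcongr
    exact hC s (uIoc_subset_uIcc hs)

/-- The energy identity under the frequency cutoff. -/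
theorem cutoff_energy {T : ℝ} {F u : ℝ → L2R} {f : L2R} (hF : IntegrableOn F (Icc 0 T))
    (hu : ∀ t ∈ Icc 0 T, u t = perturbedSemigroup L t f + duhamel L F t) (n : ℕ) {t : ℝ}
    (ht : t ∈ Icc 0 T) :
    ∫ s in (0 : ℝ)..t, ‖cutoffDeriv n (u s)‖ ^ 2 =
      1 / 2 * ‖cutoff n f‖ ^ 2 + (∫ s in (0 : ℝ)..t, inner ℝ (cutoff n (u s)) (F s)) -
        (∫ s in (0 : ℝ)..t, inner ℝ (cutoff n (u s)) (L (u s))) - 1 / 2 * ‖cutoff n (u t)‖ ^ 2 := by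
  have hT : 0 ≤ T := ht.1.trans ht.2
  have h0 : (0 : ℝ) ∈ Icc 0 T := ⟨le_rfl, hT⟩
  have hsub : Icc 0 t ⊆ Icc 0 T := Icc_subset_Icc_right ht.2
  have huc : ContinuousOn u (uIcc 0 t) := by
    rw [uIcc_of_le ht.1]; exact (continuousOn_mild L hF hu).mono hsub
  have hFi := intervalIntegrable_of_integrableOn_Icc hF h0 ht
  have hPu : ContinuousOn (fun s => cutoff n (u s)) (uIcc 0 t) :=
    (cutoff n).continuous.comp_continuousOn huc
  have hCu : IntervalIntegrable (fun s => cutoffGenerator L n (u s)) volume 0 t :=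
    ((cutoffGenerator L n).continuous.comp_continuousOn huc).intervalIntegrable
  have hPF : IntervalIntegrable (fun r => cutoff n (F r)) volume 0 t := by
    rw [intervalIntegrable_iff] at hFi ⊢
    exact (cutoff n).integrable_comp hFi
  have hy : ∀ r ∈ Icc 0 t, cutoff n (u r) = cutoff n (u 0) +
      ∫ s in (0 : ℝ)..r, (cutoffGenerator L n (u s) + cutoff n (F s)) := fun r hr => by
    rw [mild_zero L hT hu]; exact cutoff_mild L hF hu n (hsub hr)
  -- The product rule with both factors equal to the cut off solution. The cutoff is an orthogonal
  -- projection, so it may be dropped from the second argument in the pairings with F and Lu.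
  have h := inner_add_integral_eq (H := L2R) ht.1 ((hCu.add hPF).1) ((hCu.add hPF).1) hy hy
  rw [real_inner_self_eq_norm_sq, real_inner_self_eq_norm_sq, mild_zero L hT hu] at h
  have e : ∀ s, inner ℝ (cutoff n (u s)) (cutoffGenerator L n (u s) + cutoff n (F s)) +
      inner ℝ (cutoffGenerator L n (u s) + cutoff n (F s)) (cutoff n (u s)) =
      2 * ((inner ℝ (cutoff n (u s)) (F s) - inner ℝ (cutoff n (u s)) (L (u s))) -
        ‖cutoffDeriv n (u s)‖ ^ 2) := by
    intro s
    rw [real_inner_comm (cutoff n (u s)) (_ + _), cutoffGenerator, sub_apply,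
      ContinuousLinearMap.comp_apply, inner_add_right, inner_sub_right, inner_cutoff_cutoffKdv,
      inner_cutoff_cutoff, inner_cutoff_cutoff]
    ring
  have i1 := intervalIntegrable_inner hPu hFi
  have i2 : IntervalIntegrable (fun s => inner ℝ (cutoff n (u s)) (L (u s))) volume 0 t :=
    (hPu.inner (𝕜 := ℝ) (L.continuous.comp_continuousOn huc)).intervalIntegrable
  have i3 : IntervalIntegrable (fun s => ‖cutoffDeriv n (u s)‖ ^ 2) volume 0 t :=
    (((cutoffDeriv n).continuous.comp_continuousOn huc).norm.pow 2).intervalIntegrable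
  simp only [e] at h
  rw [intervalIntegral.integral_const_mul, intervalIntegral.integral_sub (i1.sub i2) i3,
    intervalIntegral.integral_sub i1 i2] at h
  linarith

theorem tendsto_integral_inner_cutoff {t : ℝ} (ht : 0 ≤ t) {u G : ℝ → L2R}
    (hu : ContinuousOn u (Icc 0 t)) (hG : IntervalIntegrable G volume 0 t) :
    Tendsto (fun n => ∫ s in (0 : ℝ)..t, inner ℝ (cutoff n (u s)) (G s)) atTop
      (𝓝 (∫ s in (0 : ℝ)..t, inner ℝ (u s) (G s))) := by
  rw [← uIcc_of_le ht] at hu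
  obtain ⟨M, hM⟩ := isCompact_uIcc.exists_bound_of_continuousOn hu
  apply intervalIntegral.tendsto_integral_filter_of_dominated_convergence (fun s => M * ‖G s‖)
  · exact Eventually.of_forall fun n => (intervalIntegrable_iff.1 (intervalIntegrable_inner
      ((cutoff n).continuous.comp_continuousOn hu) hG)).aestronglyMeasurable
  · refine Eventually.of_forall fun n => Eventually.of_forall fun s hs => ?_
    refine (norm_inner_le_norm _ _).trans ?_
    gcongr
    exact (norm_cutoff_le _ _).trans (hM s (uIoc_subset_uIcc hs))
  · exact hG.norm.const_mul M
  · exact Eventually.of_forall fun s _ => (tendsto_cutoff (u s)).inner tendsto_const_nhds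

/-- Regularity of mild solutions and the energy identity for the linear problem. -/
theorem memBT_and_energy_of_mild {T : ℝ} {F u : ℝ → L2R} {f : L2R} (hT : 0 ≤ T)
    (hF : IntegrableOn F (Icc 0 T))
    (hu : ∀ t ∈ Icc 0 T, u t = perturbedSemigroup L t f + duhamel L F t) :
    MemBT T u ∧ ∀ t ∈ Icc 0 T, ∫ s in (0 : ℝ)..t, ‖weakDeriv (u s)‖ ^ 2 =
      1 / 2 * ‖f‖ ^ 2 + (∫ s in (0 : ℝ)..t, inner ℝ (u s) (F s)) -
        (∫ s in (0 : ℝ)..t, inner ℝ (u s) (L (u s))) - 1 / 2 * ‖u t‖ ^ 2 := by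
  have h0 : (0 : ℝ) ∈ Icc 0 T := ⟨le_rfl, hT⟩
  have hTm : T ∈ Icc 0 T := ⟨hT, le_rfl⟩
  have huc := continuousOn_mild L hF hu
  -- Every other term of the cut off energy identity converges, so the dissipation integrals do too.
  -- No a priori information on uₓ is used.
  have hlim : ∀ t ∈ Icc 0 T, Tendsto (fun n => ∫ s in (0 : ℝ)..t, ‖cutoffDeriv n (u s)‖ ^ 2) atTop
      (𝓝 (1 / 2 * ‖f‖ ^ 2 + (∫ s in (0 : ℝ)..t, inner ℝ (u s) (F s)) -
        (∫ s in (0 : ℝ)..t, inner ℝ (u s) (L (u s))) - 1 / 2 * ‖u t‖ ^ 2)) := by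
    intro t ht
    have hut : ContinuousOn u (Icc 0 t) := huc.mono (Icc_subset_Icc_right ht.2)
    simp only [cutoff_energy L hF hu _ ht]
    refine Tendsto.sub (Tendsto.sub (Tendsto.add ?_ ?_) ?_) ?_
    · exact ((tendsto_cutoff f).norm.pow 2).const_mul _
    · exact tendsto_integral_inner_cutoff ht.1 hut (intervalIntegrable_of_integrableOn_Icc hF h0 ht)
    · apply tendsto_integral_inner_cutoff ht.1 hut
      rw [← uIcc_of_le ht.1] at hut
      exact (L.continuous.comp_continuousOn hut).intervalIntegrable
    · exact ((tendsto_cutoff (u t)).norm.pow 2).const_mul _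
  set μ : Measure ℝ := volume.restrict (Icc 0 T) with hμ
  have hcd : ∀ n, ContinuousOn (fun s => cutoffDeriv n (u s)) (Icc 0 T) := fun n =>
    (cutoffDeriv n).continuous.comp_continuousOn huc
  have hmeas : ∀ n, AEStronglyMeasurable (fun s => cutoffDeriv n (u s)) μ := fun n =>
    (hcd n).aestronglyMeasurable measurableSet_Icc
  let q : ℕ → ℝ → ℝ≥0∞ := fun n s => ENNReal.ofReal (‖cutoffDeriv n (u s)‖ ^ 2)
  have hqm : ∀ n, AEMeasurable (q n) μ := fun n =>
    ((hmeas n).norm.pow 2).aemeasurable.ennreal_ofReal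
  have hqmono : ∀ s, Monotone fun n => q n s := fun s n m hnm =>
    ENNReal.ofReal_le_ofReal (by gcongr; exact norm_cutoffDeriv_mono hnm _)
  have hqint : ∀ n, ∫⁻ s, q n s ∂μ =
      ENNReal.ofReal (∫ s in (0 : ℝ)..T, ‖cutoffDeriv n (u s)‖ ^ 2) := by
    intro n
    rw [intervalIntegral.integral_of_le hT, ← integral_Icc_eq_integral_Ioc,
      ofReal_integral_eq_lintegral_ofReal]
    · exact ((hcd n).norm.pow 2).integrableOn_Icc
    · exact Eventually.of_forall fun s => by positivity
  -- Monotone convergence in time. At almost every s the cut off derivatives are then bounded in n,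
  -- which puts u(s) in H¹.
  have hfin : ∫⁻ s, ⨆ n, q n s ∂μ < ⊤ := by
    rw [lintegral_iSup' hqm (Eventually.of_forall hqmono)]
    obtain ⟨B, hB⟩ := (hlim T hTm).bddAbove_range
    refine lt_of_le_of_lt (iSup_le fun n => ?_) (ENNReal.ofReal_lt_top (r := B))
    rw [hqint]
    exact ENNReal.ofReal_le_ofReal (hB ⟨n, rfl⟩)
  have hae : ∀ᵐ s ∂μ, ⨆ n, q n s < ⊤ := ae_lt_top' (.iSup hqm) hfin.ne
  have hH1 : ∀ᵐ s ∂μ, MemH1 (u s) := by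
    filter_upwards [hae] with s hs
    apply memH1_of_norm_cutoffDeriv_le (B := √((⨆ n, q n s).toReal))
    intro n
    apply Real.le_sqrt_of_sq_le
    rw [← ENNReal.ofReal_le_iff_le_toReal hs.ne]
    exact le_iSup (fun n => q n s) n
  have htend : ∀ᵐ s ∂μ, Tendsto (fun n => cutoffDeriv n (u s)) atTop (𝓝 (weakDeriv (u s))) := by
    filter_upwards [hH1] with s hs using hs.hasWeakDerivL2.tendsto_cutoffDeriv
  have hDm : AEStronglyMeasurable (fun s => weakDeriv (u s)) μ :=
    aestronglyMeasurable_of_tendsto_ae atTop hmeas htend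
  have hle : ∀ᵐ s ∂μ, ∀ n, ‖cutoffDeriv n (u s)‖ ^ 2 ≤ ‖weakDeriv (u s)‖ ^ 2 := by
    filter_upwards [htend] with s hs n
    have hmono : Monotone fun n => ‖cutoffDeriv n (u s)‖ := fun n m hnm =>
      norm_cutoffDeriv_mono hnm _
    have := hmono.ge_of_tendsto hs.norm n
    gcongr
  have hDint : Integrable (fun s => ‖weakDeriv (u s)‖ ^ 2) μ := by
    refine ⟨hDm.norm.pow 2, ?_⟩
    rw [hasFiniteIntegral_iff_ofReal (Eventually.of_forall fun s => by positivity)]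
    refine lt_of_le_of_lt (lintegral_mono_ae ?_) hfin
    filter_upwards [htend] with s hs
    refine le_of_tendsto (ENNReal.tendsto_ofReal (hs.norm.pow 2)) (Eventually.of_forall fun n => ?_)
    exact le_iSup (fun n => q n s) n
  refine ⟨⟨huc, hH1, (memLp_two_iff_integrable_sq_norm hDm).2 hDint⟩, fun t ht => ?_⟩
  refine tendsto_nhds_unique ?_ (hlim t ht)
  have hsub : Ioc 0 t ⊆ Icc 0 T := Ioc_subset_Icc_self.trans (Icc_subset_Icc_right ht.2)
  have hres : ∀ {p : ℝ → Prop}, (∀ᵐ s ∂μ, p s) → ∀ᵐ s ∂volume.restrict (Ioc 0 t), p s := fun h =>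
    ae_restrict_of_ae_restrict_of_subset hsub h
  simp only [intervalIntegral.integral_of_le ht.1]
  apply tendsto_integral_of_dominated_convergence (fun s => ‖weakDeriv (u s)‖ ^ 2)
  · exact fun n => (((hmeas n).norm.pow 2).mono_measure (Measure.restrict_mono hsub le_rfl))
  · exact IntegrableOn.mono_set hDint hsub
  · intro n
    filter_upwards [hres hle] with s hs
    rw [Real.norm_of_nonneg (by positivity)]
    exact hs n
  · filter_upwards [hres htend] with s hs using hs.norm.pow 2

end Duhamel

/-! ### The convection term in L¹(0,T;L²) -/

section Nonlinearity

/-- The nonlinearity `f ∂ₓ f`. -/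
def convection (f : L2R) : L2R := mulL2 f (weakDeriv f)

theorem MemH1.sub {f g : L2R} (hf : MemH1 f) (hg : MemH1 g) : MemH1 (f - g) :=
  ⟨_, hf.hasWeakDerivL2.sub hg.hasWeakDerivL2⟩

theorem MemH1.weakDeriv_sub {f g : L2R} (hf : MemH1 f) (hg : MemH1 g) :
    weakDeriv (f - g) = weakDeriv f - weakDeriv g :=
  (hf.hasWeakDerivL2.sub hg.hasWeakDerivL2).weakDeriv_eq

theorem MemH1.norm_mulL2_le {f : L2R} (hf : MemH1 f) (k : L2R) {θ : ℝ} (hθ : 0 < θ) :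
    ‖mulL2 f k‖ ≤ (θ⁻¹ * ‖f‖ + θ * ‖weakDeriv f‖) * ‖k‖ :=
  hf.hasWeakDerivL2.norm_mulL2_le_add k hθ

theorem MemH1.convection_sub {f g : L2R} (hf : MemH1 f) (hg : MemH1 g) :
    convection f - convection g =
      mulL2 (f - g) (weakDeriv f) + mulL2 g (weakDeriv (f - g)) := by
  rw [convection, convection, hf.hasWeakDerivL2.mulL2_sub_left hg.hasWeakDerivL2,
    hf.weakDeriv_sub hg, hg.hasWeakDerivL2.mulL2_sub_right]
  abel

/-- Serves only for measurability in time. Multiplication is not continuous on L² × L², but a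
frequency cutoff on the first factor makes it so, and the cutoff is removed by a pointwise limit
when that factor is in H¹. -/
theorem continuous_mulL2_cutoff (n : ℕ) :
    Continuous fun p : L2R × L2R => mulL2 (cutoff n p.1) p.2 := by
  have hb : ∀ f k : L2R, ‖mulL2 (cutoff n f) k‖ ≤ (1 + ‖cutoffDeriv n‖) * ‖f‖ * ‖k‖ := by
    intro f k
    refine ((hasWeakDerivL2_cutoff n f).norm_mulL2_le_add k one_pos).trans ?_
    gcongr
    rw [inv_one, one_mul, one_mul, add_mul, one_mul]
    exact add_le_add (norm_cutoff_le n f) ((cutoffDeriv n).le_opNorm f)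
  rw [continuous_iff_continuousAt]
  rintro ⟨f, k⟩
  rw [ContinuousAt, tendsto_iff_norm_sub_tendsto_zero]
  have h1 : Tendsto (fun p : L2R × L2R => (1 + ‖cutoffDeriv n‖) * ‖p.1 - f‖ * ‖p.2‖ +
      (1 + ‖cutoffDeriv n‖) * ‖f‖ * ‖p.2 - k‖) (𝓝 (f, k)) (𝓝 0) := by
    have hc : Continuous (fun p : L2R × L2R => (1 + ‖cutoffDeriv n‖) * ‖p.1 - f‖ * ‖p.2‖ +
      (1 + ‖cutoffDeriv n‖) * ‖f‖ * ‖p.2 - k‖) := by fun_prop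
    simpa using hc.tendsto (f, k)
  refine squeeze_zero (fun _ => norm_nonneg _) (fun p => ?_) h1
  have e : mulL2 (cutoff n p.1) p.2 - mulL2 (cutoff n f) k =
      mulL2 (cutoff n (p.1 - f)) p.2 + mulL2 (cutoff n f) (p.2 - k) := by
    rw [map_sub, (hasWeakDerivL2_cutoff n p.1).mulL2_sub_left (hasWeakDerivL2_cutoff n f),
      (hasWeakDerivL2_cutoff n f).mulL2_sub_right]
    abel
  change ‖mulL2 (cutoff n p.1) p.2 - mulL2 (cutoff n f) k‖ ≤ _
  rw [e]
  exact (norm_add_le _ _).trans (add_le_add (hb _ _) (hb _ _))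

theorem MemH1.tendsto_mulL2_cutoff {f : L2R} (hf : MemH1 f) (k : L2R) :
    Tendsto (fun n => mulL2 (cutoff n f) k) atTop (𝓝 (mulL2 f k)) := by
  have hw := hf.hasWeakDerivL2
  rw [tendsto_iff_norm_sub_tendsto_zero]
  have h1 : Tendsto (fun n => (‖cutoff n f - f‖ + ‖cutoffDeriv n f - weakDeriv f‖) * ‖k‖) atTop
      (𝓝 0) := by
    have := ((tendsto_iff_norm_sub_tendsto_zero.1 (tendsto_cutoff f)).add
      (tendsto_iff_norm_sub_tendsto_zero.1 hw.tendsto_cutoffDeriv)).mul_const ‖k‖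
    simpa using this
  refine squeeze_zero (fun _ => norm_nonneg _) (fun n => ?_) h1
  rw [← (hasWeakDerivL2_cutoff n f).mulL2_sub_left hw]
  have := ((hasWeakDerivL2_cutoff n f).sub hw).norm_mulL2_le_add k one_pos
  simpa using this

theorem MemBT.aestronglyMeasurable_convection {T : ℝ} {u : ℝ → L2R} (hu : MemBT T u) :
    AEStronglyMeasurable (fun s => convection (u s)) (volume.restrict (Icc 0 T)) := by
  have hm : AEStronglyMeasurable (fun s => (u s, weakDeriv (u s))) (volume.restrict (Icc 0 T)) :=
    (hu.continuousOn.aestronglyMeasurable measurableSet_Icc).prodMk hu.memLp.1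
  have hn : ∀ n, AEStronglyMeasurable (fun s => mulL2 (cutoff n (u s)) (weakDeriv (u s)))
      (volume.restrict (Icc 0 T)) := fun n =>
    (continuous_mulL2_cutoff n).comp_aestronglyMeasurable (f := fun s => (u s, weakDeriv (u s))) hm
  refine aestronglyMeasurable_of_tendsto_ae atTop hn ?_
  · filter_upwards [hu.memH1] with s hs using hs.tendsto_mulL2_cutoff _

theorem memLp_two_of_continuousOn {T : ℝ} {u : ℝ → L2R} (hu : ContinuousOn u (Icc 0 T)) :
    MemLp u 2 (volume.restrict (Icc 0 T)) := by
  obtain ⟨C, hC⟩ := isCompact_Icc.exists_bound_of_continuousOn hu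
  refine MemLp.of_bound (hu.aestronglyMeasurable measurableSet_Icc) C ?_
  filter_upwards [ae_restrict_mem measurableSet_Icc] with s hs using hC s hs

theorem MemBT.integrableOn_convection {T : ℝ} {u : ℝ → L2R} (hu : MemBT T u) :
    IntegrableOn (fun s => convection (u s)) (Icc 0 T) := by
  have h1 : Integrable (fun s => (‖u s‖ + ‖weakDeriv (u s)‖) * ‖weakDeriv (u s)‖)
      (volume.restrict (Icc 0 T)) :=
    MemLp.integrable_mul (p := 2) (q := 2)
      ((memLp_two_of_continuousOn hu.continuousOn).norm.add hu.memLp.norm) hu.memLp.norm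
  refine h1.mono' hu.aestronglyMeasurable_convection ?_
  filter_upwards [hu.memH1] with s hs
  have := hs.norm_mulL2_le (weakDeriv (u s)) one_pos
  rw [inv_one, one_mul, one_mul] at this
  exact this

theorem integral_mul_le_of_sq_le {μ : Measure ℝ} {p q : ℝ → ℝ} (hp : MemLp p 2 μ)
    (hq : MemLp q 2 μ) {P Q : ℝ} (hP : 0 ≤ P) (hQ : 0 ≤ Q) (hpP : ∫ s, p s ^ 2 ∂μ ≤ P ^ 2)
    (hqQ : ∫ s, q s ^ 2 ∂μ ≤ Q ^ 2) : ∫ s, p s * q s ∂μ ≤ P * Q := by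
  have hnorm : ∀ {r : ℝ → ℝ} (hr : MemLp r 2 μ) {R : ℝ}, 0 ≤ R → ∫ s, r s ^ 2 ∂μ ≤ R ^ 2 →
      ‖hr.toLp r‖ ≤ R := by
    intro r hr R hR h
    refine le_of_sq_le_sq ?_ hR
    refine le_trans (le_of_eq ?_) h
    rw [← real_inner_self_eq_norm_sq, L2.inner_def]
    apply integral_congr_ae
    filter_upwards [hr.coeFn_toLp] with s hs
    rw [hs]; simp [sq]
  have h := real_inner_le_norm (hp.toLp p) (hq.toLp q)
  rw [L2.inner_def] at h
  have e : ∫ s, inner ℝ (hp.toLp p s) (hq.toLp q s) ∂μ = ∫ s, p s * q s ∂μ := by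
    apply integral_congr_ae
    filter_upwards [hp.coeFn_toLp, hq.coeFn_toLp] with s h1 h2
    rw [h1, h2]; simp [mul_comm]
  rw [e] at h
  exact h.trans (mul_le_mul (hnorm hp hP hpP) (hnorm hq hQ hqQ) (norm_nonneg _) hP)

/-- The bilinear estimate in `L¹(0,T)`. -/
theorem integral_bilinear_le {T : ℝ} (hT : 0 ≤ T) {a p q : ℝ → ℝ} {A P Q θ : ℝ} (hθ : 0 < θ)
    (hA : 0 ≤ A) (hP : 0 ≤ P) (hQ : 0 ≤ Q)
    (ham : MemLp a 2 (volume.restrict (Icc 0 T))) (haA : ∀ s ∈ Icc 0 T, |a s| ≤ A)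
    (hp : MemLp p 2 (volume.restrict (Icc 0 T))) (hq : MemLp q 2 (volume.restrict (Icc 0 T)))
    (hpP : ∫ s in Icc 0 T, p s ^ 2 ≤ P ^ 2) (hqQ : ∫ s in Icc 0 T, q s ^ 2 ≤ Q ^ 2) :
    ∫ s in Icc 0 T, (θ⁻¹ * a s + θ * p s) * q s ≤ (θ⁻¹ * √T * A + θ * P) * Q := by
  -- A bound uniform in time gains √T over a bound in L²(0,T). The derivative factor has no such
  -- gain and relies on θ instead.
  have h1 : ∫ s in Icc 0 T, a s * q s ≤ (√T * A) * Q := by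
    apply integral_mul_le_of_sq_le ham hq (by positivity) hQ _ hqQ
    calc ∫ s in Icc 0 T, a s ^ 2 ≤ ∫ s in Icc 0 T, A ^ 2 := by
          apply setIntegral_mono_on ham.integrable_sq (integrableOn_const (by simp))
            measurableSet_Icc
          intro s hs
          rw [← sq_abs]
          gcongr
          exact haA s hs
      _ = (√T * A) ^ 2 := by
          rw [setIntegral_const, measureReal_def, Real.volume_Icc, sub_zero,
            ENNReal.toReal_ofReal hT, mul_pow, Real.sq_sqrt hT, smul_eq_mul]
  have h2 := integral_mul_le_of_sq_le hp hq hP hQ hpP hqQ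
  have i1 : Integrable (fun s => a s * q s) (volume.restrict (Icc 0 T)) :=
    MemLp.integrable_mul (p := 2) (q := 2) ham hq
  have i2 : Integrable (fun s => p s * q s) (volume.restrict (Icc 0 T)) :=
    MemLp.integrable_mul (p := 2) (q := 2) hp hq
  calc ∫ s in Icc 0 T, (θ⁻¹ * a s + θ * p s) * q s
      = θ⁻¹ * (∫ s in Icc 0 T, a s * q s) + θ * ∫ s in Icc 0 T, p s * q s := by
        rw [← integral_const_mul, ← integral_const_mul,
          ← integral_add (i1.const_mul _) (i2.const_mul _)]
        congr 1; ext s; ring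
    _ ≤ θ⁻¹ * ((√T * A) * Q) + θ * (P * Q) := by gcongr
    _ = _ := by ring

end Nonlinearity

/-! ### A priori bound and uniqueness -/

section LinearEstimate

variable (L : L2R →L[ℝ] L2R)

/-- The uniform bound comes from the semigroup bound on [0,1]; inserted in the energy identity, it
controls the dissipation. The point is that K does not depend on T ≤ 1. -/
theorem exists_linear_estimate : ∃ K : ℝ, 1 ≤ K ∧ ∀ (T : ℝ) (F u : ℝ → L2R) (f : L2R), 0 ≤ T →
    T ≤ 1 → IntegrableOn F (Icc 0 T) →
    (∀ t ∈ Icc 0 T, u t = perturbedSemigroup L t f + duhamel L F t) →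
    (∀ t ∈ Icc 0 T, ‖u t‖ ≤ K * (‖f‖ + ∫ s in Icc 0 T, ‖F s‖)) ∧
      ∫ s in Icc 0 T, ‖weakDeriv (u s)‖ ^ 2 ≤ (K * (‖f‖ + ∫ s in Icc 0 T, ‖F s‖)) ^ 2 := by
  obtain ⟨K₀, hK₀⟩ := exists_norm_perturbedSemigroup_le L 1
  set K₁ := max K₀ 1 with hK₁
  have hK₁0 : 0 ≤ K₁ := le_trans zero_le_one (le_max_right _ _)
  have hb : ∀ t ≤ 1, ∀ f, ‖perturbedSemigroup L t f‖ ≤ K₁ * ‖f‖ := fun t ht f =>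
    (hK₀ t ht f).trans (by gcongr; exact le_max_left _ _)
  have hbig : 0 ≤ ‖L‖ * K₁ ^ 2 := by positivity
  -- The three summands account for the datum, the forcing and the perturbation in the energy
  -- identity. Their sum is at least one, hence at most its square.
  refine ⟨1 + K₁ + ‖L‖ * K₁ ^ 2, by linarith, fun T F u f hT hT1 hF hu => ?_⟩
  set I := ∫ s in Icc 0 T, ‖F s‖ with hI
  have hI0 : 0 ≤ I := integral_nonneg fun _ => norm_nonneg _
  set X := ‖f‖ + I with hX
  have hX0 : 0 ≤ X := by positivity
  have hfX : ‖f‖ ≤ X := by linarith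
  have hIX : I ≤ X := by linarith [norm_nonneg f]
  have h0 : (0 : ℝ) ∈ Icc 0 T := ⟨le_rfl, hT⟩
  have hTm : T ∈ Icc 0 T := ⟨hT, le_rfl⟩
  have hsup : ∀ t ∈ Icc 0 T, ‖u t‖ ≤ K₁ * X := by
    intro t ht
    rw [hu t ht, hX, mul_add]
    exact (norm_add_le _ _).trans (add_le_add (hb t (ht.2.trans hT1) f)
      (norm_duhamel_le L (fun t ht => hb t (ht.trans hT1)) hK₁0 hF ht))
  refine ⟨fun t ht => (hsup t ht).trans (by gcongr; linarith), ?_⟩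
  have huc := continuousOn_mild L hF hu
  have hE := (memBT_and_energy_of_mild L hT hF hu).2 T hTm
  rw [intervalIntegral.integral_of_le hT, ← integral_Icc_eq_integral_Ioc] at hE
  rw [hE]
  have e1 : ∫ s in (0 : ℝ)..T, inner ℝ (u s) (F s) ≤ K₁ * X * X := by
    have : ‖∫ s in (0 : ℝ)..T, inner ℝ (u s) (F s)‖ ≤ ∫ s in (0 : ℝ)..T, K₁ * X * ‖F s‖ := by
      apply intervalIntegral.norm_integral_le_of_norm_le hT
      · refine Eventually.of_forall fun s hs => (norm_inner_le_norm _ _).trans ?_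
        gcongr
        exact hsup s (Ioc_subset_Icc_self hs)
      · exact (intervalIntegrable_of_integrableOn_Icc hF.norm h0 hTm).const_mul _
    have hII : ∫ s in (0 : ℝ)..T, ‖F s‖ = I := by
      rw [intervalIntegral.integral_of_le hT, ← integral_Icc_eq_integral_Ioc]
    rw [intervalIntegral.integral_const_mul, hII] at this
    exact (le_abs_self _).trans (this.trans (by gcongr))
  have e2 : -∫ s in (0 : ℝ)..T, inner ℝ (u s) (L (u s)) ≤ ‖L‖ * K₁ ^ 2 * X ^ 2 := by
    have : ‖∫ s in (0 : ℝ)..T, inner ℝ (u s) (L (u s))‖ ≤ (‖L‖ * K₁ ^ 2 * X ^ 2) * |T - 0| := by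
      apply intervalIntegral.norm_integral_le_of_norm_le_const
      intro s hs
      rw [uIoc_of_le hT] at hs
      have hs' := hsup s (Ioc_subset_Icc_self hs)
      calc _ ≤ ‖u s‖ * ‖L (u s)‖ := norm_inner_le_norm _ _
        _ ≤ ‖u s‖ * (‖L‖ * ‖u s‖) := by gcongr; exact L.le_opNorm _
        _ ≤ (K₁ * X) * (‖L‖ * (K₁ * X)) := by gcongr
        _ = _ := by ring
    rw [sub_zero, abs_of_nonneg hT] at this
    have h3 : (‖L‖ * K₁ ^ 2 * X ^ 2) * T ≤ ‖L‖ * K₁ ^ 2 * X ^ 2 :=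
      mul_le_of_le_one_right (by positivity) hT1
    exact (neg_le_abs _).trans (this.trans h3)
  have e3 : 1 / 2 * ‖f‖ ^ 2 ≤ X ^ 2 := by nlinarith [norm_nonneg f]
  have e4 : 0 ≤ 1 / 2 * ‖u T‖ ^ 2 := by positivity
  have e5 : (1 + K₁ + ‖L‖ * K₁ ^ 2) * X ^ 2 ≤ ((1 + K₁ + ‖L‖ * K₁ ^ 2) * X) ^ 2 := by
    rw [mul_pow]
    gcongr
    nlinarith
  nlinarith

theorem duhamel_sub {T : ℝ} {F G : ℝ → L2R} (hF : IntegrableOn F (Icc 0 T))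
    (hG : IntegrableOn G (Icc 0 T)) {t : ℝ} (ht : t ∈ Icc 0 T) :
    duhamel L F t - duhamel L G t = duhamel L (fun s => F s - G s) t := by
  have h0 : (0 : ℝ) ∈ Icc 0 T := ⟨le_rfl, ht.1.trans ht.2⟩
  simp only [duhamel, map_sub]
  exact (intervalIntegral.integral_sub
    (intervalIntegrable_of_integrableOn_Icc (integrableOn_perturbedSemigroup L hF ht.2) h0 ht)
    (intervalIntegrable_of_integrableOn_Icc (integrableOn_perturbedSemigroup L hG ht.2) h0 ht)).symm

theorem mild_sub {T : ℝ} {F G u v : ℝ → L2R} {f : L2R} (hF : IntegrableOn F (Icc 0 T))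
    (hG : IntegrableOn G (Icc 0 T))
    (hu : ∀ t ∈ Icc 0 T, u t = perturbedSemigroup L t f + duhamel L F t)
    (hv : ∀ t ∈ Icc 0 T, v t = perturbedSemigroup L t f + duhamel L G t) :
    ∀ t ∈ Icc 0 T, (fun s => u s - v s) t =
      perturbedSemigroup L t 0 + duhamel L (fun s => F s - G s) t := by
  intro t ht
  rw [map_zero, zero_add, ← duhamel_sub L hF hG ht]
  simp only [hu t ht, hv t ht]
  abel

/-- Uniqueness of mild solutions of the semilinear equation with a given forcing term. -/
theorem eqOn_of_mild_convection {T : ℝ} {h u v : ℝ → L2R} {f : L2R} (hT : 0 ≤ T)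
    (hh : IntegrableOn h (Icc 0 T)) (huB : MemBT T u) (hvB : MemBT T v)
    (hu : ∀ t ∈ Icc 0 T, u t = perturbedSemigroup L t f +
      duhamel L (fun s => h s - convection (u s)) t)
    (hv : ∀ t ∈ Icc 0 T, v t = perturbedSemigroup L t f +
      duhamel L (fun s => h s - convection (v s)) t) : EqOn u v (Icc 0 T) := by
  have hNu := huB.integrableOn_convection
  have hNv := hvB.integrableOn_convection
  have hF : IntegrableOn (fun s => h s - convection (u s) - (h s - convection (v s))) (Icc 0 T) :=
    (hh.sub hNu).sub (hh.sub hNv)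
  obtain ⟨w, hwdef⟩ : ∃ w : ℝ → L2R, w = fun s => u s - v s := ⟨_, rfl⟩
  have hws : ∀ s, w s = u s - v s := fun s => by rw [hwdef]
  have hw : ∀ t ∈ Icc 0 T, w t = perturbedSemigroup L t 0 +
      duhamel L (fun s => h s - convection (u s) - (h s - convection (v s))) t := by
    rw [hwdef]
    exact mild_sub L (hh.sub hNu) (hh.sub hNv) hu hv
  obtain ⟨hwB, hwE⟩ := memBT_and_energy_of_mild L hT hF hw
  have h0 : (0 : ℝ) ∈ Icc 0 T := ⟨le_rfl, hT⟩
  -- What remains after two uses of Young's inequality, each absorbing one of the two copies of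
  -- ‖wₓ‖² that the doubled energy identity supplies. It is integrable because u and v are in
  -- L²(0,T;H¹).
  let a : ℝ → ℝ := fun s => 2 * ‖L‖ + 2 * ‖weakDeriv (u s)‖ + ‖weakDeriv (u s)‖ ^ 2 +
    (‖v s‖ + ‖weakDeriv (v s)‖) ^ 2
  have ha0 : ∀ s, 0 ≤ a s := fun s => by positivity
  have haI : IntegrableOn a (Icc 0 T) := by
    refine (((integrableOn_const (by simp)).add ?_).add ?_).add ?_
    · exact (huB.memLp.norm.integrable (by norm_num)).const_mul 2
    · exact huB.memLp.norm.integrable_sq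
    · exact ((memLp_two_of_continuousOn hvB.continuousOn).norm.add hvB.memLp.norm).integrable_sq
  have key := eq_zero_of_le_integral_mul (T := T) (φ := fun s => ‖w s‖ ^ 2) (a := a)
    (hwB.continuousOn.norm.pow 2) (fun _ _ => by positivity) haI ha0 (fun t ht => by
      have hsub : Ioc 0 t ⊆ Icc 0 T := Ioc_subset_Icc_self.trans (Icc_subset_Icc_right ht.2)
      have huIcc : uIcc 0 t ⊆ Icc 0 T := by
        rw [uIcc_of_le ht.1]; exact Icc_subset_Icc_right ht.2
      have hwc : ContinuousOn w (uIcc 0 t) := hwB.continuousOn.mono huIcc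
      have i1 := intervalIntegrable_inner hwc (intervalIntegrable_of_integrableOn_Icc hF h0 ht)
      have i2 : IntervalIntegrable (fun s => inner ℝ (w s) (L (w s))) volume 0 t :=
        (hwc.inner (𝕜 := ℝ) (L.continuous.comp_continuousOn hwc)).intervalIntegrable
      have i3 : IntervalIntegrable (fun s => ‖weakDeriv (w s)‖ ^ 2) volume 0 t :=
        intervalIntegrable_of_integrableOn_Icc hwB.memLp.norm.integrable_sq h0 ht
      have i4 : IntervalIntegrable (fun s => a s * ‖w s‖ ^ 2) volume 0 t :=
        (intervalIntegrable_of_integrableOn_Icc haI h0 ht).mul_continuousOn (hwc.norm.pow 2)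
      have hE := hwE t ht
      have hE' : ‖w t‖ ^ 2 = ∫ s in (0 : ℝ)..t,
          2 * ((inner ℝ (w s) (h s - convection (u s) - (h s - convection (v s))) -
            inner ℝ (w s) (L (w s))) - ‖weakDeriv (w s)‖ ^ 2) := by
        rw [intervalIntegral.integral_const_mul, intervalIntegral.integral_sub (i1.sub i2) i3,
          intervalIntegral.integral_sub i1 i2]
        rw [norm_zero] at hE
        linarith
      rw [hE']
      have hmono := intervalIntegral.integral_mono_ae_restrict ht.1
        (((i1.sub i2).sub i3).const_mul 2) i4 (by
          have h1 := ae_restrict_of_ae_restrict_of_subset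
            (Icc_subset_Icc_right ht.2) huB.memH1
          have h2 := ae_restrict_of_ae_restrict_of_subset
            (Icc_subset_Icc_right ht.2) hvB.memH1
          filter_upwards [h1, h2] with s hus hvs
          have hwH : MemH1 (w s) := by rw [hws]; exact hus.sub hvs
          have e : h s - convection (u s) - (h s - convection (v s)) =
              -(mulL2 (w s) (weakDeriv (u s)) + mulL2 (v s) (weakDeriv (w s))) := by
            rw [hws, ← hus.convection_sub hvs]; abel
          have b1 : ‖mulL2 (w s) (weakDeriv (u s))‖ ≤
              (‖w s‖ + ‖weakDeriv (w s)‖) * ‖weakDeriv (u s)‖ := by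
            simpa using hwH.norm_mulL2_le (weakDeriv (u s)) one_pos
          have b2 : ‖mulL2 (v s) (weakDeriv (w s))‖ ≤
              (‖v s‖ + ‖weakDeriv (v s)‖) * ‖weakDeriv (w s)‖ := by
            simpa using hvs.norm_mulL2_le (weakDeriv (w s)) one_pos
          have b3 : inner ℝ (w s) (h s - convection (u s) - (h s - convection (v s))) ≤
              ‖w s‖ * ((‖w s‖ + ‖weakDeriv (w s)‖) * ‖weakDeriv (u s)‖ +
                (‖v s‖ + ‖weakDeriv (v s)‖) * ‖weakDeriv (w s)‖) := by
            rw [e]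
            refine (real_inner_le_norm _ _).trans ?_
            rw [norm_neg]
            gcongr
            exact (norm_add_le _ _).trans (add_le_add b1 b2)
          have b4 : -inner ℝ (w s) (L (w s)) ≤ ‖L‖ * ‖w s‖ ^ 2 := by
            calc -inner ℝ (w s) (L (w s)) ≤ ‖w s‖ * ‖L (w s)‖ :=
                  (neg_le_abs _).trans (abs_real_inner_le_norm _ _)
              _ ≤ ‖w s‖ * (‖L‖ * ‖w s‖) := by gcongr; exact L.le_opNorm _
              _ = _ := by ring
          change 2 * ((inner ℝ (w s) (h s - convection (u s) - (h s - convection (v s))) -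
            inner ℝ (w s) (L (w s))) - ‖weakDeriv (w s)‖ ^ 2) ≤ (2 * ‖L‖ +
              2 * ‖weakDeriv (u s)‖ + ‖weakDeriv (u s)‖ ^ 2 +
              (‖v s‖ + ‖weakDeriv (v s)‖) ^ 2) * ‖w s‖ ^ 2
          set W := ‖w s‖
          set D := ‖weakDeriv (w s)‖
          set p := ‖weakDeriv (u s)‖
          set q := ‖v s‖ + ‖weakDeriv (v s)‖
          nlinarith [sq_nonneg (W * p - D), sq_nonneg (W * q - D)])
      exact hmono)
  intro t ht
  have := key t ht
  exact sub_eq_zero.1 ((hws t).symm.trans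
    (norm_eq_zero.1 (pow_eq_zero_iff (by norm_num) |>.1 this)))

end LinearEstimate

/-! ### Local existence by contraction -/

section LocalExistence

variable {T A θ : ℝ} {u v : ℝ → L2R}

theorem MemBT.integral_norm_convection_le (hu : MemBT T u) (hT : 0 ≤ T) (hθ : 0 < θ) (hA : 0 ≤ A)
    (huA : ∀ s ∈ Icc 0 T, ‖u s‖ ≤ A)
    (huA' : ∫ s in Icc 0 T, ‖weakDeriv (u s)‖ ^ 2 ≤ A ^ 2) :
    ∫ s in Icc 0 T, ‖convection (u s)‖ ≤ (θ⁻¹ * √T + θ) * A ^ 2 := by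
  have hm := (memLp_two_of_continuousOn hu.continuousOn).norm
  have hd := hu.memLp.norm
  have hb := integral_bilinear_le hT hθ hA hA hA hm (fun s hs => by simpa using huA s hs) hd hd
    huA' huA'
  refine (integral_mono_ae hu.integrableOn_convection.norm
    (MemLp.integrable_mul (p := 2) (q := 2) ((hm.const_mul θ⁻¹).add (hd.const_mul θ)) hd) ?_).trans
    (hb.trans_eq (by ring))
  filter_upwards [hu.memH1] with s hs using hs.norm_mulL2_le _ hθ

theorem MemBT.integral_norm_convection_sub_le {D : ℝ} (hu : MemBT T u) (hv : MemBT T v)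
    (huv : MemBT T fun s => u s - v s) (hT : 0 ≤ T) (hθ : 0 < θ) (hA : 0 ≤ A) (hD : 0 ≤ D)
    (huA : ∫ s in Icc 0 T, ‖weakDeriv (u s)‖ ^ 2 ≤ A ^ 2) (hvA : ∀ s ∈ Icc 0 T, ‖v s‖ ≤ A)
    (hvA' : ∫ s in Icc 0 T, ‖weakDeriv (v s)‖ ^ 2 ≤ A ^ 2)
    (hwD : ∀ s ∈ Icc 0 T, ‖u s - v s‖ ≤ D)
    (hwD' : ∫ s in Icc 0 T, ‖weakDeriv (u s - v s)‖ ^ 2 ≤ D ^ 2) :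
    ∫ s in Icc 0 T, ‖convection (u s) - convection (v s)‖ ≤
      2 * (θ⁻¹ * √T + θ) * A * D := by
  have hmv := (memLp_two_of_continuousOn hv.continuousOn).norm
  have hmw := (memLp_two_of_continuousOn huv.continuousOn).norm
  have hdu := hu.memLp.norm
  have hdv := hv.memLp.norm
  have hdw := huv.memLp.norm
  have b1 := integral_bilinear_le hT hθ hD hD hA hmw (fun s hs => by simpa using hwD s hs) hdw hdu
    hwD' huA
  have b2 := integral_bilinear_le hT hθ hA hA hD hmv (fun s hs => by simpa using hvA s hs) hdv hdw
    hvA' hwD'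
  have i1 := MemLp.integrable_mul (p := 2) (q := 2)
    ((hmw.const_mul θ⁻¹).add (hdw.const_mul θ)) hdu
  have i2 := MemLp.integrable_mul (p := 2) (q := 2)
    ((hmv.const_mul θ⁻¹).add (hdv.const_mul θ)) hdw
  refine (integral_mono_ae (hu.integrableOn_convection.sub hv.integrableOn_convection).norm
    (i1.add i2) ?_).trans ?_
  · filter_upwards [hu.memH1, hv.memH1] with s hus hvs
    change ‖convection (u s) - convection (v s)‖ ≤ _
    rw [hus.convection_sub hvs]
    exact (norm_add_le _ _).trans (add_le_add ((hus.sub hvs).norm_mulL2_le _ hθ)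
      (hvs.norm_mulL2_le _ hθ))
  · rw [integral_add' i1 i2]
    exact (add_le_add b1 b2).trans_eq (by ring)

/-- Local existence for the semilinear equation, uniformly for bounded forcing terms. -/
theorem exists_mild_convection (L : L2R →L[ℝ] L2R) (f : L2R) {M : ℝ} (hM : 0 ≤ M) :
    ∃ T₀ : ℝ, 0 < T₀ ∧ ∀ (T : ℝ) (h : ℝ → L2R), 0 < T → T ≤ T₀ → ContinuousOn h (Icc 0 T) →
      (∀ s ∈ Icc 0 T, ‖h s‖ ≤ M) → ∃ u : ℝ → L2R, MemBT T u ∧ ∀ t ∈ Icc 0 T,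
        u t = perturbedSemigroup L t f + duhamel L (fun s => h s - convection (u s)) t := by
  obtain ⟨K, hK1, hK⟩ := exists_linear_estimate L
  -- B bounds the datum plus the L¹ norm of the forcing, of which h contributes at most M and the
  -- unknown G at most one. A is the resulting bound on the solution. The choice of θ gives 2θA² =
  -- 1/4, and T ≤ θ⁴ gives θ⁻¹√T ≤ θ.
  set B := ‖f‖ + M + 1 with hBdef
  have hB : 1 ≤ B := by linarith [norm_nonneg f]
  set A := K * B with hAdef
  have hA : 1 ≤ A := by nlinarith
  have hKA : K ≤ A := by nlinarith
  set θ := 1 / (8 * A ^ 2) with hθdef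
  have hA2 : 0 < A ^ 2 := by positivity
  have hθ : 0 < θ := by positivity
  refine ⟨min 1 (θ ^ 4), by positivity, fun T h hT hTT hh hhM => ?_⟩
  have hT1 : T ≤ 1 := hTT.trans (min_le_left _ _)
  have hsq : √T ≤ θ ^ 2 := by
    rw [Real.sqrt_le_left (by positivity)]
    exact (hTT.trans (min_le_right _ _)).trans_eq (by ring)
  have hsmall : θ⁻¹ * √T + θ ≤ 2 * θ := by
    have : θ⁻¹ * √T ≤ θ⁻¹ * θ ^ 2 := by gcongr
    have e : θ⁻¹ * θ ^ 2 = θ := by field_simp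
    linarith
  have hθA : 2 * θ * A ^ 2 = 1 / 4 := by rw [hθdef]; field_simp; norm_num
  have hhI : IntegrableOn h (Icc 0 T) := hh.integrableOn_Icc
  have hhM' : ∫ s in Icc 0 T, ‖h s‖ ≤ M := by
    calc ∫ s in Icc 0 T, ‖h s‖ ≤ ∫ s in Icc 0 T, M :=
          setIntegral_mono_on hhI.norm (integrableOn_const (by simp)) measurableSet_Icc hhM
      _ = T * M := by
          rw [setIntegral_const, measureReal_def, Real.volume_Icc, sub_zero,
            ENNReal.toReal_ofReal hT.le, smul_eq_mul]
      _ ≤ M := mul_le_of_le_one_left hM hT1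
  set μ : Measure ℝ := volume.restrict (Icc 0 T) with hμ
  -- The unknown of the fixed point problem is the nonlinear term G, not u. It lives in the complete
  -- space L¹(0,T;L²), so B_T need not be given a norm.
  let U : Lp L2R 1 μ → ℝ → L2R := fun G t =>
    perturbedSemigroup L t f + duhamel L (fun s => h s - G s) t
  have hGI : ∀ G : Lp L2R 1 μ, IntegrableOn G (Icc 0 T) := fun G => L1.integrable_coeFn G
  have hFI : ∀ G : Lp L2R 1 μ, IntegrableOn (fun s => h s - G s) (Icc 0 T) := fun G =>
    hhI.sub (hGI G)
  have hU : ∀ G : Lp L2R 1 μ, ∀ t ∈ Icc 0 T,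
      U G t = perturbedSemigroup L t f + duhamel L (fun s => h s - G s) t := fun _ _ _ => rfl
  have hUB : ∀ G, MemBT T (U G) := fun G =>
    (memBT_and_energy_of_mild L hT.le (hFI G) (hU G)).1
  let Ψ : Lp L2R 1 μ → Lp L2R 1 μ := fun G =>
    (memLp_one_iff_integrable.2 (hUB G).integrableOn_convection).toLp _
  have hΨ : ∀ G, Ψ G =ᵐ[μ] fun s => convection (U G s) := fun G => MemLp.coeFn_toLp _
  have hnorm : ∀ G : Lp L2R 1 μ, ‖G‖ = ∫ s in Icc 0 T, ‖G s‖ := fun G => L1.norm_eq_integral_norm G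
  let s : Set (Lp L2R 1 μ) := Metric.closedBall 0 1
  have hs : ∀ G ∈ s, ‖G‖ ≤ 1 := fun G hG => by simpa [s] using hG
  have hest : ∀ G ∈ s, (∀ t ∈ Icc 0 T, ‖U G t‖ ≤ A) ∧
      ∫ s in Icc 0 T, ‖weakDeriv (U G s)‖ ^ 2 ≤ A ^ 2 := by
    intro G hG
    have hF : K * (‖f‖ + ∫ s in Icc 0 T, ‖h s - G s‖) ≤ A := by
      have : ∫ s in Icc 0 T, ‖h s - G s‖ ≤ M + 1 := by
        calc ∫ s in Icc 0 T, ‖h s - G s‖ ≤ ∫ s in Icc 0 T, (‖h s‖ + ‖G s‖) :=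
              integral_mono (hFI G).norm (hhI.norm.add (hGI G).norm) fun s => norm_sub_le _ _
          _ = (∫ s in Icc 0 T, ‖h s‖) + ‖G‖ := by
              rw [integral_add hhI.norm (hGI G).norm, hnorm]
          _ ≤ M + 1 := add_le_add hhM' (hs G hG)
      exact mul_le_mul_of_nonneg_left (by linarith) (by linarith)
    have hF0 : 0 ≤ K * (‖f‖ + ∫ s in Icc 0 T, ‖h s - G s‖) := by positivity
    obtain ⟨h1, h2⟩ := hK T _ _ f hT.le hT1 (hFI G) (hU G)
    exact ⟨fun t ht => (h1 t ht).trans hF, h2.trans (by gcongr)⟩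
  have hself : MapsTo Ψ s s := by
    intro G hG
    obtain ⟨h1, h2⟩ := hest G hG
    have := (hUB G).integral_norm_convection_le hT.le hθ (by positivity) h1 h2
    rw [mem_closedBall_zero_iff, hnorm]
    calc ∫ s in Icc 0 T, ‖Ψ G s‖ = ∫ s in Icc 0 T, ‖convection (U G s)‖ :=
          integral_congr_ae (by filter_upwards [hΨ G] with s hs using by rw [hs])
      _ ≤ (θ⁻¹ * √T + θ) * A ^ 2 := this
      _ ≤ 2 * θ * A ^ 2 := by gcongr
      _ ≤ 1 := by rw [hθA]; norm_num
  -- The difference of two solutions has zero datum and forcing H − G, so the linear estimate bounds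
  -- it by A‖G − H‖. The bilinear estimate then gives the factor 4θA² = 1/2.
  have hcontr : ContractingWith (1 / 2) (hself.restrict Ψ s s) := by
    refine ⟨by norm_num, LipschitzWith.of_dist_le_mul ?_⟩
    rintro ⟨G, hG⟩ ⟨H, hH⟩
    obtain ⟨g1, g2⟩ := hest G hG
    obtain ⟨h1, h2⟩ := hest H hH
    have hFF := (hFI G).sub (hFI H)
    have hmild := mild_sub L (hFI G) (hFI H) (hU G) (hU H)
    have hwB := (memBT_and_energy_of_mild L hT.le hFF hmild).1
    obtain ⟨w1, w2⟩ := hK T _ _ 0 hT.le hT1 hFF hmild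
    have hd : ∫ s in Icc 0 T, ‖h s - G s - (h s - H s)‖ = ‖G - H‖ := by
      rw [hnorm]
      apply integral_congr_ae
      filter_upwards [Lp.coeFn_sub G H] with s hs
      rw [hs, Pi.sub_apply, sub_sub_sub_cancel_left, norm_sub_rev]
    have hd' : K * (‖(0 : L2R)‖ + ∫ s in Icc 0 T, ‖h s - G s - (h s - H s)‖) ≤ A * ‖G - H‖ := by
      rw [hd, norm_zero, zero_add]
      gcongr
    have hd0 : 0 ≤ K * (‖(0 : L2R)‖ + ∫ s in Icc 0 T, ‖h s - G s - (h s - H s)‖) := by positivity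
    have hfin := (hUB G).integral_norm_convection_sub_le (hUB H) hwB hT.le hθ (by positivity)
      (D := A * ‖G - H‖) (by positivity) g2 h1 h2 (fun t ht => (w1 t ht).trans hd')
      (w2.trans (pow_le_pow_left₀ hd0 hd' 2))
    change dist (Ψ G) (Ψ H) ≤ _ * dist G H
    rw [dist_eq_norm, dist_eq_norm, hnorm]
    calc ∫ s in Icc 0 T, ‖(Ψ G - Ψ H) s‖
        = ∫ s in Icc 0 T, ‖convection (U G s) - convection (U H s)‖ := by
          apply integral_congr_ae
          filter_upwards [Lp.coeFn_sub (Ψ G) (Ψ H), hΨ G, hΨ H] with s h1 h2 h3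
          rw [h1, Pi.sub_apply, h2, h3]
      _ ≤ 2 * (θ⁻¹ * √T + θ) * A * (A * ‖G - H‖) := hfin
      _ ≤ 2 * (2 * θ) * A * (A * ‖G - H‖) := by gcongr
      _ = 2 * (2 * θ * A ^ 2) * ‖G - H‖ := by ring
      _ = _ := by rw [hθA]; norm_num
  obtain ⟨G, -, hfix, -⟩ := hcontr.exists_fixedPoint' Metric.isClosed_closedBall.isComplete hself
    (x := 0) (by simp [s]) (edist_ne_top _ _)
  -- At the fixed point G agrees with the convection term of `U G` only almost everywhere in time,
  -- which is enough inside the Duhamel integral.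
  refine ⟨U G, hUB G, fun t ht => ?_⟩
  have hG : (G : ℝ → L2R) =ᵐ[μ] fun s => convection (U G s) := by
    have := hΨ G
    rwa [hfix.eq] at this
  have hG' := ae_restrict_of_ae_restrict_of_subset
    (Ioc_subset_Icc_self.trans (Icc_subset_Icc_right ht.2)) hG
  rw [hU G t ht]
  congr 1
  rw [duhamel, duhamel, intervalIntegral.integral_of_le ht.1, intervalIntegral.integral_of_le ht.1]
  apply integral_congr_ae
  filter_upwards [hG'] with r hr
  rw [hr]

end LocalExistence

/-! ### The delay as a known forcing -/

section Delay

variable {lam : LinfR} {τ T : ℝ} {u₀ u : ℝ → L2R} (L : L2R →L[ℝ] L2R)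

theorem continuousOn_forcing {lam : LinfR} {τ T : ℝ} {u₀ : ℝ → L2R} (hTτ : T ≤ τ)
    (hu₀ : ContinuousOn u₀ (Icc (-τ) 0)) :
    ContinuousOn (fun s => -coeffMul lam (u₀ (s - τ))) (Icc 0 T) := by
  refine ((coeffMulL lam).continuous.comp_continuousOn (hu₀.comp (t := Icc (-τ) 0)
    (continuous_sub_right τ).continuousOn fun s hs => ?_)).neg
  exact ⟨by linarith [hs.1], by linarith [hs.2]⟩

/-- On `[0, τ)` a mild solution solves the semilinear equation with a given forcing term. -/
theorem mild_delayed_iff (hTτ : T < τ) (hu₀ : ContinuousOn u₀ (Icc (-τ) 0)) (huB : MemBT T u) :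
    (∀ t ∈ Icc 0 T, u t = perturbedSemigroup L t (u₀ 0)
      - (∫ s in (0 : ℝ)..t, perturbedSemigroup L (t - s) (coeffMul lam (delayed τ u₀ u s)))
      - ∫ s in (0 : ℝ)..t, perturbedSemigroup L (t - s) (mulL2 (u s) (weakDeriv (u s)))) ↔
    ∀ t ∈ Icc 0 T, u t = perturbedSemigroup L t (u₀ 0) +
      duhamel L (fun s => -coeffMul lam (u₀ (s - τ)) - convection (u s)) t := by
  refine forall₂_congr fun t ht => ?_
  have h0 : (0 : ℝ) ∈ Icc 0 T := ⟨le_rfl, ht.1.trans ht.2⟩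
  have hc := continuousOn_forcing (lam := lam) hTτ.le hu₀
  have i1 := intervalIntegrable_of_integrableOn_Icc
    (integrableOn_perturbedSemigroup L hc.integrableOn_Icc ht.2) h0 ht
  have i2 := intervalIntegrable_of_integrableOn_Icc
    (integrableOn_perturbedSemigroup L huB.integrableOn_convection ht.2) h0 ht
  have e : ∫ s in (0 : ℝ)..t, perturbedSemigroup L (t - s) (coeffMul lam (delayed τ u₀ u s)) =
      -∫ s in (0 : ℝ)..t, perturbedSemigroup L (t - s) (-coeffMul lam (u₀ (s - τ))) := by
    rw [← intervalIntegral.integral_neg]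
    apply intervalIntegral.integral_congr
    intro s hs
    rw [uIcc_of_le ht.1] at hs
    -- The strict inequality T < τ puts every s, including s = T, in the history branch of
    -- `delayed`.
    simp only [delayed, if_pos (hs.2.trans_lt (ht.2.trans_lt hTτ)), map_neg, neg_neg]
  rw [e, sub_neg_eq_add, add_sub_assoc]
  simp only [duhamel, map_sub]
  rw [intervalIntegral.integral_sub i1 i2]
  rfl

/-- The linear energy identity with forcing −λu(· − τ) − u uₓ, in which the convection term is
orthogonal to u. -/
theorem energyIdentity_of_mild (lam₀ : LinfR) (hT : 0 ≤ T) (hTτ : T < τ)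
    (hu₀ : ContinuousOn u₀ (Icc (-τ) 0)) (huB : MemBT T u)
    (hu : ∀ t ∈ Icc 0 T, u t = perturbedSemigroup (coeffMulL lam₀) t (u₀ 0) +
      duhamel (coeffMulL lam₀) (fun s => -coeffMul lam (u₀ (s - τ)) - convection (u s)) t)
    {t : ℝ} (ht : t ∈ Icc 0 T) : EnergyIdentity lam₀ lam τ u₀ u t := by
  have hF := (continuousOn_forcing (lam := lam) hTτ.le hu₀).integrableOn_Icc.sub
    huB.integrableOn_convection
  have hE := (memBT_and_energy_of_mild (coeffMulL lam₀) hT hF hu).2 t ht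
  have e1 : ∫ s in (0 : ℝ)..t, inner ℝ (u s) (-coeffMul lam (u₀ (s - τ)) - convection (u s)) =
      -∫ s in (0 : ℝ)..t, ∫ x, lam x * delayed τ u₀ u s x * u s x := by
    rw [← intervalIntegral.integral_neg]
    apply intervalIntegral.integral_congr
    intro s hs
    rw [uIcc_of_le ht.1] at hs
    have hsτ : s < τ := hs.2.trans_lt (ht.2.trans_lt hTτ)
    have hN : inner ℝ (u s) (convection (u s)) = 0 := by
      rw [real_inner_comm, convection, inner_mulL2_weakDeriv_self]
    simp only [delayed, if_pos hsτ]
    rw [inner_sub_right, hN, sub_zero, inner_neg_right, real_inner_comm, inner_coeffMul]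
  have e2 : ∫ s in (0 : ℝ)..t, inner ℝ (u s) (coeffMulL lam₀ (u s)) =
      ∫ s in (0 : ℝ)..t, ∫ x, lam₀ x * u s x ^ 2 := by
    congr 1
    ext s
    rw [real_inner_comm, coeffMulL_apply, inner_coeffMul]
    congr 1
    ext x
    ring
  have e3 := mild_zero _ hT hu
  simp only [Pi.sub_apply] at hE
  rw [e1, e2] at hE
  rw [EnergyIdentity, hE, e3]
  ring

end Delay

end

theorem proposition3p5 (lam₀ lam : LinfR) (τ : ℝ) (hτ : 0 < τ) :
    ∃ S : ℝ → L2R →L[ℝ] L2R, IsC0Semigroup S ∧ HasGenerator S (KdVBurgersGraph lam₀) ∧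
      ∀ u₀ : ℝ → L2R, ContinuousOn u₀ (Icc (-τ) 0) →
        ∃ T₀ : ℝ, 0 < T₀ ∧ ∀ T : ℝ, 0 < T → T ≤ T₀ →
          ∃ u : ℝ → L2R, IsMildSolution S lam τ u₀ T u ∧
            IntegrableOn (fun s => mulL2 (u s) (weakDeriv (u s))) (Icc 0 T) ∧
            (∀ v : ℝ → L2R, IsMildSolution S lam τ u₀ T v → EqOn v u (Icc 0 T)) ∧
            ∀ t ∈ Icc 0 T, EnergyIdentity lam₀ lam τ u₀ u t := by
  refine ⟨perturbedSemigroup (coeffMulL lam₀), isC0Semigroup_perturbedSemigroup _,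
    hasGenerator_perturbedSemigroup lam₀, fun u₀ hu₀ => ?_⟩
  -- The forcing is bounded on all of [0,τ] before T is chosen, so the existence time depends only
  -- on the data.
  obtain ⟨M, hM⟩ := isCompact_Icc.exists_bound_of_continuousOn
    (continuousOn_forcing (lam := lam) le_rfl hu₀)
  have hM0 : 0 ≤ M := (norm_nonneg _).trans (hM 0 ⟨le_rfl, hτ.le⟩)
  obtain ⟨T₁, hT₁, hex⟩ := exists_mild_convection (coeffMulL lam₀) (u₀ 0) hM0
  -- The value τ/2 serves only to make T < τ strict.
  refine ⟨min T₁ (τ / 2), lt_min hT₁ (half_pos hτ), fun T hT hTT => ?_⟩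
  have hTτ : T < τ := (hTT.trans (min_le_right _ _)).trans_lt (half_lt_self hτ)
  have hc := continuousOn_forcing (lam := lam) hTτ.le hu₀
  obtain ⟨u, huB, hu⟩ := hex T _ hT (hTT.trans (min_le_left _ _)) hc
    fun s hs => hM s ⟨hs.1, hs.2.trans hTτ.le⟩
  refine ⟨u, ⟨huB, (mild_delayed_iff _ hTτ hu₀ huB).2 hu⟩, huB.integrableOn_convection,
    fun v hv => ?_, fun t ht => energyIdentity_of_mild lam₀ hT.le hTτ hu₀ huB hu ht⟩
  exact eqOn_of_mild_convection _ hT.le hc.integrableOn_Icc hv.memBT huB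
    ((mild_delayed_iff _ hTτ hu₀ hv.memBT).1 hv.eqn) hu
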